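/- Let $(\cdot,\cdot)$ be the Hilbert symbol of $\mathbb Q_2$. For $g=\begin{pmatrix}a&b\\c&d\end{pmatrix}\in \mathrm{SL}_2(\mathbb Q_2)$ put $x(g)=c$ if $c\ne 0$ and $x(g)=d$ if $c=0$; put $s(g)=(c,d)$ if $cd\neq 0$ and $\mathrm{ord}(c)$ is odd, and $s(g)=1$ otherwise. Let $G=G(\mathbb Q_2)$ be the double cover of $\mathrm{SL}_2(\mathbb Q_2)$: the set $\mathrm{SL}_2(\mathbb Q_2)\times\mu_2$, $\mu_2=\{\pm1\}$, with the group law $$(g_1,\epsilon_1)(g_2,\epsilon_2)=(g_1g_2,\ \epsilon_1\epsilon_2\,\sigma(g_1,g_2)),\qquad \sigma(g_1,g_2)=(x(g_1g_2)x(g_1),\,x(g_1g_2)x(g_2))\,s(g_1)s(g_2)s(g_1g_2),$$ and the topology for which the sets $g\cdot\{(k,1): k\in \mathrm{SL}_2(\mathbb Z_2),\ k\equiv 1 \bmod 2^n\}$, $n\ge 2$, form a basis of neighbourhoods of each $g \in G$. For $t\in\mathbb Q_2^\times$ put $h(t)=\left(\begin{pmatrix}t&0\\0&t^{-1}\end{pmatrix},1\right)$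 and $w(t)=\left(\begin{pmatrix}0&t\\-t^{-1}&0\end{pmatrix},1\right)$. Let $T$ be the subgroup generated by all $h(t)$, and let $M$ be the center of $G$, which is cyclic of order $4$, generated by $h(-1)$. Let $K_0\subset G$ be the inverse image of $\left\{\begin{pmatrix}a&b\\c&d\end{pmatrix}\in \mathrm{SL}_2(\mathbb Z_2): c\in4\mathbb Z_2\right\}$, and let $K_1=\left\{\left(\begin{pmatrix}a&b\\c&d\end{pmatrix},1\right): \begin{pmatrix}a&b\\c&d\end{pmatrix}\in \mathrm{SL}_2(\mathbb Z_2),\ a\in1+4\mathbb Z_2,\ c\in4\mathbb Z_2\right\}$, so that $K_0=M\times K_1$. Let $\gamma$ be a genuine character of $M$, that is, a character that is non-trivial on $\mu_2$. Extend $\gamma$ to $K_0$ so that it is trivial on $K_1$, and to the normalizer $N_G(T)$ so that it is trivial on $K_1\cap T$, $\gamma(h(2^n))=1$ for all $n\in\mathbb Z$, and $\gamma(w(1))=\zeta:=\frac{1+\gamma(h(-1))}{\sqrt2}$. Let $H(\gamma)$ be the space of locally constant compactly supported functions $f:G\to\mathbb C$ with $$f(k_0gk_0')=\overline{\gamma}(k_0)f(g)\overline{\gamma}(k_0')\qquad\text{for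 all } k_0,k_0'\in K_0,\ g\in G,$$ with the product $(f_1\cdot f_2)(g_0)=\int_Gf_1(g)f_2(g^{-1}g_0)\,dg$, where $dg$ is the Haar measure on $G$ for which $K_0$ has measure $1$. For $g\in N_G(T)$ let $X_g\in H(\gamma)$ be the function supported on $K_0gK_0$ with $X_g(k_0gk_0')=\overline\gamma(k_0)\overline\gamma(g)\overline\gamma(k_0')$ for $k_0,k_0'\in K_0$. Put $U_n=X_{w(2^{-n})}$ and $T_w=\sqrt2^{\,-1}U_0$. **Theorem.** $H(\gamma)$ is a unital associative $\mathbb C$-algebra with unit $X_1$, and it is generated by $T_w$ and $U_1$ as an abstract $\mathbb C$-algebra modulo the relations (a) $(T_w-2)(T_w+1)=0$ and (b) $U_1^2=1$. That is, the quotient of the free associative unital algebra $\mathbb C\langle t,u\rangle$ by the two-sided ideal generated by $(t-2)(t+1)$ and $u^2-1$ is isomorphic to $H(\gamma)$ by an isomorphism of $\mathbb C$-algebras that sends $t$ to $T_w$ and $u$ to $U_1$. -/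

import Mathlib

open MeasureTheory
open scoped MatrixGroups

namespace DoubleCover

open Classical in
/-- The Hilbert symbol of `ℚ₂`. -/
noncomputable def hilbert (a b : ℚ_[2]) : ℤˣ :=
  if ∃ x y z : ℚ_[2], ¬(x = 0 ∧ y = 0 ∧ z = 0) ∧ z ^ 2 = a * x ^ 2 + b * y ^ 2 then 1 else -1

/-- `b` is a value of the norm form `u² - a v²` (auxiliary, for the bilinearity of the symbol). -/
def IsNormFrom (a b : ℚ_[2]) : Prop := ∃ u v : ℚ_[2], b = u ^ 2 - a * v ^ 2

theorem hilbert_eq_one_iff {a b : ℚ_[2]} (ha : a ≠ 0) :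
    hilbert a b = 1 ↔ IsNormFrom a b := by
  unfold hilbert IsNormFrom
  split_ifs with h
  · refine ⟨fun _ => ?_, fun _ => rfl⟩
    obtain ⟨x, y, z, h0, h⟩ := h
    by_cases hy : y = 0
    · subst hy
      have hx : x ≠ 0 := by
        rintro rfl
        apply h0
        simpa using h
      have hz : z ≠ 0 := by
        rintro rfl
        have : a * x ^ 2 = 0 := by linear_combination -h
        simp_all
      refine ⟨(b + 1) / 2, (b - 1) * x / (2 * z), ?_⟩
      have h2 : a * x ^ 2 = z ^ 2 := by linear_combination -h
      field_simp
      linear_combination (-(b - 1) ^ 2) * h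
    · refine ⟨z / y, x / y, ?_⟩
      field_simp
      linear_combination -h
  · refine ⟨fun h1 => absurd h1 (by decide), fun h1 => absurd ?_ h⟩
    obtain ⟨u, v, h1⟩ := h1
    refine ⟨v, 1, u, by simp, by linear_combination -h1⟩

namespace IsNormFrom

theorem mul {a b c : ℚ_[2]} (hb : IsNormFrom a b) (hc : IsNormFrom a c) :
    IsNormFrom a (b * c) := by
  obtain ⟨u, v, rfl⟩ := hb
  obtain ⟨s, t, rfl⟩ := hc
  exact ⟨u * s + a * v * t, u * t + v * s, by ring⟩

theorem sq (a t : ℚ_[2]) : IsNormFrom a (t ^ 2) := ⟨t, 0, by ring⟩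

theorem of_mul_sq {a b t : ℚ_[2]} (ht : t ≠ 0) (h : IsNormFrom a (b * t ^ 2)) :
    IsNormFrom a b := by
  have := h.mul (sq a t⁻¹)
  rwa [mul_assoc, ← mul_pow, mul_inv_cancel₀ ht, one_pow, mul_one] at this

theorem mul_sq_left {a b t : ℚ_[2]} (ht : t ≠ 0) :
    IsNormFrom (a * t ^ 2) b ↔ IsNormFrom a b := by
  constructor
  · rintro ⟨u, v, rfl⟩
    exact ⟨u, t * v, by ring⟩
  · rintro ⟨u, v, rfl⟩
    exact ⟨u, v / t, by field_simp⟩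

end IsNormFrom

theorem exists_sqrt (u : ℤ_[2]) (hu : ‖u - 1‖ ≤ 1 / 8) : ∃ t : ℚ_[2], t ^ 2 = (u : ℚ_[2]) := by
  have h2 : ‖(2 : ℤ_[2])‖ = 1 / 2 := by
    have := PadicInt.norm_p (p := 2)
    simpa using this
  obtain ⟨z, hz, -⟩ := hensels_lemma (p := 2) (R := ℤ_[2]) (F := Polynomial.X ^ 2 - Polynomial.C u)
    (a := 1) (by
      simp
      rw [← norm_neg, neg_sub, one_add_one_eq_two, h2]
      norm_num at hu ⊢
      linarith)
  refine ⟨z, ?_⟩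
  have : z ^ 2 = u := by simpa [sub_eq_zero] using hz
  rw [← this]
  simp

theorem exists_sqrt_of_dvd (n : ℤ) (h : (8 : ℤ) ∣ n - 1) : ∃ t : ℚ_[2], t ^ 2 = (n : ℚ_[2]) := by
  obtain ⟨t, ht⟩ := exists_sqrt (n : ℤ_[2]) (by
    have := (PadicInt.norm_int_le_pow_iff_dvd (p := 2) (k := n - 1) (n := 3)).2
      (by exact_mod_cast h)
    push_cast at this
    norm_num at this ⊢
    exact this)
  exact ⟨t, by rw [ht]; simp⟩

theorem square_class (b : ℚ_[2]) (hb : b ≠ 0) :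
    ∃ (q : ℤ) (t : ℚ_[2]), t ≠ 0 ∧ (q = 1 ∨ q = -1 ∨ q = 3 ∨ q = -3) ∧
      (b = q * t ^ 2 ∨ b = 2 * q * t ^ 2) := by
  have key : ∀ u : ℤ_[2], ‖u‖ = 1 → ∃ (q : ℤ) (t : ℚ_[2]), t ≠ 0 ∧
      (q = 1 ∨ q = -1 ∨ q = 3 ∨ q = -3) ∧ (u : ℚ_[2]) = q * t ^ 2 := by
    intro u hu
    set r : ZMod (2 ^ 3) := PadicInt.toZModPow 3 u with hr
    have hunit : IsUnit r := (PadicInt.isUnit_iff.2 hu).map _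
    have : ∃ q : ℤ, (q = 1 ∨ q = -1 ∨ q = 3 ∨ q = -3) ∧ r * q = 1 := by
      have : ∀ r : ZMod (2 ^ 3), IsUnit r → r * ((1 : ℤ)) = 1 ∨ r * ((-1 : ℤ)) = 1 ∨
        r * ((3 : ℤ)) = 1 ∨ r * ((-3 : ℤ)) = 1 := by
        push_cast
        decide
      rcases this r hunit with h | h | h | h
      · exact ⟨1, by simp, h⟩
      · exact ⟨-1, by simp, h⟩
      · exact ⟨3, by simp, h⟩
      · exact ⟨-3, by simp, h⟩
    obtain ⟨q, hq, h1⟩ := this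
    have hq0 : (q : ℚ_[2]) ≠ 0 := by
      rcases hq with rfl | rfl | rfl | rfl <;> norm_num
    have hu0 : (u : ℚ_[2]) ≠ 0 := by
      intro h
      have : ‖(u : ℚ_[2])‖ = 1 := hu
      simp [h] at this
    obtain ⟨t, ht⟩ := exists_sqrt (u * q) (by
      have h3 : u * q - 1 ∈ RingHom.ker (PadicInt.toZModPow 3 : ℤ_[2] →+* ZMod (2 ^ 3)) := by
        rw [RingHom.mem_ker, map_sub, map_mul, map_one, map_intCast, ← hr, h1, sub_self]
      rw [PadicInt.ker_toZModPow, ← PadicInt.norm_le_pow_iff_mem_span_pow] at h3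
      norm_num at h3 ⊢
      exact h3)
    have ht' : t ^ 2 = u * q := by rw [ht]; simp
    refine ⟨q, t / q, ?_, hq, ?_⟩
    · have : t ≠ 0 := by
        rintro rfl
        have : (u : ℚ_[2]) * q = 0 := by rw [← ht']; simp
        simp_all
      exact div_ne_zero this hq0
    · field_simp
      linear_combination -ht'
  set n := b.valuation with hn
  have h2 : (2 : ℚ_[2]) ≠ 0 := two_ne_zero
  have hnb : ‖b * (2 : ℚ_[2]) ^ (-n)‖ = 1 := by
    rw [norm_mul, Padic.norm_eq_zpow_neg_valuation hb, norm_zpow]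
    have : ‖(2 : ℚ_[2])‖ = 2⁻¹ := by
      have := Padic.norm_p (p := 2)
      simpa using this
    rw [this, ← hn]
    simp only [zpow_neg, inv_zpow, inv_inv, Nat.cast_ofNat]
    exact inv_mul_cancel₀ (zpow_ne_zero _ two_ne_zero)
  obtain ⟨q, t, ht, hq, h⟩ := key ⟨b * (2 : ℚ_[2]) ^ (-n), hnb.le⟩ hnb
  have hb' : b = q * t ^ 2 * 2 ^ n := by
    rw [← h]
    simp only [mul_assoc]
    rw [← zpow_add₀ h2]
    simp
  rcases Int.even_or_odd' n with ⟨k, hk | hk⟩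
  · refine ⟨q, t * 2 ^ k, mul_ne_zero ht (zpow_ne_zero _ h2), hq, Or.inl ?_⟩
    rw [hb', hk, two_mul, zpow_add₀ h2]
    ring
  · refine ⟨q, t * 2 ^ k, mul_ne_zero ht (zpow_ne_zero _ h2), hq, Or.inr ?_⟩
    rw [hb', hk, two_mul, zpow_add₀ h2, zpow_add₀ h2, zpow_one]
    ring

/-- The norm group has index at most two. -/
theorem norm_index_of {a c : ℚ_[2]} (hc : c ≠ 0)
    (h1 : IsNormFrom a (-1) ∨ IsNormFrom a (-1 * c))
    (h3 : IsNormFrom a 3 ∨ IsNormFrom a (3 * c))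
    (h2 : IsNormFrom a 2 ∨ IsNormFrom a (2 * c)) (b : ℚ_[2]) (hb : b ≠ 0) :
    IsNormFrom a b ∨ IsNormFrom a (b * c) := by
  have hmul : ∀ x y, (IsNormFrom a x ∨ IsNormFrom a (x * c)) →
      (IsNormFrom a y ∨ IsNormFrom a (y * c)) →
      (IsNormFrom a (x * y) ∨ IsNormFrom a (x * y * c)) := by
    rintro x y (hx | hx) (hy | hy)
    · exact Or.inl (hx.mul hy)
    · exact Or.inr (by simpa only [mul_assoc] using hx.mul hy)
    · refine Or.inr ?_
      have := hx.mul hy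
      rwa [show x * c * y = x * y * c by ring] at this
    · refine Or.inl (IsNormFrom.of_mul_sq hc ?_)
      have := hx.mul hy
      rwa [show x * c * (y * c) = x * y * c ^ 2 by ring] at this
  have hsq : ∀ t, IsNormFrom a (t ^ 2) ∨ IsNormFrom a (t ^ 2 * c) :=
    fun t => Or.inl (IsNormFrom.sq a t)
  obtain ⟨q, t, -, hq, h⟩ := square_class b hb
  have hqq : IsNormFrom a (q : ℚ_[2]) ∨ IsNormFrom a ((q : ℚ_[2]) * c) := by
    rcases hq with rfl | rfl | rfl | rfl
    · simpa using hsq 1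
    · simpa using h1
    · simpa using h3
    · have := hmul _ _ h1 h3
      rw [show (-1 : ℚ_[2]) * 3 = ((-3 : ℤ) : ℚ_[2]) by norm_num] at this
      exact this
  rcases h with rfl | rfl
  · exact hmul _ _ hqq (hsq t)
  · exact hmul _ _ (hmul _ _ h2 hqq) (hsq t)

theorem norm_index (a : ℚ_[2]) (ha : a ≠ 0) :
    ∃ c : ℚ_[2], c ≠ 0 ∧ ∀ b : ℚ_[2], b ≠ 0 → IsNormFrom a b ∨ IsNormFrom a (b * c) := by
  obtain ⟨r, hr⟩ := exists_sqrt_of_dvd (-7) (by norm_num)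
  obtain ⟨s, hs⟩ := exists_sqrt_of_dvd (-15) (by norm_num)
  push_cast at hr hs
  have hr0 : r ≠ 0 := by rintro rfl; norm_num at hr
  obtain ⟨q, t, ht, hq, h⟩ := square_class a ha
  have red : ∀ a' c : ℚ_[2], c ≠ 0 → a = a' * t ^ 2 →
      (IsNormFrom a' (-1) ∨ IsNormFrom a' (-1 * c)) →
      (IsNormFrom a' 3 ∨ IsNormFrom a' (3 * c)) →
      (IsNormFrom a' 2 ∨ IsNormFrom a' (2 * c)) → ∃ c : ℚ_[2], c ≠ 0 ∧
        ∀ b : ℚ_[2], b ≠ 0 → IsNormFrom a b ∨ IsNormFrom a (b * c) := by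
    intro a' c hc h h1 h3 h2
    refine ⟨c, hc, fun b hb => ?_⟩
    rw [h, IsNormFrom.mul_sq_left ht, IsNormFrom.mul_sq_left ht]
    exact norm_index_of hc h1 h3 h2 b hb
  rcases h with h | h
  · rcases hq with rfl | rfl | rfl | rfl
    · exact red 1 1 one_ne_zero (by simpa using h) (Or.inl ⟨0, 1, by ring⟩)
        (Or.inl ⟨2, 1, by ring⟩) (Or.inl ⟨3 / 2, 1 / 2, by ring⟩)
    · exact red (-1) (-1) (by norm_num) (by simpa using h) (Or.inr ⟨1, 0, by ring⟩)
        (Or.inr ⟨s / 5, 2 * s / 5, by linear_combination (-1 / 5) * hs⟩) (Or.inl ⟨1, 1, by ring⟩)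
    · exact red 3 (-1) (by norm_num) (by simpa using h) (Or.inr ⟨1, 0, by ring⟩)
        (Or.inr ⟨0, 1, by ring⟩) (Or.inr ⟨1, 1, by ring⟩)
    · exact red (-3) 2 (by norm_num) (by simpa using h)
        (Or.inl ⟨2 / r, 1 / r, by field_simp; linear_combination -hr⟩)
        (Or.inl ⟨0, 1, by ring⟩) (Or.inr ⟨2, 0, by ring⟩)
  · rcases hq with rfl | rfl | rfl | rfl
    · exact red 2 3 (by norm_num) (by simpa using h) (Or.inl ⟨1, 1, by ring⟩)
        (Or.inr ⟨3, 0, by ring⟩) (Or.inl ⟨2, 1, by ring⟩)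
    · exact red (-2) (-1) (by norm_num) (by simpa using h) (Or.inr ⟨1, 0, by ring⟩)
        (Or.inl ⟨1, 1, by ring⟩) (Or.inl ⟨0, 1, by ring⟩)
    · exact red 6 (-1) (by norm_num) (by rw [h]; push_cast; ring) (Or.inr ⟨1, 0, by ring⟩)
        (Or.inl ⟨3, 1, by ring⟩) (Or.inr ⟨2, 1, by ring⟩)
    · exact red (-6) 3 (by norm_num) (by rw [h]; push_cast; ring)
        (Or.inl ⟨1 / r, 1 / r, by field_simp; linear_combination -hr⟩)
        (Or.inr ⟨3, 0, by ring⟩) (Or.inr ⟨0, 1, by ring⟩)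

theorem hilbert_symm (a b : ℚ_[2]) : hilbert a b = hilbert b a := by
  unfold hilbert
  congr 1
  apply propext
  constructor <;>
  · rintro ⟨x, y, z, h0, h⟩
    exact ⟨y, x, z, fun h1 => h0 ⟨h1.2.1, h1.1, h1.2.2⟩, by rw [h]; ring⟩

theorem hilbert_mul_right {a b c : ℚ_[2]} (ha : a ≠ 0) (hb : b ≠ 0) (hc : c ≠ 0) :
    hilbert a (b * c) = hilbert a b * hilbert a c := by
  have iff1 := fun {x : ℚ_[2]} (_ : x ≠ 0) => hilbert_eq_one_iff (b := x) ha
  have hbc := mul_ne_zero hb hc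
  have neg : ∀ {x : ℚ_[2]}, x ≠ 0 → ¬ IsNormFrom a x → hilbert a x = -1 := fun hx h =>
    (Int.units_eq_one_or _).resolve_left (fun h1 => h ((iff1 hx).1 h1))
  have cancel : ∀ {x y : ℚ_[2]}, x ≠ 0 → IsNormFrom a x → IsNormFrom a (x * y) →
      IsNormFrom a y := by
    intro x y hx h1 h2
    refine IsNormFrom.of_mul_sq hx ?_
    have := h1.mul h2
    rwa [show x * (x * y) = y * x ^ 2 by ring] at this
  by_cases h1 : IsNormFrom a b <;> by_cases h2 : IsNormFrom a c
  · rw [(iff1 hb).2 h1, (iff1 hc).2 h2, (iff1 hbc).2 (h1.mul h2), one_mul]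
  · rw [(iff1 hb).2 h1, neg hc h2, neg hbc (fun h => h2 (cancel hb h1 h)), one_mul]
  · rw [(iff1 hc).2 h2, neg hb h1, neg hbc (fun h => h1 (cancel hc h2 (by rwa [mul_comm]))),
      mul_one]
  · obtain ⟨d, hd, hidx⟩ := norm_index a ha
    have h1' := (hidx b hb).resolve_left h1
    have h2' := (hidx c hc).resolve_left h2
    rw [neg hb h1, neg hc h2, (iff1 hbc).2]
    · rfl
    · refine IsNormFrom.of_mul_sq hd ?_
      have := h1'.mul h2'
      rwa [show b * d * (c * d) = b * c * d ^ 2 by ring] at this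

theorem hilbert_of_add_eq_one {a b : ℚ_[2]} (h : a + b = 1) : hilbert a b = 1 := by
  unfold hilbert
  rw [if_pos ⟨1, 1, 1, by simp, by linear_combination -h⟩]

theorem hilbert_self_neg (a : ℚ_[2]) : hilbert a (-a) = 1 := by
  unfold hilbert
  rw [if_pos ⟨1, 1, 0, by simp, by ring⟩]

theorem hilbert_sq (a : ℚ_[2]) (t : ℚ_[2]) : hilbert a (t ^ 2) = 1 := by
  unfold hilbert
  rw [if_pos ⟨0, 1, t, by simp, by ring⟩]


/-- The entry `x(g)` of a matrix `g` with bottom row `(c, d)`: it is `c` if `c ≠ 0`, and `d` if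
`c = 0`. -/
noncomputable def xEntry (g : SL(2, ℚ_[2])) : ℚ_[2] :=
  open Classical in if g 1 0 ≠ 0 then g 1 0 else g 1 1

/-- The sign `s(g)` of a matrix `g` with bottom row `(c, d)`: it is the Hilbert symbol `(c, d)` if
`c d ≠ 0` and `c` has odd valuation, and `1` otherwise. -/
noncomputable def sSign (g : SL(2, ℚ_[2])) : ℤˣ :=
  open Classical in
  if g 1 0 * g 1 1 ≠ 0 ∧ Odd (g 1 0).valuation then hilbert (g 1 0) (g 1 1) else 1

/-- The two-cocycle defining the double cover. -/
noncomputable def cocycle (g h : SL(2, ℚ_[2])) : ℤˣ :=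
  hilbert (xEntry (g * h) * xEntry g) (xEntry (g * h) * xEntry h) *
    sSign g * sSign h * sSign (g * h)

theorem xEntry_ne_zero (g : SL(2, ℚ_[2])) : xEntry g ≠ 0 := by
  unfold xEntry
  split_ifs with h
  · exact h
  · intro h1
    have := g.det_coe
    rw [Matrix.det_fin_two] at this
    simp_all

/-- The additive form of the Hilbert symbol. -/
noncomputable def addHilbert (a b : ℚ_[2]) : ZMod 2 :=
  open Classical in if hilbert a b = 1 then 0 else 1

theorem addHilbert_mul_right {a b c : ℚ_[2]} (ha : a ≠ 0) (hb : b ≠ 0) (hc : c ≠ 0) :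
    addHilbert a (b * c) = addHilbert a b + addHilbert a c := by
  unfold addHilbert
  rw [hilbert_mul_right ha hb hc]
  rcases Int.units_eq_one_or (hilbert a b) with h | h <;>
  rcases Int.units_eq_one_or (hilbert a c) with h' | h' <;> rw [h, h'] <;> decide

theorem addHilbert_symm (a b : ℚ_[2]) : addHilbert a b = addHilbert b a := by
  unfold addHilbert
  rw [hilbert_symm]

theorem addHilbert_mul_left {a b c : ℚ_[2]} (ha : a ≠ 0) (hb : b ≠ 0) (hc : c ≠ 0) :
    addHilbert (b * c) a = addHilbert b a + addHilbert c a := by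
  rw [addHilbert_symm, addHilbert_mul_right ha hb hc, addHilbert_symm a b, addHilbert_symm a c]

theorem addHilbert_self_neg (a : ℚ_[2]) : addHilbert a (-a) = 0 := by
  simp [addHilbert, hilbert_self_neg]

theorem addHilbert_self {a : ℚ_[2]} (ha : a ≠ 0) : addHilbert a a = addHilbert (-1) a := by
  have h := addHilbert_self_neg a
  rw [← neg_one_mul, addHilbert_mul_right ha (by norm_num) ha, addHilbert_symm a (-1)] at h
  have h2 : (2 : ZMod 2) = 0 := rfl
  linear_combination h - addHilbert (-1) a * h2

/-- The relation in the Hilbert symbols that results from `b r + a c = p q`. -/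
theorem addHilbert_relation {a b c p q r : ℚ_[2]} (h : b * r + a * c = p * q) :
    addHilbert (b * r * (p * q)) (a * c * (p * q)) = 0 := by
  have h1 : hilbert (b * r * (p * q)) (a * c * (p * q)) = 1 := by
    unfold hilbert
    rw [if_pos ⟨1, 1, p * q, by simp, by linear_combination (-p * q) * h⟩]
  simp [addHilbert, h1]

/-- The cocycle without its coboundary factor, in additive form. -/
noncomputable def addCocycle (p a b : ℚ_[2]) : ZMod 2 := addHilbert (p * a) (p * b)

theorem addCocycle_eq {p a b : ℚ_[2]} (hp : p ≠ 0) (ha : a ≠ 0) (hb : b ≠ 0) :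
    addCocycle p a b =
      addHilbert (-1) p + addHilbert p a + addHilbert p b + addHilbert a b := by
  unfold addCocycle
  rw [addHilbert_mul_left (mul_ne_zero hp hb) hp ha, addHilbert_mul_right hp hp hb,
    addHilbert_mul_right ha hp hb, addHilbert_self hp, addHilbert_symm a p]
  ring

theorem addHilbert_mul_mul {a b c d : ℚ_[2]} (ha : a ≠ 0) (hb : b ≠ 0) (hc : c ≠ 0)
    (hd : d ≠ 0) : addHilbert (a * b) (c * d) =
      addHilbert a c + addHilbert a d + addHilbert b c + addHilbert b d := by
  rw [addHilbert_mul_left (mul_ne_zero hc hd) ha hb, addHilbert_mul_right ha hc hd,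
    addHilbert_mul_right hb hc hd]
  ring

theorem xEntry_of_ne {g : SL(2, ℚ_[2])} (h : g 1 0 ≠ 0) : xEntry g = g 1 0 := by
  simp [xEntry, h]

theorem xEntry_of_eq {g : SL(2, ℚ_[2])} (h : g 1 0 = 0) : xEntry g = g 1 1 := by
  simp [xEntry, h]

theorem mul_entry (g h : SL(2, ℚ_[2])) (i j : Fin 2) :
    (g * h) i j = g i 0 * h 0 j + g i 1 * h 1 j := by
  simp [Matrix.mul_apply, Fin.sum_univ_two]

theorem xEntry_mul_of_left {g h : SL(2, ℚ_[2])} (h0 : g 1 0 = 0) :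
    xEntry (g * h) = xEntry g * xEntry h := by
  have hd : g 1 1 ≠ 0 := by
    rw [← xEntry_of_eq h0]
    exact xEntry_ne_zero g
  rw [xEntry_of_eq h0]
  by_cases hc : h 1 0 = 0
  · rw [xEntry_of_eq hc, xEntry_of_eq (by simp [mul_entry, h0, hc])]
    simp [mul_entry, h0]
  · rw [xEntry_of_ne hc, xEntry_of_ne (by simp [mul_entry, h0, hc, hd])]
    simp [mul_entry, h0]

theorem xEntry_mul_of_right {g h : SL(2, ℚ_[2])} (h0 : h 1 0 = 0) :
    ∃ t : ℚ_[2], t ≠ 0 ∧ xEntry (g * h) * t ^ 2 = xEntry g * xEntry h := by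
  have hd : h 1 1 ≠ 0 := by
    rw [← xEntry_of_eq h0]
    exact xEntry_ne_zero h
  have hdet : h 0 0 * h 1 1 = 1 := by
    have := h.det_coe
    rw [Matrix.det_fin_two] at this
    linear_combination this + h 0 1 * h0
  have ha : h 0 0 ≠ 0 := left_ne_zero_of_mul_eq_one hdet
  rw [xEntry_of_eq h0]
  by_cases hc : g 1 0 = 0
  · refine ⟨1, one_ne_zero, ?_⟩
    rw [xEntry_of_eq hc, xEntry_of_eq (by simp [mul_entry, h0, hc])]
    simp [mul_entry, hc]
  · refine ⟨h 1 1, hd, ?_⟩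
    rw [xEntry_of_ne hc, xEntry_of_ne (by simp [mul_entry, h0, hc, ha])]
    simp only [mul_entry, h0]
    linear_combination (g 1 0 * h 1 1) * hdet

theorem addHilbert_sq_mul {a b t : ℚ_[2]} (ha : a ≠ 0) (hb : b ≠ 0) (ht : t ≠ 0) :
    addHilbert (b * t ^ 2) a = addHilbert b a := by
  have h2 : (2 : ZMod 2) = 0 := rfl
  rw [pow_two, addHilbert_mul_left ha hb (mul_ne_zero ht ht), addHilbert_mul_left ha ht ht]
  linear_combination addHilbert t a * h2

theorem addHilbert_congr {x y z t a : ℚ_[2]} (ha : a ≠ 0) (hx : x ≠ 0) (hy : y ≠ 0) (hz : z ≠ 0)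
    (ht : t ≠ 0) (h : x * t ^ 2 = y * z) : addHilbert x a = addHilbert y a + addHilbert z a := by
  rw [← addHilbert_sq_mul ha hx ht, h, addHilbert_mul_left ha hy hz]

theorem addCocycle_identity (g₁ g₂ g₃ : SL(2, ℚ_[2])) :
    addCocycle (xEntry (g₁ * g₂)) (xEntry g₁) (xEntry g₂) +
      addCocycle (xEntry (g₁ * g₂ * g₃)) (xEntry (g₁ * g₂)) (xEntry g₃) =
    addCocycle (xEntry (g₁ * g₂ * g₃)) (xEntry g₁) (xEntry (g₂ * g₃)) +
      addCocycle (xEntry (g₂ * g₃)) (xEntry g₂) (xEntry g₃) := by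
  have hA := xEntry_ne_zero g₁
  have hB := xEntry_ne_zero g₂
  have hC := xEntry_ne_zero g₃
  have hP := xEntry_ne_zero (g₁ * g₂)
  have hQ := xEntry_ne_zero (g₂ * g₃)
  have hR := xEntry_ne_zero (g₁ * g₂ * g₃)
  have hN : (-1 : ℚ_[2]) ≠ 0 := by norm_num
  have det : g₂ 0 0 * g₂ 1 1 - g₂ 0 1 * g₂ 1 0 = 1 := by
    rw [← Matrix.det_fin_two, g₂.det_coe]
  have rel : g₂ 1 0 * (g₁ * g₂ * g₃) 1 0 + g₁ 1 0 * g₃ 1 0 =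
      (g₁ * g₂) 1 0 * (g₂ * g₃) 1 0 := by
    simp only [mul_entry]
    linear_combination (-g₁ 1 0 * g₃ 1 0) * det
  have hself : ∀ {x : ℚ_[2]}, x ≠ 0 → addHilbert x x = addHilbert (-1) x := addHilbert_self
  rw [addCocycle_eq hP hA hB, addCocycle_eq hR hP hC, addCocycle_eq hR hA hQ,
    addCocycle_eq hQ hB hC]
  have key1 : g₁ 1 0 = 0 → xEntry (g₁ * g₂) = xEntry g₁ * xEntry g₂ ∧
      xEntry (g₁ * g₂ * g₃) = xEntry g₁ * xEntry (g₂ * g₃) := fun h =>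
    ⟨xEntry_mul_of_left h, by rw [mul_assoc, xEntry_mul_of_left h]⟩
  have key2l : g₂ 1 0 = 0 → xEntry (g₂ * g₃) = xEntry g₂ * xEntry g₃ := xEntry_mul_of_left
  have key2r : g₂ 1 0 = 0 → ∃ t : ℚ_[2], t ≠ 0 ∧
      xEntry (g₁ * g₂) * t ^ 2 = xEntry g₁ * xEntry g₂ := xEntry_mul_of_right
  have key3 : g₃ 1 0 = 0 → ∃ t : ℚ_[2], t ≠ 0 ∧
      xEntry (g₂ * g₃) * t ^ 2 = xEntry g₂ * xEntry g₃ := xEntry_mul_of_right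
  have key3' : g₃ 1 0 = 0 → ∃ t : ℚ_[2], t ≠ 0 ∧
      xEntry (g₁ * g₂ * g₃) * t ^ 2 = xEntry (g₁ * g₂) * xEntry g₃ := xEntry_mul_of_right
  have e1 := fun h => xEntry_of_ne (g := g₁) h
  have e2 := fun h => xEntry_of_ne (g := g₂) h
  have e3 := fun h => xEntry_of_ne (g := g₃) h
  have e12 := fun h => xEntry_of_ne (g := g₁ * g₂) h
  have e23 := fun h => xEntry_of_ne (g := g₂ * g₃) h
  have e123 := fun h => xEntry_of_ne (g := g₁ * g₂ * g₃) h
  generalize xEntry g₁ = A at *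
  generalize xEntry g₂ = B at *
  generalize xEntry g₃ = C at *
  generalize xEntry (g₁ * g₂) = P at *
  generalize xEntry (g₂ * g₃) = Q at *
  generalize xEntry (g₁ * g₂ * g₃) = R at *
  generalize g₁ 1 0 = a at *
  generalize g₂ 1 0 = b at *
  generalize g₃ 1 0 = c at *
  generalize (g₁ * g₂) 1 0 = p at *
  generalize (g₂ * g₃) 1 0 = q at *
  generalize (g₁ * g₂ * g₃) 1 0 = r at *
  by_cases ha : a = 0
  · obtain ⟨rfl, rfl⟩ := key1 ha
    have sB := addHilbert_symm B A
    simp only [addHilbert_mul_right, addHilbert_mul_left, hA, hB, hC, hQ, hN, hself,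
      ne_eq, not_false_eq_true, mul_ne_zero_iff, and_self, addHilbert_symm _ A]
    grind
  by_cases hc : c = 0
  · obtain ⟨t, ht, hQ'⟩ := key3 hc
    obtain ⟨s, hs, hR'⟩ := key3' hc
    have q1 := fun x hx => addHilbert_congr (a := x) hx hQ hB hC ht hQ'
    have r1 := fun x hx => addHilbert_congr (a := x) hx hR hP hC hs hR'
    have := addHilbert_symm
    grind
  by_cases hb : b = 0
  · obtain ⟨t, ht, hP'⟩ := key2r hb
    have hQ' := key2l hb
    have q1 := fun x hx => addHilbert_congr (a := x) (t := 1) hx hQ hB hC (by simp) (by simpa using hQ')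
    have p1 := fun x hx => addHilbert_congr (a := x) hx hP hA hB ht hP'
    have := addHilbert_symm
    grind
  obtain rfl := e1 ha
  obtain rfl := e2 hb
  obtain rfl := e3 hc
  have L := fun {x y z : ℚ_[2]} (hx : x ≠ 0) (hy : y ≠ 0) (hz : z ≠ 0) =>
    addHilbert_mul_left hx hy hz
  by_cases hpq : p * q = 0
  · have hr : r ≠ 0 := by
      rintro rfl
      rw [hpq] at rel
      simp_all
    obtain rfl := e123 hr
    have r1 : ∀ x, x ≠ 0 → addHilbert B x + addHilbert R x =
        addHilbert (-1) x + addHilbert A x + addHilbert C x := by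
      intro x hx
      rw [← L hx hB hR, ← L hx hN hA, ← L hx (mul_ne_zero hN hA) hC]
      congr 1
      linear_combination rel + hpq
    have := addHilbert_symm
    clear rel e12 e23 key1 key2l key2r key3 key3' det e1 e2 e3 e123
    grind
  have hp : p ≠ 0 := left_ne_zero_of_mul hpq
  have hq : q ≠ 0 := right_ne_zero_of_mul hpq
  obtain rfl := e12 hp
  obtain rfl := e23 hq
  by_cases hr : r = 0
  · have r1 : ∀ x, x ≠ 0 → addHilbert P x + addHilbert Q x =
        addHilbert A x + addHilbert C x := by
      intro x hx
      rw [← L hx hP hQ, ← L hx hA hC]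
      congr 1
      linear_combination -rel + B * hr
    have n1 := addHilbert_self_neg (A * C)
    rw [← neg_one_mul, L (by simp [*]) hA hC, addHilbert_mul_right hA hN (mul_ne_zero hA hC),
      addHilbert_mul_right hC hN (mul_ne_zero hA hC), addHilbert_mul_right hA hA hC,
      addHilbert_mul_right hC hA hC] at n1
    have := addHilbert_symm
    clear rel e12 e23 key1 key2l key2r key3 key3' det e1 e2 e3 e123 L
    grind
  obtain rfl := e123 hr
  have n1 := addHilbert_relation rel
  rw [addHilbert_mul_mul (mul_ne_zero hB hR) (mul_ne_zero hP hQ) (mul_ne_zero hA hC)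
    (mul_ne_zero hP hQ), addHilbert_mul_mul hB hR hA hC, addHilbert_mul_mul hB hR hP hQ,
    addHilbert_mul_mul hP hQ hA hC, addHilbert_mul_mul hP hQ hP hQ] at n1
  have := addHilbert_symm
  clear rel e12 e23 key1 key2l key2r key3 key3' det e1 e2 e3 e123 L
  grind

theorem hilbert_eq_of_addHilbert {a b c d a' b' c' d' : ℚ_[2]}
    (h : addHilbert a b + addHilbert c d = addHilbert a' b' + addHilbert c' d') :
    hilbert a b * hilbert c d = hilbert a' b' * hilbert c' d' := by
  unfold addHilbert at h
  rcases Int.units_eq_one_or (hilbert a b) with h1 | h1 <;>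
  rcases Int.units_eq_one_or (hilbert c d) with h2 | h2 <;>
  rcases Int.units_eq_one_or (hilbert a' b') with h3 | h3 <;>
  rcases Int.units_eq_one_or (hilbert c' d') with h4 | h4 <;>
  rw [h1, h2, h3, h4] at h ⊢ <;> revert h <;> decide

theorem units_sq (u : ℤˣ) : u * u = 1 := Int.units_mul_self u

theorem cocycle_identity (g₁ g₂ g₃ : SL(2, ℚ_[2])) :
    cocycle g₁ g₂ * cocycle (g₁ * g₂) g₃ = cocycle g₁ (g₂ * g₃) * cocycle g₂ g₃ := by
  have h := hilbert_eq_of_addHilbert (addCocycle_identity g₁ g₂ g₃)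
  unfold cocycle
  rw [← mul_assoc g₁ g₂ g₃]
  have e1 := units_sq (sSign (g₁ * g₂))
  have e2 := units_sq (sSign (g₂ * g₃))
  generalize hilbert (xEntry (g₁ * g₂) * xEntry g₁) (xEntry (g₁ * g₂) * xEntry g₂) = u₁ at *
  generalize hilbert (xEntry (g₁ * g₂ * g₃) * xEntry (g₁ * g₂))
    (xEntry (g₁ * g₂ * g₃) * xEntry g₃) = u₂ at *
  generalize hilbert (xEntry (g₁ * g₂ * g₃) * xEntry g₁)
    (xEntry (g₁ * g₂ * g₃) * xEntry (g₂ * g₃)) = u₃ at *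
  generalize hilbert (xEntry (g₂ * g₃) * xEntry g₂) (xEntry (g₂ * g₃) * xEntry g₃) = u₄ at *
  generalize sSign (g₁ * g₂) = s₁₂ at *
  generalize sSign (g₂ * g₃) = s₂₃ at *
  generalize sSign (g₁ * g₂ * g₃) = s at *
  calc u₁ * sSign g₁ * sSign g₂ * s₁₂ * (u₂ * s₁₂ * sSign g₃ * s)
      = (u₁ * u₂) * (s₁₂ * s₁₂) * (sSign g₁ * sSign g₂ * sSign g₃ * s) := by
        simp only [mul_comm, mul_left_comm]
    _ = (u₃ * u₄) * (s₂₃ * s₂₃) * (sSign g₁ * sSign g₂ * sSign g₃ * s) := by rw [h, e1, e2]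
    _ = u₃ * sSign g₁ * s₂₃ * s * (u₄ * sSign g₂ * sSign g₃ * s₂₃) := by
        simp only [mul_comm, mul_left_comm]

theorem xEntry_one : xEntry 1 = 1 := by simp [xEntry]

theorem sSign_one : sSign 1 = 1 := by simp [sSign]

theorem cocycle_one_left (g : SL(2, ℚ_[2])) : cocycle 1 g = 1 := by
  unfold cocycle
  rw [one_mul, xEntry_one, sSign_one, ← pow_two, hilbert_sq, one_mul, one_mul, units_sq]

theorem cocycle_one_right (g : SL(2, ℚ_[2])) : cocycle g 1 = 1 := by
  unfold cocycle
  rw [mul_one, xEntry_one, sSign_one, ← pow_two, hilbert_symm, hilbert_sq, one_mul, mul_one,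
    units_sq]

theorem cocycle_neg_one_comm (g : SL(2, ℚ_[2])) : cocycle (-1) g = cocycle g (-1) := by
  unfold cocycle
  rw [hilbert_symm, neg_one_mul, mul_neg_one, mul_right_comm _ (sSign (-1)) (sSign g)]

end DoubleCover

/-- The double cover `G` of `SL₂(ℚ₂)`: pairs `(g, ε)` with `g` in `SL₂(ℚ₂)` and `ε = ±1`, with the
group law `(g₁, ε₁) (g₂, ε₂) = (g₁ g₂, ε₁ ε₂ σ(g₁, g₂))`. -/
@[ext]
structure DoubleCover where
  mat : SL(2, ℚ_[2])
  sgn : ℤˣ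

namespace DoubleCover

noncomputable instance : Mul DoubleCover :=
  ⟨fun a b => ⟨a.mat * b.mat, a.sgn * b.sgn * cocycle a.mat b.mat⟩⟩

noncomputable instance : One DoubleCover := ⟨⟨1, 1⟩⟩

noncomputable instance : Inv DoubleCover :=
  ⟨fun a => ⟨a.mat⁻¹, a.sgn * cocycle a.mat⁻¹ a.mat⟩⟩

theorem mul_def (a b : DoubleCover) :
    a * b = ⟨a.mat * b.mat, a.sgn * b.sgn * cocycle a.mat b.mat⟩ := rfl

noncomputable instance : Group DoubleCover :=
  Group.ofLeftAxioms
    (by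
      intro a b c
      refine DoubleCover.ext (mul_assoc _ _ _) ?_
      have h := cocycle_identity a.mat b.mat c.mat
      change a.sgn * b.sgn * cocycle a.mat b.mat * c.sgn * cocycle (a.mat * b.mat) c.mat =
        a.sgn * (b.sgn * c.sgn * cocycle b.mat c.mat) * cocycle a.mat (b.mat * c.mat)
      calc _ = a.sgn * b.sgn * c.sgn * (cocycle a.mat b.mat * cocycle (a.mat * b.mat) c.mat) := by
            ac_rfl
        _ = _ := by
            rw [h]
            ac_rfl)
    (by
      intro a
      refine DoubleCover.ext (one_mul _) ?_
      change 1 * a.sgn * cocycle 1 a.mat = a.sgn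
      rw [cocycle_one_left, one_mul, mul_one])
    (by
      intro a
      refine DoubleCover.ext (inv_mul_cancel _) ?_
      change a.sgn * cocycle a.mat⁻¹ a.mat * a.sgn * cocycle a.mat⁻¹ a.mat = 1
      rw [mul_assoc, units_sq])

/-- The section `s : SL₂(ℚ₂) → G`. -/
noncomputable def sec (g : SL(2, ℚ_[2])) : DoubleCover := ⟨g, 1⟩

/-- The topology of `G`: the sets `g · s(Γ(2ⁿ))`, where `Γ(2ⁿ)` is the group of matrices congruent
to `1` modulo `2ⁿ`, form a basis of neighbourhoods of `g` (on `Γ(4)` the section `s` is a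
homomorphism). -/
noncomputable instance : TopologicalSpace DoubleCover where
  IsOpen U := ∀ g ∈ U, ∃ n : ℕ, ∀ k : SL(2, ℚ_[2]),
    (∀ i j, ‖k i j - (1 : SL(2, ℚ_[2])) i j‖ ≤ (2 : ℝ) ^ (-(n : ℤ))) → g * sec k ∈ U
  isOpen_univ := fun _ _ => ⟨0, fun _ _ => trivial⟩
  isOpen_inter := by
    rintro U V hU hV g ⟨hgU, hgV⟩
    obtain ⟨m, hm⟩ := hU g hgU
    obtain ⟨n, hn⟩ := hV g hgV
    refine ⟨max m n, fun k hk => ⟨hm k fun i j => (hk i j).trans ?_,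
      hn k fun i j => (hk i j).trans ?_⟩⟩
    · exact zpow_le_zpow_right₀ one_le_two (by simp)
    · exact zpow_le_zpow_right₀ one_le_two (by simp)
  isOpen_sUnion := by
    rintro S hS g ⟨U, hU, hg⟩
    obtain ⟨n, hn⟩ := hS U hU g hg
    exact ⟨n, fun k hk => ⟨U, hU, hn k hk⟩⟩

noncomputable instance : MeasurableSpace DoubleCover := borel DoubleCover

instance : BorelSpace DoubleCover := ⟨rfl⟩

/-- The matrix `diag(t, t⁻¹)`. -/
noncomputable def hMat (t : ℚ_[2]ˣ) : SL(2, ℚ_[2]) :=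
  ⟨!![(t : ℚ_[2]), 0; 0, (t : ℚ_[2])⁻¹], by simp⟩

/-- The matrix with rows `(0, t)` and `(-t⁻¹, 0)`. -/
noncomputable def wMat (t : ℚ_[2]ˣ) : SL(2, ℚ_[2]) :=
  ⟨!![0, (t : ℚ_[2]); -(t : ℚ_[2])⁻¹, 0], by simp⟩

noncomputable def h (t : ℚ_[2]ˣ) : DoubleCover := sec (hMat t)

noncomputable def w (t : ℚ_[2]ˣ) : DoubleCover := sec (wMat t)

/-- The element `2` of `ℚ₂ˣ`. -/
noncomputable def two : ℚ_[2]ˣ := Units.mk0 2 two_ne_zero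

/-- The torus `T`, generated by the elements `h(t)`. -/
noncomputable def T : Subgroup DoubleCover := Subgroup.closure (Set.range h)

theorem mem_center_of_comm {z : DoubleCover} (h1 : ∀ g : SL(2, ℚ_[2]), z.mat * g = g * z.mat)
    (h2 : ∀ g, cocycle z.mat g = cocycle g z.mat) : z ∈ Subgroup.center DoubleCover := by
  rw [Subgroup.mem_center_iff]
  intro g
  rw [mul_def, mul_def]
  refine DoubleCover.ext (h1 _).symm ?_
  change g.sgn * z.sgn * cocycle g.mat z.mat = z.sgn * g.sgn * cocycle z.mat g.mat
  rw [h2, mul_comm g.sgn]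

theorem hMat_neg_one : hMat (-1) = -1 := by
  ext i j
  fin_cases i <;> fin_cases j <;> simp [hMat]

/-- The non-trivial element of `μ₂`, as an element of the centre `M` of `G`. -/
noncomputable def muNegOne : Subgroup.center DoubleCover :=
  ⟨⟨1, -1⟩, mem_center_of_comm (fun g => by simp)
    (fun g => by rw [cocycle_one_left, cocycle_one_right])⟩

/-- The element `h(-1)` of the centre `M` of `G`. -/
noncomputable def hNegOne : Subgroup.center DoubleCover :=
  ⟨h (-1), mem_center_of_comm (fun g => by simp [h, sec, hMat_neg_one])
    (fun g => by
      change cocycle (hMat (-1)) g = cocycle g (hMat (-1))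
      rw [hMat_neg_one, cocycle_neg_one_comm])⟩

/-- The subgroup `K₀`: the inverse image in `G` of the matrices in `SL₂(ℤ₂)` with `c ∈ 4ℤ₂`. -/
def K₀ : Set DoubleCover :=
  {g | (∀ i j, ‖g.mat i j‖ ≤ 1) ∧ ‖g.mat 1 0‖ ≤ 1 / 4}

/-- The subgroup `K₁ = K₁(4)`: the elements `(g, 1)` with `g ∈ SL₂(ℤ₂)`, `a ∈ 1 + 4ℤ₂` and
`c ∈ 4ℤ₂`. -/
def K₁ : Set DoubleCover :=
  {g | (∀ i j, ‖g.mat i j‖ ≤ 1) ∧ ‖g.mat 0 0 - 1‖ ≤ 1 / 4 ∧ ‖g.mat 1 0‖ ≤ 1 / 4 ∧ g.sgn = 1}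

variable (γ : Subgroup.center DoubleCover →* ℂˣ)

open Classical in
/-- The extension of the central character `γ` to `K₀ = M × K₁` that is trivial on `K₁`. -/
noncomputable def gammaK₀ (k : DoubleCover) : ℂ :=
  if hk : ∃ m : Subgroup.center DoubleCover, ∃ k₁ ∈ K₁, k = m * k₁ then (γ hk.choose : ℂ) else 0

/-- The primitive eighth root of unity `ζ = (1 + γ(h(-1))) / √2`. -/
noncomputable def zeta : ℂ := (1 + (γ hNegOne : ℂ)) / (Real.sqrt 2 : ℝ)

open Classical in
/-- The extension of the central character `γ` to the normalizer of `T` that is trivial on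
`K₁ ∩ T`, takes the value `1` at all `h(2ⁿ)` and the value `ζ` at `w(1)`. -/
noncomputable def gammaN (g : DoubleCover) : ℂ :=
  if hg : ∃ p : Subgroup.center DoubleCover × ℕ, ∃ n : ℤ, ∃ k₁ ∈ K₁ ∩ T,
    g = p.1 * k₁ * h (two ^ n) * w 1 ^ p.2 then (γ hg.choose.1 : ℂ) * zeta γ ^ hg.choose.2 else 0

/-- The space `H(γ)` of locally constant, compactly supported functions `f` on `G` such that
`f(k g k') = conj γ(k) f(g) conj γ(k')` for all `k, k' ∈ K₀`. -/
noncomputable def heckeSpace : Submodule ℂ (DoubleCover → ℂ) where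
  carrier := {f | IsLocallyConstant f ∧ HasCompactSupport f ∧
    ∀ k ∈ K₀, ∀ k' ∈ K₀, ∀ g,
      f (k * g * k') = star (gammaK₀ γ k) * f g * star (gammaK₀ γ k')}
  zero_mem' := ⟨IsLocallyConstant.const 0, HasCompactSupport.zero, by simp⟩
  add_mem' := by
    rintro f f' ⟨h1, h2, h3⟩ ⟨h1', h2', h3'⟩
    refine ⟨h1.add h1', h2.add h2', fun k hk k' hk' g => ?_⟩
    simp only [Pi.add_apply, h3 k hk k' hk', h3' k hk k' hk']
    ring
  smul_mem' := by
    rintro c f ⟨h1, h2, h3⟩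
    refine ⟨h1.comp (fun z => c • z), h2.comp_left (smul_zero c), fun k hk k' hk' g => ?_⟩
    simp only [Pi.smul_apply, smul_eq_mul, h3 k hk k' hk']
    ring

/-- The convolution `(f₁ · f₂)(g₀) = ∫ f₁(g) f₂(g⁻¹ g₀) dg`. -/
noncomputable def conv (μ : Measure DoubleCover) (f₁ f₂ : DoubleCover → ℂ) : DoubleCover → ℂ :=
  fun g₀ => ∫ g, f₁ g * f₂ (g⁻¹ * g₀) ∂μ

open Classical in
/-- For `g` in the normalizer of `T`, the function `X_g` supported on `K₀ g K₀` such that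
`X_g(k g k') = conj γ(k) conj γ(g) conj γ(k')` for all `k, k' ∈ K₀`. -/
noncomputable def X (g x : DoubleCover) : ℂ :=
  if hx : ∃ p : DoubleCover × DoubleCover, p.1 ∈ K₀ ∧ p.2 ∈ K₀ ∧ x = p.1 * g * p.2 then
    star (gammaK₀ γ hx.choose.1) * star (gammaN γ g) * star (gammaK₀ γ hx.choose.2)
  else 0

/-- The function `U_n = X_{w(2⁻ⁿ)}`. -/
noncomputable def U (n : ℤ) : DoubleCover → ℂ := X γ (w (two ^ (-n)))

/-- The function `T_w = √2⁻¹ U_0`. -/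
noncomputable def Tw : DoubleCover → ℂ := ((Real.sqrt 2 : ℝ) : ℂ)⁻¹ • U γ 0

/-- The relations `(t - 2) (t + 1) = 0` and `u ^ 2 = 1` on two free generators `t` and `u`. -/
inductive HeckeRel : FreeAlgebra ℂ (Fin 2) → FreeAlgebra ℂ (Fin 2) → Prop
  | quadratic : HeckeRel ((FreeAlgebra.ι ℂ 0 - 2) * (FreeAlgebra.ι ℂ 0 + 1)) 0
  | involution : HeckeRel (FreeAlgebra.ι ℂ 1 ^ 2) 1

/-- The `ℂ`-algebra presented by two generators `t`, `u` and the relations above. -/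
abbrev PresentedAlgebra : Type := RingQuot HeckeRel

/-- The images of the two free generators in the presented algebra. -/
noncomputable def gen (i : Fin 2) : PresentedAlgebra :=
  RingQuot.mkAlgHom ℂ HeckeRel (FreeAlgebra.ι ℂ i)

end DoubleCover

/-!
The presented algebra `ℂ⟨t, u⟩ / ((t - 2)(t + 1), u² - 1)` is made to act on the Hecke algebra
`H(γ)`, and its orbit map at the unit is shown to be the isomorphism.

The input from the double cover is that the cocycle is trivial on `Γ₁(4)` (`cocycle_of_mem`). Hence
`K₁` is a compact open subgroup, `K₀ = M × K₁`, and `γ` extends to `K₀`. The double coset of `w(1/2)`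
is a single coset of `K₀` and that of `w(1)` consists of four, so left convolution with `U₁` and
`T_w` is given by finite sums of left translations, `opU` and `opT`. These make sense for all
functions that are equivariant under `K₀` from the left.

The relations hold already for these operators. `opU_opU` is a computation with `w(1/2)²`. In
`opT_opT` the sixteen terms of the square are grouped by the lower unipotent elements `n⁻(i)` with
`i = 0, 1, 2, 3`: for `i = 0` one obtains a multiple of the identity, for `i = 1, 3` a multiple of
`T_w` by the decomposition `n⁻(±1) = n(±1) w(∓1) n(±1)`, and for `i = 2` nothing, because
`n⁻(2)` conjugates an element on which `γ` is trivial into one on which `γ` is `±i`. So the presented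
algebra acts (`heckeAction`). Convolution from the left commutes with left translations and has the
conjugate of `γ` on `K₀` as a left unit, so convolution with the image of `a` under the orbit map
`toHecke` is the action of `a` (`conv_toHecke`), and `toHecke` is multiplicative.

For bijectivity, let `s = w(1)` and `s' = w(1/2)`, and compare the alternating words in `t` and `u`,
which span the presented algebra (`span_word`), with the alternating products of `s` and `s'`
(`pt`), which represent the affine Weyl group.

* The image of a word vanishes at all alternating products except the corresponding one
  (`toHecke_word_pt`). At a product that does not begin with `s`, the four terms of `opT` are equal
  and lengthen the product; at one that begins with `s`, the value follows from the quadratic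
  relation.
* An equivariant function that vanishes at all alternating products is zero (`eq_zero_of_pt`). A
  matrix that Gaussian elimination over `K₀` does not bring into monomial form conjugates some
  unipotent element over `Γ₁(4)` into one over `-Γ₁(4)`, or conversely; on the former `γ` takes the
  values `±1` and on the latter `±i`, so an equivariant function vanishes there.

The first fact gives injectivity. As a function of compact support is non-zero at only finitely many
alternating products, a linear combination of words takes the same values at these, and the second
fact gives surjectivity.
-/

namespace DoubleCover

/-! ### Norms on `ℚ₂` -/

theorem norm_two : ‖(2 : ℚ_[2])‖ = 1 / 2 := by
  have := Padic.norm_p (p := 2)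
  simpa using this

theorem norm_four : ‖(4 : ℚ_[2])‖ = 1 / 4 := by
  rw [show (4 : ℚ_[2]) = 2 * 2 by norm_num, norm_mul, norm_two]
  norm_num

theorem norm_add_le_of {x y : ℚ_[2]} {r : ℝ} (hx : ‖x‖ ≤ r) (hy : ‖y‖ ≤ r) : ‖x + y‖ ≤ r :=
  (Padic.nonarchimedean x y).trans (max_le hx hy)

theorem norm_sub_le_of {x y : ℚ_[2]} {r : ℝ} (hx : ‖x‖ ≤ r) (hy : ‖y‖ ≤ r) : ‖x - y‖ ≤ r := by
  rw [sub_eq_add_neg]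
  exact norm_add_le_of hx (by rwa [norm_neg])

theorem norm_mul_le_left {x y : ℚ_[2]} {r : ℝ} (hx : ‖x‖ ≤ r) (hy : ‖y‖ ≤ 1) : ‖x * y‖ ≤ r := by
  rw [norm_mul]
  nlinarith [norm_nonneg x, norm_nonneg y]

theorem norm_mul_le_right {x y : ℚ_[2]} {r : ℝ} (hx : ‖x‖ ≤ 1) (hy : ‖y‖ ≤ r) : ‖x * y‖ ≤ r := by
  rw [mul_comm]
  exact norm_mul_le_left hy hx

theorem norm_eq_of_sub_lt {x y : ℚ_[2]} (h : ‖x - y‖ < ‖y‖) : ‖x‖ = ‖y‖ := by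
  have := Padic.add_eq_max_of_ne (p := 2) (q := x - y) (r := y) h.ne
  rwa [sub_add_cancel, max_eq_right h.le] at this

theorem norm_eq_one_of_sub {x : ℚ_[2]} (h : ‖x - 1‖ ≤ 1 / 4) : ‖x‖ = 1 := by
  rw [norm_eq_of_sub_lt (y := 1) (by rw [norm_one]; linarith), norm_one]

/-- The norm takes only powers of `2` as values. -/
theorem norm_le_of_lt {x : ℚ_[2]} {n : ℤ} (h : ‖x‖ < (2 : ℝ) ^ n) : ‖x‖ ≤ (2 : ℝ) ^ (n - 1) := by
  have := (Padic.norm_lt_pow_iff_norm_le_pow_sub_one (p := 2) x n).1 (by exact_mod_cast h)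
  exact_mod_cast this

theorem norm_le_half {x : ℚ_[2]} (h : ‖x‖ < 1) : ‖x‖ ≤ 1 / 2 := by
  have := norm_le_of_lt (x := x) (n := 0) (by simpa using h)
  norm_num at this ⊢
  exact this

theorem norm_le_quarter {x : ℚ_[2]} (h : ‖x‖ < 1 / 2) : ‖x‖ ≤ 1 / 4 := by
  have := norm_le_of_lt (x := x) (n := -1) (by norm_num at h ⊢; exact h)
  norm_num at this ⊢
  exact this

theorem norm_le_one_of_lt {x : ℚ_[2]} (h : ‖x‖ < 2) : ‖x‖ ≤ 1 := by
  have := norm_le_of_lt (x := x) (n := 1) (by norm_num at h ⊢; exact h)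
  norm_num at this ⊢
  exact this

/-- The residue field of `ℚ₂` has two elements. -/
theorem norm_residue {x : ℚ_[2]} (hx : ‖x‖ ≤ 1) : ‖x‖ ≤ 1 / 2 ∨ ‖x - 1‖ ≤ 1 / 2 := by
  obtain ⟨n, hn, h⟩ := PadicInt.exists_mem_range (p := 2) ⟨x, hx⟩
  rw [IsLocalRing.mem_maximalIdeal, PadicInt.mem_nonunits] at h
  have h' : ‖x - n‖ < 1 := h
  interval_cases n
  · exact Or.inl (norm_le_half (by simpa using h'))
  · exact Or.inr (norm_le_half (by simpa using h'))

theorem norm_sub_one_of_unit {x : ℚ_[2]} (hx : ‖x‖ = 1) : ‖x - 1‖ ≤ 1 / 2 :=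
  (norm_residue hx.le).resolve_left (by rw [hx]; norm_num)

theorem norm_half_le {x : ℚ_[2]} {r : ℝ} (hx : ‖x‖ ≤ r / 2) : ‖x / 2‖ ≤ r := by
  rw [norm_div, norm_two]
  linarith

/-- A `2`-adic integer is congruent modulo `4` to one of `0, 1, 2, 3`. -/
theorem exists_natCast_mod_four {x : ℚ_[2]} (hx : ‖x‖ ≤ 1) :
    ∃ i : ℕ, i < 4 ∧ ‖x - i‖ ≤ 1 / 4 := by
  have key : ∀ y : ℚ_[2], ‖y‖ ≤ 1 / 2 → ‖y‖ ≤ 1 / 4 ∨ ‖y - 2‖ ≤ 1 / 4 := by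
    intro y hy
    have e : ∀ z : ℚ_[2], ‖z / 2‖ ≤ 1 / 2 → ‖z‖ ≤ 1 / 4 := fun z hz => by
      rw [norm_div, norm_two] at hz
      linarith
    rcases norm_residue (x := y / 2) (norm_half_le hy) with h | h
    · exact Or.inl (e _ h)
    · exact Or.inr (e _ (by rwa [show (y - 2) / 2 = y / 2 - 1 by ring]))
  rcases norm_residue hx with h | h
  · rcases key _ h with h | h
    · exact ⟨0, by norm_num, by simpa using h⟩
    · exact ⟨2, by norm_num, by simpa using h⟩
  · rcases key _ h with h | h
    · exact ⟨1, by norm_num, by simpa using h⟩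
    · exact ⟨3, by norm_num, by
        rwa [show x - ((3 : ℕ) : ℚ_[2]) = x - 1 - 2 by push_cast; ring]⟩

/-- A unit of `ℤ₂` is congruent to `1` or to `-1` modulo `4`. -/
theorem norm_unit_mod_four {x : ℚ_[2]} (hx : ‖x‖ = 1) : ‖x - 1‖ ≤ 1 / 4 ∨ ‖-x - 1‖ ≤ 1 / 4 := by
  have h := norm_sub_one_of_unit hx
  rcases norm_residue (x := (x - 1) / 2) (norm_half_le h) with h | h
  · left
    rw [norm_div, norm_two] at h
    linarith
  · right
    rw [show (x - 1) / 2 - 1 = -((-x - 1) / 2 + 2) by ring, norm_neg] at h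
    have h2 : ‖(-x - 1) / 2‖ ≤ 1 / 2 := by
      rw [show (-x - 1) / 2 = ((-x - 1) / 2 + 2) - 2 by ring]
      exact norm_sub_le_of h norm_two.le
    rw [norm_div, norm_two] at h2
    linarith

theorem norm_sq_sub_one {x : ℚ_[2]} (hx : ‖x‖ = 1) : ‖x ^ 2 - 1‖ ≤ 1 / 4 := by
  have h := norm_sub_one_of_unit hx
  have h' : ‖x + 1‖ ≤ 1 / 2 := by
    rw [show x + 1 = x - 1 + 2 by ring]
    exact norm_add_le_of h norm_two.le
  rw [show x ^ 2 - 1 = (x - 1) * (x + 1) by ring, norm_mul]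
  nlinarith [norm_nonneg (x - 1), norm_nonneg (x + 1)]

/-! ### Units and the Hilbert symbol -/

theorem square_class_unit {u : ℚ_[2]} (hu : ‖u‖ = 1) :
    ∃ (q : ℤ) (t : ℚ_[2]), t ≠ 0 ∧ ‖t‖ = 1 ∧ (q = 1 ∨ q = -1 ∨ q = 3 ∨ q = -3) ∧
      u = q * t ^ 2 := by
  have hu0 : u ≠ 0 := by
    rintro rfl
    simp at hu
  obtain ⟨q, t, ht, hq, h⟩ := square_class u hu0
  have h3 : ‖(3 : ℚ_[2])‖ = 1 := by
    have := norm_eq_of_sub_lt (x := (3 : ℚ_[2])) (y := 1)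
      (by norm_num [norm_two])
    rw [this, norm_one]
  have hq1 : ‖(q : ℚ_[2])‖ = 1 := by
    rcases hq with rfl | rfl | rfl | rfl <;> push_cast <;> simp [h3]
  rcases h with h | h
  · refine ⟨q, t, ht, ?_, hq, h⟩
    rw [h, norm_mul, norm_pow, hq1, one_mul] at hu
    exact (pow_eq_one_iff_of_nonneg (norm_nonneg t) two_ne_zero).1 hu
  · -- the valuation of `2 q t²` is odd
    exfalso
    rw [h, norm_mul, norm_mul, norm_pow, hq1, norm_two,
      Padic.norm_eq_zpow_neg_valuation ht] at hu
    have h4 : (2 : ℝ) ^ (-1 + -t.valuation * 2) = 2 ^ (0 : ℤ) := by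
      rw [zpow_add₀ two_ne_zero, zpow_mul]
      push_cast at hu
      rw [zpow_zero, ← hu]
      norm_num
    have := zpow_right_injective₀ (by norm_num : (0 : ℝ) < 2) (by norm_num) h4
    omega

/-- The unramified symbol: a unit that is `1` modulo `4` is a norm from every extension generated
by the square root of a unit. -/
theorem hilbert_unit {u d : ℚ_[2]} (hu : ‖u‖ = 1) (hd : ‖d - 1‖ ≤ 1 / 4) : hilbert u d = 1 := by
  obtain ⟨q, t, ht, ht1, hq, rfl⟩ := square_class_unit (norm_eq_one_of_sub hd)
  have ht2 := norm_sq_sub_one ht1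
  have key : IsNormFrom (-3) u := by
    obtain ⟨r, hr⟩ := exists_sqrt_of_dvd (-7) (by norm_num)
    push_cast at hr
    have hr0 : r ≠ 0 := by rintro rfl; norm_num at hr
    obtain ⟨p, s, -, -, hp, rfl⟩ := square_class_unit hu
    refine IsNormFrom.mul ?_ (IsNormFrom.sq _ _)
    have h1 : IsNormFrom (-3) (-1) :=
      ⟨2 / r, 1 / r, by field_simp; linear_combination -hr⟩
    have h3 : IsNormFrom (-3) 3 := ⟨0, 1, by ring⟩
    rcases hp with rfl | rfl | rfl | rfl
    · exact ⟨1, 0, by push_cast; ring⟩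
    · simpa using h1
    · simpa using h3
    · simpa using h1.mul h3
  have hbad : ¬ ‖(2 : ℚ_[2])‖ ≤ 1 / 4 := by rw [norm_two]; norm_num
  rcases hq with rfl | rfl | rfl | rfl
  · simpa using hilbert_sq u t
  · refine absurd ?_ hbad
    have := norm_add_le_of hd ht2
    push_cast at this
    rw [show -1 * t ^ 2 - 1 + (t ^ 2 - 1) = -2 by ring, norm_neg] at this
    exact this
  · refine absurd ?_ hbad
    have := norm_sub_le_of (norm_mul_le_right (x := (3 : ℚ_[2])) ?_ ht2) hd
    · push_cast at this
      rw [show 3 * (t ^ 2 - 1) - (3 * t ^ 2 - 1) = -2 by ring, norm_neg] at this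
      exact this
    · exact_mod_cast Padic.norm_int_le_one (p := 2) 3
  · rw [hilbert_symm, hilbert_eq_one_iff (by simp [ht])]
    push_cast
    exact (IsNormFrom.mul_sq_left ht).2 key

theorem hilbert_mul_left {a b c : ℚ_[2]} (ha : a ≠ 0) (hb : b ≠ 0) (hc : c ≠ 0) :
    hilbert (b * c) a = hilbert b a * hilbert c a := by
  rw [hilbert_symm, hilbert_mul_right ha hb hc, hilbert_symm a b, hilbert_symm a c]

theorem hilbert_mul_sq {a b t : ℚ_[2]} (ha : a ≠ 0) (hb : b ≠ 0) (ht : t ≠ 0) :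
    hilbert a (b * t ^ 2) = hilbert a b := by
  rw [hilbert_mul_right ha hb (pow_ne_zero 2 ht), hilbert_sq, mul_one]

/-- For `c` in `4ℤ₂`, a unit that is a square modulo `c` is a norm from `ℚ₂(√c)`. -/
theorem hilbert_of_modEq_sq {c d s y : ℚ_[2]} (hc0 : c ≠ 0) (hc : ‖c‖ ≤ 1 / 4) (hs : ‖s‖ = 1)
    (hy : ‖y‖ ≤ 1) (hd : d = s ^ 2 + c * y) : hilbert c d = 1 := by
  have hs0 : s ≠ 0 := by rintro rfl; simp at hs
  set e := 1 + c * (y / s ^ 2) with he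
  have hy' : ‖y / s ^ 2‖ ≤ 1 := by simpa [hs] using hy
  have hcy : ‖c * (y / s ^ 2)‖ ≤ 1 / 4 := norm_mul_le_left hc hy'
  have he1 : ‖e - 1‖ ≤ 1 / 4 := by simpa [he] using hcy
  have hn : ‖e‖ = 1 := norm_eq_one_of_sub he1
  have he0 : e ≠ 0 := by
    intro h
    simp [h] at hn
  rw [show d = e * s ^ 2 by rw [hd, he]; field_simp, hilbert_mul_sq hc0 he0 hs0]
  -- if `c` is in `8ℤ₂`, then `e` is a square; otherwise `c` is a unit up to a square
  rcases hc.lt_or_eq with h | h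
  · have h8 : ‖c‖ ≤ 1 / 8 := by
      have := norm_le_of_lt (x := c) (n := -2) (by norm_num at h ⊢; exact h)
      norm_num at this ⊢
      exact this
    obtain ⟨t, ht⟩ := exists_sqrt ⟨e, hn.le⟩ (by
      change ‖e - 1‖ ≤ 1 / 8
      simpa [he] using norm_mul_le_left h8 hy')
    change t ^ 2 = e at ht
    rw [← ht, hilbert_sq]
  · have h4 : c = (c / 4) * 2 ^ 2 := by ring
    have hc4 : c / 4 ≠ 0 := div_ne_zero hc0 (by norm_num)
    rw [h4, hilbert_symm, hilbert_mul_sq he0 hc4 two_ne_zero, hilbert_symm]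
    refine hilbert_unit ?_ he1
    rw [norm_div, h, norm_four]
    norm_num

/-! ### The congruence subgroup `Γ₁(4)` and the splitting of the cover over it -/

/-- The matrices of `SL₂(ℤ₂)`, inside `SL₂(ℚ₂)`, with `a ∈ 1 + 4ℤ₂` and `c ∈ 4ℤ₂`. -/
def Gamma1 : Set SL(2, ℚ_[2]) :=
  {g | (∀ i j, ‖g i j‖ ≤ 1) ∧ ‖g 0 0 - 1‖ ≤ 1 / 4 ∧ ‖g 1 0‖ ≤ 1 / 4}

theorem det_entries (g : SL(2, ℚ_[2])) : g 0 0 * g 1 1 - g 0 1 * g 1 0 = 1 := by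
  rw [← Matrix.det_fin_two, g.det_coe]

theorem inv_entries (g : SL(2, ℚ_[2])) : g⁻¹ 0 0 = g 1 1 ∧ g⁻¹ 0 1 = -g 0 1 ∧
    g⁻¹ 1 0 = -g 1 0 ∧ g⁻¹ 1 1 = g 0 0 := by
  rw [Matrix.SpecialLinearGroup.SL2_inv_expl g]
  exact ⟨rfl, rfl, rfl, rfl⟩

theorem sl2_ext {g k : SL(2, ℚ_[2])} (h00 : g 0 0 = k 0 0) (h01 : g 0 1 = k 0 1)
    (h10 : g 1 0 = k 1 0) (h11 : g 1 1 = k 1 1) : g = k := by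
  ext i j
  fin_cases i <;> fin_cases j <;> assumption

theorem mem_Gamma1_iff {g : SL(2, ℚ_[2])} : g ∈ Gamma1 ↔
    ‖g 0 0 - 1‖ ≤ 1 / 4 ∧ ‖g 0 1‖ ≤ 1 ∧ ‖g 1 0‖ ≤ 1 / 4 ∧ ‖g 1 1 - 1‖ ≤ 1 / 4 := by
  constructor
  · rintro ⟨h, h1, h2⟩
    refine ⟨h1, h 0 1, h2, ?_⟩
    rw [show g 1 1 - 1 = g 0 1 * g 1 0 - g 1 1 * (g 0 0 - 1) by
      linear_combination det_entries g]
    exact norm_sub_le_of (norm_mul_le_right (h 0 1) h2) (norm_mul_le_right (h 1 1) h1)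
  · rintro ⟨h1, h2, h3, h4⟩
    refine ⟨fun i j => ?_, h1, h3⟩
    fin_cases i <;> fin_cases j
    · exact (norm_eq_one_of_sub h1).le
    · exact h2
    · exact h3.trans (by norm_num)
    · exact (norm_eq_one_of_sub h4).le

theorem norm_mul_sub_one {x y : ℚ_[2]} (hx : ‖x - 1‖ ≤ 1 / 4) (hy : ‖y - 1‖ ≤ 1 / 4) :
    ‖x * y - 1‖ ≤ 1 / 4 := by
  rw [show x * y - 1 = x * (y - 1) + (x - 1) by ring]
  exact norm_add_le_of (norm_mul_le_right (norm_eq_one_of_sub hx).le hy) hx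

theorem Gamma1_mul {g k : SL(2, ℚ_[2])} (hg : g ∈ Gamma1) (hk : k ∈ Gamma1) :
    g * k ∈ Gamma1 := by
  rw [mem_Gamma1_iff] at *
  obtain ⟨a1, b1, c1, d1⟩ := hg
  obtain ⟨a2, b2, c2, d2⟩ := hk
  have a1' := (norm_eq_one_of_sub a1).le
  have a2' := (norm_eq_one_of_sub a2).le
  have d1' := (norm_eq_one_of_sub d1).le
  have d2' := (norm_eq_one_of_sub d2).le
  simp only [mul_entry]
  refine ⟨?_, ?_, ?_, ?_⟩
  · rw [add_sub_right_comm]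
    exact norm_add_le_of (norm_mul_sub_one a1 a2) (norm_mul_le_right b1 c2)
  · exact norm_add_le_of (norm_mul_le_right a1' b2) (norm_mul_le_right b1 d2')
  · exact norm_add_le_of (norm_mul_le_left c1 a2') (norm_mul_le_right d1' c2)
  · rw [add_sub_assoc]
    exact norm_add_le_of (norm_mul_le_left c1 b2) (norm_mul_sub_one d1 d2)

theorem Gamma1_inv {g : SL(2, ℚ_[2])} (hg : g ∈ Gamma1) : g⁻¹ ∈ Gamma1 := by
  rw [mem_Gamma1_iff] at *
  obtain ⟨h1, h2, h3, h4⟩ := inv_entries g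
  rw [h1, h2, h3, h4, norm_neg, norm_neg]
  exact ⟨hg.2.2.2, hg.2.1, hg.2.2.1, hg.1⟩

theorem Gamma1_one : (1 : SL(2, ℚ_[2])) ∈ Gamma1 := by
  rw [mem_Gamma1_iff]
  simp

/-- On `Γ₁(4)` the parity condition in the definition of `s(g)` can be dropped, since `(c, d) = 1`
if `c` has even valuation. -/
theorem sSign_of_mem {g : SL(2, ℚ_[2])} (hg : g ∈ Gamma1) (hc : g 1 0 ≠ 0) :
    sSign g = hilbert (g 1 0) (g 1 1) := by
  obtain ⟨-, -, -, hd⟩ := mem_Gamma1_iff.1 hg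
  have hd1 := norm_eq_one_of_sub hd
  have hd0 : g 1 1 ≠ 0 := by
    intro h
    simp [h] at hd1
  unfold sSign
  split_ifs with h
  · rfl
  · have hev : Even (g 1 0).valuation := by
      rw [← Int.not_odd_iff_even]
      exact fun ho => h ⟨mul_ne_zero hc hd0, ho⟩
    obtain ⟨n, hn⟩ := hev
    have h2 : (2 : ℚ_[2]) ^ n ≠ 0 := zpow_ne_zero n two_ne_zero
    have hu0 : g 1 0 / (2 ^ n) ^ 2 ≠ 0 := div_ne_zero hc (pow_ne_zero 2 h2)
    have e : g 1 0 = g 1 0 / (2 ^ n) ^ 2 * (2 ^ n) ^ 2 := by field_simp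
    rw [e, hilbert_symm, hilbert_mul_sq hd0 hu0 h2, hilbert_symm, hilbert_unit _ hd]
    rw [norm_div, norm_pow, norm_zpow, norm_two, Padic.norm_eq_zpow_neg_valuation hc, hn,
      ← zpow_natCast ((1 / 2 : ℝ) ^ n), ← zpow_mul, one_div, inv_zpow, ← zpow_neg]
    rw [div_eq_one_iff_eq (zpow_ne_zero _ two_ne_zero)]
    push_cast
    congr 1
    ring

theorem sSign_of_c_eq_zero {g : SL(2, ℚ_[2])} (hc : g 1 0 = 0) : sSign g = 1 := by
  simp [sSign, hc]

/-- The cocycle is trivial on `Γ₁(4)`. If all lower left entries are non-zero, this follows from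
`c₃ d₂ = c₁ + c₂ d₃` for `g₁ g₂ = g₃`, and from `d₁ d₂ d₃` being a square modulo `c₁`. -/
theorem cocycle_of_mem {g₁ g₂ : SL(2, ℚ_[2])} (h₁ : g₁ ∈ Gamma1) (h₂ : g₂ ∈ Gamma1) :
    cocycle g₁ g₂ = 1 := by
  have h₃ := Gamma1_mul h₁ h₂
  have s₁ := sSign_of_mem h₁
  have s₂ := sSign_of_mem h₂
  have s₃ := sSign_of_mem h₃
  have z₁ := sSign_of_c_eq_zero (g := g₁)
  have z₂ := sSign_of_c_eq_zero (g := g₂)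
  have z₃ := sSign_of_c_eq_zero (g := g₁ * g₂)
  have x₁ := xEntry_of_ne (g := g₁)
  have x₂ := xEntry_of_ne (g := g₂)
  have x₃ := xEntry_of_ne (g := g₁ * g₂)
  have y₁ := xEntry_of_eq (g := g₁)
  have y₂ := xEntry_of_eq (g := g₂)
  have y₃ := xEntry_of_eq (g := g₁ * g₂)
  have e10 := mul_entry g₁ g₂ 1 0
  have e11 := mul_entry g₁ g₂ 1 1
  have det₂ := det_entries g₂
  unfold cocycle
  obtain ⟨-, -, hc₁, hd₁⟩ := mem_Gamma1_iff.1 h₁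
  obtain ⟨ha₂, hb₂, hc₂, hd₂⟩ := mem_Gamma1_iff.1 h₂
  obtain ⟨-, -, hc₃, hd₃⟩ := mem_Gamma1_iff.1 h₃
  generalize xEntry g₁ = X₁ at *
  generalize xEntry g₂ = X₂ at *
  generalize xEntry (g₁ * g₂) = X₃ at *
  generalize sSign g₁ = S₁ at *
  generalize sSign g₂ = S₂ at *
  generalize sSign (g₁ * g₂) = S₃ at *
  generalize (g₁ * g₂) 1 0 = c₃ at *
  generalize (g₁ * g₂) 1 1 = d₃ at *
  generalize g₁ 1 0 = c₁ at *
  generalize g₁ 1 1 = d₁ at *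
  generalize g₂ 1 0 = c₂ at *
  generalize g₂ 1 1 = d₂ at *
  generalize g₂ 0 0 = a₂ at *
  generalize g₂ 0 1 = b₂ at *
  have nz : ∀ {d : ℚ_[2]}, ‖d - 1‖ ≤ 1 / 4 → d ≠ 0 := by
    rintro d hd rfl
    have := norm_eq_one_of_sub hd
    simp at this
  have n₁ := nz hd₁
  have n₂ := nz hd₂
  have n₃ := nz hd₃
  have u₁ := norm_eq_one_of_sub hd₁
  have u₂ := norm_eq_one_of_sub hd₂
  have u₃ := norm_eq_one_of_sub hd₃
  have rel : c₃ * d₂ = c₁ + c₂ * d₃ := by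
    rw [e10, e11]
    linear_combination c₁ * det₂
  have L : c₁ ≠ 0 → hilbert c₁ d₁ * (hilbert c₁ d₂ * hilbert c₁ d₃) = 1 := by
    intro h
    rw [← hilbert_mul_right h n₂ n₃, ← hilbert_mul_right h n₁ (mul_ne_zero n₂ n₃)]
    refine hilbert_of_modEq_sq h hc₁ (s := d₁ * d₂) (y := b₂ * (d₁ * d₂)) ?_ ?_ ?_
    · rw [norm_mul, u₁, u₂, one_mul]
    · rw [norm_mul, norm_mul, u₁, u₂]
      simpa using hb₂
    · rw [e11]
      ring
  by_cases hz₁ : c₁ = 0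
  · rw [z₁ hz₁]
    obtain rfl := y₁ hz₁
    by_cases hz₂ : c₂ = 0
    · have hz₃ : c₃ = 0 := by rw [e10, hz₁, hz₂]; ring
      obtain rfl := y₂ hz₂
      obtain rfl := y₃ hz₃
      rw [z₂ hz₂, z₃ hz₃, hilbert_unit]
      · simp
      · rw [norm_mul, u₃, u₁, one_mul]
      · exact norm_mul_sub_one hd₃ hd₂
    · have hz₃ : c₃ ≠ 0 := by
        rw [e10, hz₁]
        simp [n₁, hz₂]
      obtain rfl := x₂ hz₂
      obtain rfl := x₃ hz₃
      have e10' : X₃ = X₁ * X₂ := by rw [e10, hz₁]; ring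
      have e11' : d₃ = X₁ * d₂ := by rw [e11, hz₁]; ring
      have f1 : hilbert X₁ d₂ = 1 := hilbert_unit u₁ hd₂
      have f2 : hilbert X₁ X₁ = 1 := hilbert_unit u₁ hd₁
      rw [s₂ hz₂, s₃ hz₃, e10', e11', show X₁ * X₂ * X₁ = X₂ * X₁ ^ 2 by ring,
        show X₁ * X₂ * X₂ = X₁ * X₂ ^ 2 by ring, hilbert_mul_sq (by simp [*]) n₁ hz₂,
        hilbert_symm, hilbert_mul_sq n₁ hz₂ n₁, hilbert_mul_left (by simp [*]) n₁ hz₂,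
        hilbert_mul_right n₁ n₁ n₂, hilbert_mul_right hz₂ n₁ n₂, f1, f2, hilbert_symm X₁ X₂]
      generalize hilbert X₂ X₁ = p
      generalize hilbert X₂ d₂ = q
      revert p q
      decide
  obtain rfl := x₁ hz₁
  by_cases hz₂ : c₂ = 0
  · have ha₂' := nz ha₂
    have e2 : a₂ * d₂ = 1 := by rw [hz₂] at det₂; linear_combination det₂
    have e10' : c₃ = X₁ * a₂ := by rw [e10, hz₂]; ring
    have hz₃ : c₃ ≠ 0 := by rw [e10']; exact mul_ne_zero hz₁ ha₂'
    obtain rfl := y₂ hz₂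
    obtain rfl := x₃ hz₃
    have f1 : hilbert a₂ d₃ = 1 := hilbert_unit (norm_eq_one_of_sub ha₂) hd₃
    have f2 : hilbert X₁ a₂ = hilbert X₁ X₂ := by
      rw [← hilbert_mul_sq hz₁ ha₂' n₂]
      congr 1
      linear_combination X₂ * e2
    rw [s₁ hz₁, s₃ hz₃, z₂ hz₂, e10', show X₁ * a₂ * X₁ = a₂ * X₁ ^ 2 by ring,
      mul_assoc X₁ a₂, e2, mul_one X₁, hilbert_symm (a₂ * X₁ ^ 2),
      hilbert_mul_sq hz₁ ha₂' hz₁,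
      hilbert_mul_left n₃ hz₁ ha₂', f1, f2]
    have L' := L hz₁
    generalize hilbert X₁ X₂ = p at *
    generalize hilbert X₁ d₁ = q at *
    generalize hilbert X₁ d₃ = r at *
    clear * - L'
    revert p q r
    decide
  obtain rfl := x₂ hz₂
  rw [s₁ hz₁, s₂ hz₂]
  have L' := L hz₁
  by_cases hz₃ : c₃ = 0
  · -- here `c₁ = -c₂ d₃`, and the symbols of units that are `1` modulo `4` are trivial
    obtain rfl := y₃ hz₃
    have e1 : X₁ = -(X₂ * X₃) := by rw [hz₃] at rel; linear_combination -rel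
    have hN : (-1 : ℚ_[2]) ≠ 0 := by norm_num
    have f1 : hilbert (-1) d₁ = 1 := hilbert_unit (by simp) hd₁
    have f2 : hilbert (-1) d₂ = 1 := hilbert_unit (by simp) hd₂
    have f3 : hilbert (-1) X₃ = 1 := hilbert_unit (by simp) hd₃
    have f4 : hilbert X₃ d₁ = 1 := hilbert_unit u₃ hd₁
    have f5 : hilbert X₃ d₂ = 1 := hilbert_unit u₃ hd₂
    have f6 : hilbert X₃ X₃ = 1 := hilbert_unit u₃ hd₃
    have hN' : -X₂ ≠ 0 := neg_ne_zero.2 hz₂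
    have hself : hilbert (-X₂) X₂ = 1 := by rw [hilbert_symm, hilbert_self_neg]
    have ex : ∀ d, d ≠ 0 → hilbert X₁ d = hilbert (-1) d * (hilbert X₂ d * hilbert X₃ d) := by
      intro d hd
      rw [← hilbert_mul_left hd hz₂ n₃, ← hilbert_mul_left hd hN (mul_ne_zero hz₂ n₃), e1,
        neg_one_mul]
    rw [z₃ hz₃, show X₃ * X₁ = -X₂ * X₃ ^ 2 by rw [e1]; ring, hilbert_symm,
      hilbert_mul_sq (mul_ne_zero n₃ hz₂) hN' n₃, hilbert_symm, hilbert_mul_right hN' n₃ hz₂,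
      hself, ← neg_one_mul X₂, hilbert_mul_left n₃ hN hz₂, f3, ex d₁ n₁, f1, f4]
    rw [ex d₁ n₁, ex d₂ n₂, ex X₃ n₃, f1, f2, f3, f4, f5, f6] at L'
    generalize hilbert X₂ X₃ = p at *
    generalize hilbert X₂ d₁ = q at *
    generalize hilbert X₂ d₂ = r at *
    clear * - L'
    revert p q r
    decide
  · -- `c₃ c₁ d₂ + c₃ c₂ d₂ d₃ = (c₃ d₂)²` gives a trivial symbol, which is then expanded
    obtain rfl := x₃ hz₃
    have hA := mul_ne_zero hz₃ hz₁
    have hB := mul_ne_zero hz₃ hz₂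
    have hD := mul_ne_zero n₂ n₃
    have r1 : hilbert (X₃ * X₁ * d₂) (X₃ * X₂ * (d₂ * d₃)) = 1 := by
      unfold hilbert
      rw [if_pos ⟨1, 1, X₃ * d₂, by simp, by linear_combination (X₃ * d₂) * rel⟩]
    have f1 : hilbert d₂ (d₂ * d₃) = 1 := hilbert_unit u₂ (norm_mul_sub_one hd₂ hd₃)
    rw [hilbert_mul_left (mul_ne_zero hB hD) hA n₂, hilbert_mul_right hA hB hD,
      hilbert_mul_right n₂ hB hD, f1, hilbert_mul_right hA n₂ n₃, hilbert_mul_left n₂ hz₃ hz₁,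
      hilbert_mul_left n₃ hz₃ hz₁, hilbert_symm d₂, hilbert_mul_left n₂ hz₃ hz₂] at r1
    rw [s₃ hz₃]
    generalize hilbert (X₃ * X₁) (X₃ * X₂) = o at *
    generalize hilbert X₃ d₂ = p at *
    generalize hilbert X₁ d₂ = q at *
    generalize hilbert X₃ d₃ = r at *
    generalize hilbert X₁ d₃ = s at *
    generalize hilbert X₂ d₂ = t at *
    generalize hilbert X₁ d₁ = v at *
    clear * - r1 L'
    revert o p q r s t v
    decide

/-! ### Relations between the standard elements of the cover -/

/-- The upper triangular unipotent matrix with rows `(1, b)` and `(0, 1)`. -/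
noncomputable def upperMat (b : ℚ_[2]) : SL(2, ℚ_[2]) := ⟨!![1, b; 0, 1], by simp⟩

/-- The lower triangular unipotent matrix with rows `(1, 0)` and `(c, 1)`. -/
noncomputable def lowerMat (c : ℚ_[2]) : SL(2, ℚ_[2]) := ⟨!![1, 0; c, 1], by simp⟩

/-- The lift of an upper triangular unipotent matrix to the cover. -/
noncomputable def upper (b : ℚ_[2]) : DoubleCover := sec (upperMat b)

/-- The lift of a lower triangular unipotent matrix to the cover. -/
noncomputable def lower (c : ℚ_[2]) : DoubleCover := sec (lowerMat c)

section entries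

variable (b : ℚ_[2]) (t : ℚ_[2]ˣ)

@[simp] theorem upperMat_00 : upperMat b 0 0 = 1 := rfl
@[simp] theorem upperMat_01 : upperMat b 0 1 = b := rfl
@[simp] theorem upperMat_10 : upperMat b 1 0 = 0 := rfl
@[simp] theorem upperMat_11 : upperMat b 1 1 = 1 := rfl
@[simp] theorem lowerMat_00 : lowerMat b 0 0 = 1 := rfl
@[simp] theorem lowerMat_01 : lowerMat b 0 1 = 0 := rfl
@[simp] theorem lowerMat_10 : lowerMat b 1 0 = b := rfl
@[simp] theorem lowerMat_11 : lowerMat b 1 1 = 1 := rfl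
@[simp] theorem hMat_00 : hMat t 0 0 = t := rfl
@[simp] theorem hMat_01 : hMat t 0 1 = 0 := rfl
@[simp] theorem hMat_10 : hMat t 1 0 = 0 := rfl
@[simp] theorem hMat_11 : hMat t 1 1 = (t : ℚ_[2])⁻¹ := rfl
@[simp] theorem wMat_00 : wMat t 0 0 = 0 := rfl
@[simp] theorem wMat_01 : wMat t 0 1 = t := rfl
@[simp] theorem wMat_10 : wMat t 1 0 = -(t : ℚ_[2])⁻¹ := rfl
@[simp] theorem wMat_11 : wMat t 1 1 = 0 := rfl

theorem upperMat_zero : upperMat 0 = 1 := sl2_ext (by simp) (by simp) (by simp) (by simp)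

theorem lowerMat_zero : lowerMat 0 = 1 := sl2_ext (by simp) (by simp) (by simp) (by simp)

theorem upperMat_mul (c : ℚ_[2]) : upperMat b * upperMat c = upperMat (b + c) := by
  refine sl2_ext ?_ ?_ ?_ ?_ <;> simp [mul_entry, add_comm]

theorem hMat_mul (s : ℚ_[2]ˣ) : hMat s * hMat t = hMat (s * t) := by
  refine sl2_ext ?_ ?_ ?_ ?_ <;> simp [mul_entry, mul_comm]

theorem hMat_mul_wMat (s : ℚ_[2]ˣ) : hMat s * wMat t = wMat (s * t) := by
  refine sl2_ext ?_ ?_ ?_ ?_ <;> simp [mul_entry, mul_comm]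

theorem hMat_one : hMat 1 = 1 := sl2_ext (by simp) (by simp) (by simp) (by simp)

@[simp] theorem xEntry_upperMat : xEntry (upperMat b) = 1 := by simp [xEntry]

@[simp] theorem xEntry_hMat : xEntry (hMat t) = (t : ℚ_[2])⁻¹ := by simp [xEntry]

@[simp] theorem xEntry_wMat : xEntry (wMat t) = -(t : ℚ_[2])⁻¹ := by simp [xEntry]

@[simp] theorem sSign_upperMat : sSign (upperMat b) = 1 := by simp [sSign]

@[simp] theorem sSign_hMat : sSign (hMat t) = 1 := by simp [sSign]

@[simp] theorem sSign_wMat : sSign (wMat t) = 1 := by simp [sSign]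

theorem hilbert_one_right (a : ℚ_[2]) : hilbert a 1 = 1 := by
  simpa using hilbert_sq a 1

@[simp] theorem sSign_lowerMat : sSign (lowerMat b) = 1 := by
  unfold sSign
  split_ifs
  · exact hilbert_one_right b
  · rfl

end entries

@[simp] theorem mul_mat (x y : DoubleCover) : (x * y).mat = x.mat * y.mat := rfl
@[simp] theorem inv_mat (x : DoubleCover) : (x⁻¹).mat = x.mat⁻¹ := rfl
@[simp] theorem one_mat : (1 : DoubleCover).mat = 1 := rfl
@[simp] theorem one_sgn : (1 : DoubleCover).sgn = 1 := rfl
@[simp] theorem sec_mat (g : SL(2, ℚ_[2])) : (sec g).mat = g := rfl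

theorem sec_one : sec 1 = 1 := rfl

theorem sec_mul_sec {g k : SL(2, ℚ_[2])} (h : cocycle g k = 1) : sec g * sec k = sec (g * k) := by
  rw [mul_def]
  simp [sec, h]

theorem sec_mul_sec_eq {g k g' k' : SL(2, ℚ_[2])} (h : g * k = g' * k')
    (hc : cocycle g k = cocycle g' k') : sec g * sec k = sec g' * sec k' := by
  rw [mul_def, mul_def]
  simp [sec, h, hc]

theorem sec_mul_sec_of_mem {g k : SL(2, ℚ_[2])} (hg : g ∈ Gamma1) (hk : k ∈ Gamma1) :
    sec g * sec k = sec (g * k) :=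
  sec_mul_sec (cocycle_of_mem hg hk)

theorem cocycle_upperMat_left (b : ℚ_[2]) (g : SL(2, ℚ_[2])) : cocycle (upperMat b) g = 1 := by
  have h0 : (upperMat b * g) 1 0 = g 1 0 := by simp [mul_entry]
  have h1 : (upperMat b * g) 1 1 = g 1 1 := by simp [mul_entry]
  have hx : xEntry (upperMat b * g) = xEntry g := by
    unfold xEntry
    split_ifs <;> simp_all
  have hs : sSign (upperMat b * g) = sSign g := by
    unfold sSign
    split_ifs <;> simp_all
  rw [cocycle, hx, hs, ← pow_two, hilbert_sq, sSign_upperMat]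
  simp

theorem upper_mul_sec (b : ℚ_[2]) (g : SL(2, ℚ_[2])) : upper b * sec g = sec (upperMat b * g) :=
  sec_mul_sec (cocycle_upperMat_left b g)

theorem upper_mul_upper (b c : ℚ_[2]) : upper b * upper c = upper (b + c) := by
  rw [upper, upper, ← upper, upper_mul_sec, upperMat_mul, upper]

theorem upper_zero : upper 0 = 1 := by rw [upper, upperMat_zero, sec_one]

theorem lower_zero : lower 0 = 1 := by rw [lower, lowerMat_zero, sec_one]

theorem upper_mul_w (b : ℚ_[2]) (t : ℚ_[2]ˣ) :
    upper b * w t = w t * lower (-b / (t : ℚ_[2]) ^ 2) := by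
  have ht := t.ne_zero
  refine sec_mul_sec_eq (sl2_ext ?_ ?_ ?_ ?_) ?_
  · simp [mul_entry]
    field_simp
  · simp [mul_entry]
  · simp [mul_entry]
  · simp [mul_entry]
  · rw [cocycle_upperMat_left]
    set c := -b / (t : ℚ_[2]) ^ 2 with hc
    by_cases h : c = 0
    · rw [h, lowerMat_zero, cocycle_one_right]
    · have hx : xEntry (wMat t * lowerMat c) = -(t : ℚ_[2])⁻¹ := by
        simp [xEntry, mul_entry]
      have hs : sSign (wMat t * lowerMat c) = 1 := by
        simp [sSign, mul_entry]
      have hl : xEntry (lowerMat c) = c := by simp [xEntry, h]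
      rw [cocycle, hx, hs, hl, xEntry_wMat, sSign_wMat, sSign_lowerMat, hilbert_symm, ← pow_two,
        hilbert_sq]
      simp

theorem lower_mul_w (c : ℚ_[2]) (t : ℚ_[2]ˣ) :
    lower c * w t = w t * upper (-c * (t : ℚ_[2]) ^ 2) := by
  have ht := t.ne_zero
  have hm : lowerMat c * wMat t = wMat t * upperMat (-c * (t : ℚ_[2]) ^ 2) := by
    refine sl2_ext ?_ ?_ ?_ ?_
    · simp [mul_entry]
    · simp [mul_entry]
    · simp [mul_entry]
    · simp [mul_entry]
      field_simp
  refine sec_mul_sec_eq hm ?_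
  by_cases h : c = 0
  · simp [h, lowerMat_zero, upperMat_zero, cocycle_one_left, cocycle_one_right]
  · have hx : xEntry (lowerMat c * wMat t) = -(t : ℚ_[2])⁻¹ := by
      simp [xEntry, mul_entry]
    have hl : xEntry (lowerMat c) = c := by simp [xEntry, h]
    rw [cocycle, cocycle, ← hm, hx, hl, xEntry_wMat, sSign_wMat, sSign_lowerMat, xEntry_upperMat,
      sSign_upperMat, ← pow_two, hilbert_sq, hilbert_symm, hilbert_sq]

theorem hilbert_sq_mul {a b t : ℚ_[2]} (ha : a ≠ 0) (hb : b ≠ 0) (ht : t ≠ 0) :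
    hilbert (a * t ^ 2) b = hilbert a b := by
  rw [hilbert_symm, hilbert_mul_sq hb ha ht, hilbert_symm]

theorem h_mul_w (t u : ℚ_[2]ˣ) : h t * w u = w u * h t⁻¹ := by
  have ht := t.ne_zero
  have hu := u.ne_zero
  have hm : hMat t * wMat u = wMat u * hMat t⁻¹ := by
    refine sl2_ext ?_ ?_ ?_ ?_ <;> simp [mul_entry, mul_comm]
  refine sec_mul_sec_eq hm ?_
  rw [cocycle, cocycle, ← hm, hMat_mul_wMat]
  simp only [xEntry_hMat, xEntry_wMat, sSign_hMat, sSign_wMat, mul_one, Units.val_mul,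
    Units.val_inv_eq_inv_val, inv_inv]
  rw [show -((t : ℚ_[2]) * u)⁻¹ * (t : ℚ_[2])⁻¹ = -u * ((t : ℚ_[2])⁻¹ * (u : ℚ_[2])⁻¹) ^ 2 by
      field_simp,
    show -((t : ℚ_[2]) * u)⁻¹ * -(u : ℚ_[2])⁻¹ = t * ((t : ℚ_[2])⁻¹ * (u : ℚ_[2])⁻¹) ^ 2 by
      field_simp,
    show -((t : ℚ_[2]) * u)⁻¹ * t = -u * ((u : ℚ_[2])⁻¹) ^ 2 by field_simp,
    hilbert_sq_mul (by simp) (by simp) (by simp), hilbert_mul_sq (by simp) (by simp) (by simp),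
    hilbert_symm (t * _), hilbert_sq_mul (by simp) (by simp) (by simp),
    hilbert_mul_sq (by simp) (by simp) (by simp)]

theorem h_mul_upper (t : ℚ_[2]ˣ) (b : ℚ_[2]) : h t * upper b = upper ((t : ℚ_[2]) ^ 2 * b) * h t := by
  have ht := t.ne_zero
  have hm : hMat t * upperMat b = upperMat ((t : ℚ_[2]) ^ 2 * b) * hMat t := by
    refine sl2_ext ?_ ?_ ?_ ?_
    · simp [mul_entry]
    · simp [mul_entry]
      field_simp
    · simp [mul_entry]
    · simp [mul_entry]
  refine sec_mul_sec_eq hm ?_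
  have hx : xEntry (hMat t * upperMat b) = (t : ℚ_[2])⁻¹ := by simp [xEntry, mul_entry]
  have hs : sSign (hMat t * upperMat b) = 1 := by simp [sSign, mul_entry]
  rw [cocycle_upperMat_left, cocycle, hx, hs, xEntry_hMat, sSign_hMat, sSign_upperMat, ← pow_two,
    hilbert_symm, hilbert_sq]
  simp

theorem w_mul_w (t : ℚ_[2]ˣ) (ht1 : hilbert t (-1) = 1) : w t * w t = h (-1) := by
  have ht := t.ne_zero
  have hm : wMat t * wMat t = hMat (-1) := by
    refine sl2_ext ?_ ?_ ?_ ?_ <;> simp [mul_entry]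
  rw [w, sec_mul_sec, hm, h]
  rw [cocycle, hm, xEntry_hMat, xEntry_wMat, sSign_wMat, sSign_hMat]
  simp only [Units.val_neg, Units.val_one, mul_one]
  rw [show ((-1 : ℚ_[2])⁻¹ * -(t : ℚ_[2])⁻¹) = t * ((t : ℚ_[2])⁻¹) ^ 2 by field_simp,
    hilbert_mul_sq (by simp) ht (by simp), hilbert_sq_mul ht ht (by simp)]
  have h2 := hilbert_self_neg (t : ℚ_[2])
  rw [← mul_neg_one, hilbert_mul_right ht ht (by norm_num), ht1, mul_one] at h2
  exact h2

theorem hilbert_neg_one_one : hilbert ((1 : ℚ_[2]ˣ) : ℚ_[2]) (-1) = 1 := by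
  rw [Units.val_one, hilbert_symm, hilbert_one_right]

theorem w_one_inv : (w 1)⁻¹ = w (-1) := by
  have hm : wMat 1 * wMat (-1) = 1 := by
    refine sl2_ext ?_ ?_ ?_ ?_ <;> simp [mul_entry]
  refine inv_eq_of_mul_eq_one_right ?_
  rw [w, w, sec_mul_sec, hm, sec_one]
  rw [cocycle, hm, xEntry_one, xEntry_wMat, xEntry_wMat, sSign_wMat, sSign_wMat, sSign_one]
  simp [hilbert_one_right]

theorem two_pow_val (n : ℤ) : ((two ^ n : ℚ_[2]ˣ) : ℚ_[2]) = 2 ^ n := by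
  simp [two]

theorem hilbert_two_pow_neg_one (n : ℤ) : hilbert ((two ^ n : ℚ_[2]ˣ) : ℚ_[2]) (-1) = 1 := by
  have h1 : hilbert 2 (-1) = 1 := hilbert_of_add_eq_one (by norm_num)
  have h2 : (2 : ℚ_[2]) ≠ 0 := two_ne_zero
  rw [two_pow_val]
  rcases Int.even_or_odd' n with ⟨k, rfl | rfl⟩
  · rw [mul_comm, zpow_mul, hilbert_symm]
    exact_mod_cast hilbert_sq _ _
  · rw [zpow_add₀ h2, mul_comm 2 k, zpow_mul, zpow_one, mul_comm]
    have := hilbert_sq_mul (t := (2 : ℚ_[2]) ^ k) h2 (by norm_num : (-1 : ℚ_[2]) ≠ 0)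
      (zpow_ne_zero _ h2)
    rw [← h1, ← this]
    norm_cast

theorem h_two_pow_mul_w (n : ℤ) : h (two ^ n) * w 1 = w (two ^ n) := by
  rw [h, w, sec_mul_sec, hMat_mul_wMat, mul_one, w]
  rw [cocycle, hMat_mul_wMat]
  simp only [xEntry_hMat, xEntry_wMat, sSign_hMat, sSign_wMat, mul_one, Units.val_one, inv_one]
  set t := two ^ n
  have ht := t.ne_zero
  rw [show -(t : ℚ_[2])⁻¹ * (t : ℚ_[2])⁻¹ = -1 * ((t : ℚ_[2])⁻¹) ^ 2 by ring,
    show -(t : ℚ_[2])⁻¹ * -1 = t * ((t : ℚ_[2])⁻¹) ^ 2 by field_simp,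
    hilbert_mul_sq (by simp) ht (by simp), hilbert_sq_mul (by simp) ht (by simp), hilbert_symm]
  exact hilbert_two_pow_neg_one n

theorem lower_one : lower 1 = upper 1 * w (-1) * upper 1 := by
  rw [upper, ← upper, w, upper_mul_sec, mul_def]
  have hm : upperMat 1 * wMat (-1) * upperMat 1 = lowerMat 1 := by
    refine sl2_ext ?_ ?_ ?_ ?_ <;> simp [mul_entry]
  have hx : xEntry (upperMat 1 * wMat (-1)) = 1 := by simp [xEntry, mul_entry]
  have hs : sSign (upperMat 1 * wMat (-1)) = 1 := by simp [sSign, mul_entry]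
  refine DoubleCover.ext hm.symm ?_
  have hl : xEntry (lowerMat 1) = 1 := by simp [xEntry]
  simp [sec, upper, cocycle, hm, hx, hl, hs, lower, hilbert_one_right]

theorem lower_neg_one : lower (-1) = upper (-1) * w 1 * upper (-1) := by
  rw [upper, ← upper, w, upper_mul_sec, mul_def]
  have hm : upperMat (-1) * wMat 1 * upperMat (-1) = lowerMat (-1) := by
    refine sl2_ext ?_ ?_ ?_ ?_ <;> simp [mul_entry]
  have hx : xEntry (upperMat (-1) * wMat 1) = -1 := by simp [xEntry, mul_entry]
  have hs : sSign (upperMat (-1) * wMat 1) = 1 := by simp [sSign, mul_entry]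
  refine DoubleCover.ext hm.symm ?_
  have hl : xEntry (lowerMat (-1)) = -1 := by simp [xEntry]
  simp [sec, upper, cocycle, hm, hx, hl, hs, lower, hilbert_one_right, hilbert_symm 1]

/-- The number `-1` is not a sum of two squares in `ℚ₂`. -/
theorem hilbert_neg_one_neg_one : hilbert (-1) (-1) = -1 := by
  have key : ∀ s t : ℚ_[2], ‖s‖ ≤ 1 → ‖t‖ ≤ 1 → 1 + s ^ 2 + t ^ 2 ≠ 0 := by
    have hsq : ∀ s : ℚ_[2], ‖s‖ ≤ 1 → ‖s ^ 2‖ ≤ 1 / 4 ∨ ‖s ^ 2 - 1‖ ≤ 1 / 4 := by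
      intro s hs
      rcases hs.lt_or_eq with h | h
      · left
        have := norm_le_half h
        rw [norm_pow]
        nlinarith [norm_nonneg s]
      · exact Or.inr (norm_sq_sub_one h)
    have n3 : ¬ ‖(3 : ℚ_[2])‖ ≤ 1 / 4 := by
      intro h
      have := norm_sub_le_of norm_four.le h
      norm_num at this
    have n2 : ¬ ‖(2 : ℚ_[2])‖ ≤ 1 / 4 := by rw [norm_two]; norm_num
    have n1 : ¬ ‖(1 : ℚ_[2])‖ ≤ 1 / 4 := by norm_num
    intro s t hs ht h
    rcases hsq s hs with h1 | h1 <;> rcases hsq t ht with h2 | h2 <;>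
      have h3 := norm_add_le_of h1 h2
    · exact n1 (by rwa [show (1 : ℚ_[2]) = -(s ^ 2 + t ^ 2) by linear_combination h, norm_neg])
    · exact n2 (by
        rwa [show (2 : ℚ_[2]) = -(s ^ 2 + (t ^ 2 - 1)) by linear_combination h, norm_neg])
    · exact n2 (by
        rwa [show (2 : ℚ_[2]) = -(s ^ 2 - 1 + t ^ 2) by linear_combination h, norm_neg])
    · exact n3 (by
        rwa [show (3 : ℚ_[2]) = -(s ^ 2 - 1 + (t ^ 2 - 1)) by linear_combination h, norm_neg])
  refine (Int.units_eq_one_or _).resolve_left fun h1 => ?_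
  obtain ⟨u, v, h⟩ := (hilbert_eq_one_iff (by norm_num)).1 h1
  have h' : 1 + u ^ 2 + v ^ 2 = 0 := by linear_combination -h
  by_cases hu : ‖u‖ ≤ 1
  · by_cases hv : ‖v‖ ≤ 1
    · exact key u v hu hv h'
    · have hv0 : v ≠ 0 := by rintro rfl; simp at hv
      refine key v⁻¹ (u / v) ?_ ?_ ?_
      · rw [norm_inv]
        exact inv_le_one_of_one_le₀ (not_le.1 hv).le
      · rw [norm_div]
        exact (div_le_one (by linarith)).2 (by linarith)
      · field_simp
        linear_combination h'
  · have hu0 : u ≠ 0 := by rintro rfl; simp at hu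
    by_cases hv : ‖v‖ ≤ ‖u‖
    · refine key u⁻¹ (v / u) ?_ ?_ ?_
      · rw [norm_inv]
        exact inv_le_one_of_one_le₀ (not_le.1 hu).le
      · rw [norm_div]
        exact (div_le_one (by linarith)).2 hv
      · field_simp
        linear_combination h'
    · have hv0 : v ≠ 0 := by rintro rfl; simp at hv
      refine key v⁻¹ (u / v) ?_ ?_ ?_
      · rw [norm_inv]
        exact inv_le_one_of_one_le₀ (by linarith)
      · rw [norm_div]
        exact (div_le_one (by linarith)).2 (by linarith)
      · field_simp
        linear_combination h'

theorem hNegOne_sq : hNegOne * hNegOne = muNegOne := by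
  refine Subtype.ext ?_
  change h (-1) * h (-1) = ⟨1, -1⟩
  rw [h, mul_def]
  refine DoubleCover.ext ?_ ?_
  · change hMat (-1) * hMat (-1) = 1
    rw [hMat_mul, neg_one_mul, neg_neg, hMat_one]
  · simp [sec, cocycle, hMat_mul, hilbert_neg_one_neg_one]

theorem muNegOne_sq : muNegOne * muNegOne = 1 := by
  refine Subtype.ext ?_
  change (⟨1, -1⟩ : DoubleCover) * ⟨1, -1⟩ = 1
  rw [mul_def]
  exact DoubleCover.ext (one_mul 1) (by simp [cocycle_one_left])

/-! ### The groups `K₀ = M × K₁` and the extension of the central character -/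

theorem mem_K₁_iff {x : DoubleCover} : x ∈ K₁ ↔ x.mat ∈ Gamma1 ∧ x.sgn = 1 := by
  constructor
  · rintro ⟨h1, h2, h3, h4⟩
    exact ⟨⟨h1, h2, h3⟩, h4⟩
  · rintro ⟨⟨h1, h2, h3⟩, h4⟩
    exact ⟨h1, h2, h3, h4⟩

theorem sec_mem_K₁ {g : SL(2, ℚ_[2])} (h : g ∈ Gamma1) : sec g ∈ K₁ :=
  mem_K₁_iff.2 ⟨h, rfl⟩

theorem K₁_mul {x y : DoubleCover} (hx : x ∈ K₁) (hy : y ∈ K₁) : x * y ∈ K₁ := by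
  rw [mem_K₁_iff] at *
  refine ⟨Gamma1_mul hx.1 hy.1, ?_⟩
  change x.sgn * y.sgn * cocycle x.mat y.mat = 1
  rw [hx.2, hy.2, cocycle_of_mem hx.1 hy.1]
  simp

theorem K₁_inv {x : DoubleCover} (hx : x ∈ K₁) : x⁻¹ ∈ K₁ := by
  rw [mem_K₁_iff] at *
  refine ⟨Gamma1_inv hx.1, ?_⟩
  change x.sgn * cocycle x.mat⁻¹ x.mat = 1
  rw [hx.2, cocycle_of_mem (Gamma1_inv hx.1) hx.1]
  simp

theorem K₁_one : (1 : DoubleCover) ∈ K₁ := mem_K₁_iff.2 ⟨Gamma1_one, rfl⟩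

theorem upper_mem_K₁ {b : ℚ_[2]} (hb : ‖b‖ ≤ 1) : upper b ∈ K₁ :=
  sec_mem_K₁ (mem_Gamma1_iff.2 (by simpa using hb))

theorem lower_mem_K₁ {c : ℚ_[2]} (hc : ‖c‖ ≤ 1 / 4) : lower c ∈ K₁ :=
  sec_mem_K₁ (mem_Gamma1_iff.2 (by simpa using hc))

theorem norm_inv_sub_one {t : ℚ_[2]} (ht : ‖t - 1‖ ≤ 1 / 4) : ‖t⁻¹ - 1‖ ≤ 1 / 4 := by
  have h1 := norm_eq_one_of_sub ht
  have h0 : t ≠ 0 := by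
    rintro rfl
    simp at h1
  rw [show t⁻¹ - 1 = -(t⁻¹ * (t - 1)) by field_simp; ring, norm_neg]
  exact norm_mul_le_right (by rw [norm_inv, h1, inv_one]) ht

theorem h_mem_K₁ {t : ℚ_[2]ˣ} (ht : ‖(t : ℚ_[2]) - 1‖ ≤ 1 / 4) : h t ∈ K₁ :=
  sec_mem_K₁ (mem_Gamma1_iff.2
    ⟨ht, by simp, by simp, by simpa using norm_inv_sub_one ht⟩)

theorem center_mat {m : DoubleCover} (hm : m ∈ Subgroup.center DoubleCover) :
    m.mat = 1 ∨ m.mat = -1 := by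
  rw [Subgroup.mem_center_iff] at hm
  have hu := congrArg DoubleCover.mat (hm (upper 1))
  have hl := congrArg DoubleCover.mat (hm (lower 1))
  simp only [mul_mat, upper, lower, sec_mat] at hu hl
  have hu0 := congrArg (fun g : SL(2, ℚ_[2]) => g 0 0) hu
  have hu1 := congrArg (fun g : SL(2, ℚ_[2]) => g 0 1) hu
  have hl0 := congrArg (fun g : SL(2, ℚ_[2]) => g 0 0) hl
  simp [mul_entry] at hu0 hu1 hl0
  have hd := det_entries m.mat
  have h11 : m.mat 1 1 = m.mat 0 0 := by linear_combination hu1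
  rw [hl0, h11] at hd
  have h2 : (m.mat 0 0 - 1) * (m.mat 0 0 + 1) = 0 := by linear_combination hd
  rcases mul_eq_zero.1 h2 with h | h
  · left
    have h' : m.mat 0 0 = 1 := by linear_combination h
    exact sl2_ext (by simp [h']) (by simp [hl0]) (by simp [hu0]) (by simp [h11, h'])
  · right
    have h' : m.mat 0 0 = -1 := by linear_combination h
    exact sl2_ext (by simp [h']) (by simp [hl0]) (by simp [hu0]) (by simp [h11, h'])

theorem neg_one_not_mem_Gamma1 {g : SL(2, ℚ_[2])} (hg : g ∈ Gamma1) : -g ∉ Gamma1 := by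
  intro h
  have h1 := hg.2.1
  have h2 := h.2.1
  simp only [Matrix.SpecialLinearGroup.coe_neg, Matrix.neg_apply] at h2
  have := norm_add_le_of h1 h2
  rw [show g 0 0 - 1 + (-g 0 0 - 1) = -2 by ring, norm_neg, norm_two] at this
  norm_num at this

theorem center_eq_one_of_mem_K₁ {m : Subgroup.center DoubleCover} (hm : (m : DoubleCover) ∈ K₁) :
    m = 1 := by
  rw [mem_K₁_iff] at hm
  refine Subtype.ext (DoubleCover.ext ?_ hm.2)
  rcases center_mat m.2 with h | h
  · exact h
  · exact absurd (h ▸ hm.1) (neg_one_not_mem_Gamma1 Gamma1_one)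

/-- The factors in `M K₁` are unique. -/
theorem center_mul_K₁_inj {m m' : Subgroup.center DoubleCover} {k k' : DoubleCover} (hk : k ∈ K₁)
    (hk' : k' ∈ K₁) (h : (m : DoubleCover) * k = m' * k') : m = m' := by
  have h1 : ((m'⁻¹ * m : Subgroup.center DoubleCover) : DoubleCover) = k' * k⁻¹ := by
    rw [Subgroup.coe_mul, Subgroup.coe_inv]
    calc (m' : DoubleCover)⁻¹ * m = (m' : DoubleCover)⁻¹ * (m * k) * k⁻¹ := by group
      _ = k' * k⁻¹ := by rw [h]; group
  have h2 := center_eq_one_of_mem_K₁ (m := m'⁻¹ * m) (by rw [h1]; exact K₁_mul hk' (K₁_inv hk))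
  exact (inv_mul_eq_one.1 h2).symm

/-- Elements over `Γ₁(4)` lie in `μ₂ K₁`. -/
theorem exists_of_mat_mem {x : DoubleCover} (hx : x.mat ∈ Gamma1) :
    ∃ m : Subgroup.center DoubleCover, m * m = 1 ∧ ∃ k ∈ K₁, x = m * k := by
  rcases Int.units_eq_one_or x.sgn with h | h
  · exact ⟨1, one_mul 1, x, mem_K₁_iff.2 ⟨hx, h⟩, (one_mul x).symm⟩
  · refine ⟨muNegOne, muNegOne_sq, sec x.mat, sec_mem_K₁ hx, ?_⟩
    change x = ⟨1, -1⟩ * sec x.mat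
    rw [mul_def]
    refine DoubleCover.ext (one_mul _).symm ?_
    change x.sgn = -1 * 1 * cocycle 1 x.mat
    rw [cocycle_one_left, h]
    rfl

theorem hNegOne_mat : (hNegOne : DoubleCover).mat = -1 := hMat_neg_one

/-- Elements over `-Γ₁(4)` lie in `h(-1)⁻¹ μ₂ K₁`. -/
theorem exists_of_neg_mat_mem {x : DoubleCover} (hx : -x.mat ∈ Gamma1) :
    ∃ m : Subgroup.center DoubleCover, m * m = 1 ∧ ∃ k ∈ K₁, x = (hNegOne⁻¹ * m :) * k := by
  obtain ⟨m, hm, k, hk, h⟩ := exists_of_mat_mem (x := (hNegOne : DoubleCover) * x) (by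
    rwa [mul_mat, hNegOne_mat, neg_one_mul])
  refine ⟨m, hm, k, hk, ?_⟩
  rw [Subgroup.coe_mul, mul_assoc, ← h, Subgroup.coe_inv]
  group

theorem mem_K₀_iff {x : DoubleCover} : x ∈ K₀ ↔ x.mat ∈ Gamma1 ∨ -x.mat ∈ Gamma1 := by
  constructor
  · rintro ⟨h1, h2⟩
    have hd := det_entries x.mat
    have ha : ‖x.mat 0 0‖ = 1 := by
      by_contra h
      have h3 := norm_le_half ((h1 0 0).lt_of_ne h)
      have h4 : ‖x.mat 0 0 * x.mat 1 1 - x.mat 0 1 * x.mat 1 0‖ ≤ 1 / 2 :=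
        norm_sub_le_of (norm_mul_le_left h3 (h1 1 1))
          ((norm_mul_le_right (h1 0 1) h2).trans (by norm_num))
      rw [hd, norm_one] at h4
      norm_num at h4
    rcases norm_unit_mod_four ha with h | h
    · exact Or.inl ⟨h1, h, h2⟩
    · refine Or.inr ⟨fun i j => ?_, ?_, ?_⟩
      · simpa using h1 i j
      · simpa using h
      · simpa using h2
  · rintro (⟨h1, -, h2⟩ | ⟨h1, -, h2⟩)
    · exact ⟨h1, h2⟩
    · exact ⟨fun i j => by simpa using h1 i j, by simpa using h2⟩

theorem exists_of_mem_K₀ {x : DoubleCover} (hx : x ∈ K₀) :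
    ∃ m : Subgroup.center DoubleCover, ∃ k ∈ K₁, x = m * k := by
  rcases mem_K₀_iff.1 hx with h | h
  · obtain ⟨m, -, h⟩ := exists_of_mat_mem h
    exact ⟨m, h⟩
  · obtain ⟨m, -, h⟩ := exists_of_neg_mat_mem h
    exact ⟨_, h⟩

theorem center_mul_mem_K₀ (m : Subgroup.center DoubleCover) {k : DoubleCover} (hk : k ∈ K₁) :
    (m : DoubleCover) * k ∈ K₀ := by
  rw [mem_K₀_iff, mul_mat]
  rcases center_mat m.2 with h | h <;> rw [h]
  · exact Or.inl (by simpa using (mem_K₁_iff.1 hk).1)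
  · exact Or.inr (by simpa using (mem_K₁_iff.1 hk).1)

theorem K₁_subset_K₀ {k : DoubleCover} (hk : k ∈ K₁) : k ∈ K₀ :=
  mem_K₀_iff.2 (Or.inl (mem_K₁_iff.1 hk).1)

theorem center_mem_K₀ (m : Subgroup.center DoubleCover) : (m : DoubleCover) ∈ K₀ := by
  simpa using center_mul_mem_K₀ m K₁_one

theorem center_comm (m : Subgroup.center DoubleCover) (x : DoubleCover) :
    x * (m : DoubleCover) = m * x :=
  Subgroup.mem_center_iff.1 m.2 x

theorem K₀_mul {x y : DoubleCover} (hx : x ∈ K₀) (hy : y ∈ K₀) : x * y ∈ K₀ := by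
  obtain ⟨m, k, hk, rfl⟩ := exists_of_mem_K₀ hx
  obtain ⟨m', k', hk', rfl⟩ := exists_of_mem_K₀ hy
  rw [mul_assoc, ← mul_assoc k, center_comm, mul_assoc, ← mul_assoc, ← Subgroup.coe_mul]
  exact center_mul_mem_K₀ _ (K₁_mul hk hk')

theorem K₀_inv {x : DoubleCover} (hx : x ∈ K₀) : x⁻¹ ∈ K₀ := by
  rw [mem_K₀_iff] at *
  rcases hx with h | h
  · exact Or.inl (Gamma1_inv h)
  · refine Or.inr ?_
    have := Gamma1_inv h
    rwa [inv_neg] at this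

theorem K₀_one : (1 : DoubleCover) ∈ K₀ := K₁_subset_K₀ K₁_one

section character

variable (γ : Subgroup.center DoubleCover →* ℂˣ)

theorem gammaK₀_mul_K₁ (m : Subgroup.center DoubleCover) {k : DoubleCover} (hk : k ∈ K₁) :
    gammaK₀ γ (m * k) = γ m := by
  have hex : ∃ m' : Subgroup.center DoubleCover, ∃ k₁ ∈ K₁, (m : DoubleCover) * k = m' * k₁ :=
    ⟨m, k, hk, rfl⟩
  unfold gammaK₀
  rw [dif_pos hex]
  obtain ⟨k₁, hk₁, h⟩ := hex.choose_spec
  rw [← center_mul_K₁_inj hk hk₁ h]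

theorem gammaK₀_center (m : Subgroup.center DoubleCover) : gammaK₀ γ m = γ m := by
  simpa using gammaK₀_mul_K₁ γ m K₁_one

theorem gammaK₀_of_mem_K₁ {k : DoubleCover} (hk : k ∈ K₁) : gammaK₀ γ k = 1 := by
  simpa using gammaK₀_mul_K₁ γ 1 hk

theorem gammaK₀_mul {x y : DoubleCover} (hx : x ∈ K₀) (hy : y ∈ K₀) :
    gammaK₀ γ (x * y) = gammaK₀ γ x * gammaK₀ γ y := by
  obtain ⟨m, k, hk, rfl⟩ := exists_of_mem_K₀ hx
  obtain ⟨m', k', hk', rfl⟩ := exists_of_mem_K₀ hy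
  rw [gammaK₀_mul_K₁ γ m hk, gammaK₀_mul_K₁ γ m' hk', mul_assoc, ← mul_assoc k, center_comm,
    mul_assoc, ← mul_assoc, ← Subgroup.coe_mul, gammaK₀_mul_K₁ γ _ (K₁_mul hk hk'), map_mul,
    Units.val_mul]

theorem gammaK₀_one : gammaK₀ γ 1 = 1 := gammaK₀_of_mem_K₁ γ K₁_one

theorem gammaK₀_inv {x : DoubleCover} (hx : x ∈ K₀) :
    gammaK₀ γ x * gammaK₀ γ x⁻¹ = 1 := by
  rw [← gammaK₀_mul γ hx (K₀_inv hx), mul_inv_cancel, gammaK₀_one]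

theorem gammaK₀_ne_zero {x : DoubleCover} (hx : x ∈ K₀) : gammaK₀ γ x ≠ 0 :=
  left_ne_zero_of_mul_eq_one (gammaK₀_inv γ hx)

theorem gammaK₀_sq_of_mem {x : DoubleCover} (hx : x.mat ∈ Gamma1) : gammaK₀ γ x ^ 2 = 1 := by
  obtain ⟨m, hm, k, hk, rfl⟩ := exists_of_mat_mem hx
  rw [gammaK₀_mul_K₁ γ m hk, pow_two, ← Units.val_mul, ← map_mul, hm, map_one, Units.val_one]

variable {γ}

theorem gamma_hNegOne_sq (hγ : γ muNegOne = -1) : (γ hNegOne : ℂ) ^ 2 = -1 := by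
  rw [pow_two, ← Units.val_mul, ← map_mul, hNegOne_sq, hγ]
  simp

/-- A genuine character takes the values `±i` over `-Γ₁(4)`. -/
theorem gammaK₀_sq_of_neg_mem (hγ : γ muNegOne = -1) {x : DoubleCover} (hx : -x.mat ∈ Gamma1) :
    gammaK₀ γ x ^ 2 = -1 := by
  obtain ⟨m, hm, k, hk, rfl⟩ := exists_of_neg_mat_mem hx
  rw [gammaK₀_mul_K₁ γ _ hk, map_mul, Units.val_mul, mul_pow, map_inv,
    Units.val_inv_eq_inv_val, inv_pow, gamma_hNegOne_sq hγ, pow_two, ← Units.val_mul, ← map_mul,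
    hm, map_one, Units.val_one]
  norm_num

theorem star_gamma_hNegOne (hγ : γ muNegOne = -1) : star (γ hNegOne : ℂ) = -(γ hNegOne : ℂ) := by
  have h := gamma_hNegOne_sq hγ
  have h2 : ((γ hNegOne : ℂ) - Complex.I) * ((γ hNegOne : ℂ) + Complex.I) = 0 := by
    linear_combination h - Complex.I_sq
  rcases mul_eq_zero.1 h2 with h3 | h3
  · rw [sub_eq_zero.1 h3]
    simp
  · rw [eq_neg_of_add_eq_zero_left h3]
    simp

theorem sqrt_two_sq : ((Real.sqrt 2 : ℝ) : ℂ) ^ 2 = 2 := by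
  rw [← Complex.ofReal_pow, Real.sq_sqrt (by norm_num)]
  simp

end character

/-! ### The extension of the character to the normalizer of the torus -/

section normalizer

variable {γ : Subgroup.center DoubleCover →* ℂˣ}

theorem zeta_sq (hγ : γ muNegOne = -1) : zeta γ ^ 2 = γ hNegOne := by
  rw [zeta, div_pow, sqrt_two_sq]
  linear_combination (1 / 2) * gamma_hNegOne_sq hγ

theorem star_zeta (hγ : γ muNegOne = -1) :
    star (zeta γ) = (1 - (γ hNegOne : ℂ)) / (Real.sqrt 2 : ℝ) := by
  rw [zeta, star_div₀, star_add, star_one, star_gamma_hNegOne hγ, ← sub_eq_add_neg]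
  congr 1
  exact Complex.conj_ofReal _

theorem zeta_mul_star_zeta (hγ : γ muNegOne = -1) : zeta γ * star (zeta γ) = 1 := by
  rw [star_zeta hγ, zeta, div_mul_div_comm, ← pow_two, sqrt_two_sq]
  linear_combination (-1 / 2) * gamma_hNegOne_sq hγ

theorem w_one_sq : w 1 * w 1 = (hNegOne : DoubleCover) := w_mul_w 1 hilbert_neg_one_one

theorem w_half_sq : w (two ^ (-1 : ℤ)) * w (two ^ (-1 : ℤ)) = (hNegOne : DoubleCover) :=
  w_mul_w _ (hilbert_two_pow_neg_one _)

theorem norm_entry_of_mem_K₀ {x : DoubleCover} (hx : x ∈ K₀) : ‖x.mat 0 0‖ = 1 := by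
  rcases mem_K₀_iff.1 hx with h | h
  · exact norm_eq_one_of_sub h.2.1
  · have := norm_eq_one_of_sub h.2.1
    rwa [Matrix.SpecialLinearGroup.coe_neg, Matrix.neg_apply, norm_neg] at this

theorem eq_of_norm_two_zpow {n : ℤ} (h : ‖(2 : ℚ_[2]) ^ n‖ = 1) : n = 0 := by
  rw [norm_zpow, norm_two, one_div, inv_zpow, inv_eq_one] at h
  exact zpow_right_injective₀ (by norm_num : (0 : ℝ) < 2) (by norm_num) (by simpa using h)

/-- The extension of `γ` to the normalizer of `T` is well defined on the elements `h(2ⁿ) w(1)ᵖ`. -/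
theorem gammaN_h_mul_w_pow (hγ : γ muNegOne = -1) (n₀ : ℤ) {p₀ : ℕ} (hp₀ : p₀ < 2) :
    gammaN γ (h (two ^ n₀) * w 1 ^ p₀) = zeta γ ^ p₀ := by
  have hex : ∃ p : Subgroup.center DoubleCover × ℕ, ∃ n : ℤ, ∃ k₁ ∈ K₁ ∩ T,
      h (two ^ n₀) * w 1 ^ p₀ = p.1 * k₁ * h (two ^ n) * w 1 ^ p.2 :=
    ⟨(1, p₀), n₀, 1, ⟨K₁_one, one_mem T⟩, by simp⟩
  unfold gammaN
  rw [dif_pos hex]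
  obtain ⟨n, k, ⟨hk, -⟩, e⟩ := hex.choose_spec
  generalize hex.choose = mp at *
  obtain ⟨m, p⟩ := mp
  dsimp only at *
  have hw : w 1 ^ p = ((hNegOne ^ (p / 2) : Subgroup.center DoubleCover) : DoubleCover) *
      w 1 ^ (p % 2) := by
    conv_lhs => rw [← Nat.div_add_mod p 2, pow_add, pow_mul, pow_two, w_one_sq]
    rw [Subgroup.coe_pow]
  have hz : zeta γ ^ p = γ (hNegOne ^ (p / 2)) * zeta γ ^ (p % 2) := by
    conv_lhs => rw [← Nat.div_add_mod p 2, pow_add, pow_mul, zeta_sq hγ]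
    simp
  rw [hz, ← mul_assoc, ← Units.val_mul, ← map_mul]
  generalize hq : hNegOne ^ (p / 2) = z at *
  -- the element of `K₀` that the two decompositions differ by
  have e' : ((m * z : Subgroup.center DoubleCover) : DoubleCover) * k =
      h (two ^ n₀) * (w 1 ^ p₀ * (w 1 ^ (p % 2))⁻¹) * (h (two ^ n))⁻¹ := by
    rw [← mul_assoc (h (two ^ n₀)), e, hw, Subgroup.coe_mul, mul_assoc, ← center_comm z k,
      ← mul_assoc _ (z : DoubleCover), mul_assoc _ _ (z : DoubleCover), center_comm z (h _)]
    group
  have hK : h (two ^ n₀) * (w 1 ^ p₀ * (w 1 ^ (p % 2))⁻¹) * (h (two ^ n))⁻¹ ∈ K₀ := by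
    rw [← e']
    exact center_mul_mem_K₀ _ hk
  have hK1 := norm_entry_of_mem_K₀ hK
  obtain ⟨i1, i2, i3, i4⟩ := inv_entries (hMat (two ^ n))
  obtain ⟨j1, j2, j3, j4⟩ := inv_entries (wMat 1)
  have hr : p % 2 < 2 := Nat.mod_lt _ (by norm_num)
  generalize p % 2 = r at *
  clear hex
  -- if `r ≠ p₀`, the element is antidiagonal, which is impossible in `K₀`
  interval_cases r <;> interval_cases p₀
  · simp only [pow_zero, inv_one, mul_one] at hK1 e'
    have hn : n₀ - n = 0 := by
      refine eq_of_norm_two_zpow ?_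
      simp only [mul_mat, inv_mat, h, sec_mat, mul_entry, i1, i3] at hK1
      simp only [hMat_00, hMat_01, hMat_10, hMat_11, two_pow_val] at hK1
      rw [zpow_sub₀ two_ne_zero]
      simpa [div_eq_mul_inv] using hK1
    rw [sub_eq_zero.1 hn, mul_inv_cancel] at e'
    have := center_mul_K₁_inj (m := m * z) (m' := 1) hk K₁_one
      (by rw [e', Subgroup.coe_one, one_mul])
    rw [this]
    simp
  · simp [h, w, mul_entry, i1, i3] at hK1
  · simp [h, w, mul_entry, i1, i3, j1, j3] at hK1
  · simp only [mul_inv_cancel, mul_one] at hK1 e'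
    have hn : n₀ - n = 0 := by
      refine eq_of_norm_two_zpow ?_
      simp only [mul_mat, inv_mat, h, sec_mat, mul_entry, i1, i3] at hK1
      simp only [hMat_00, hMat_01, hMat_10, hMat_11, two_pow_val] at hK1
      rw [zpow_sub₀ two_ne_zero]
      simpa [div_eq_mul_inv] using hK1
    rw [sub_eq_zero.1 hn, mul_inv_cancel] at e'
    have := center_mul_K₁_inj (m := m * z) (m' := 1) hk K₁_one
      (by rw [e', Subgroup.coe_one, one_mul])
    rw [this]
    simp

theorem h_one : h 1 = 1 := by rw [h, hMat_one, sec_one]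

theorem gammaN_one (hγ : γ muNegOne = -1) : gammaN γ 1 = 1 := by
  simpa [h_one] using gammaN_h_mul_w_pow hγ 0 (p₀ := 0) (by norm_num)

theorem gammaN_w (hγ : γ muNegOne = -1) (n : ℤ) : gammaN γ (w (two ^ n)) = zeta γ := by
  simpa [h_two_pow_mul_w] using gammaN_h_mul_w_pow hγ n (p₀ := 1) (by norm_num)

end normalizer

/-! ### The topology of the cover -/

/-- Left translation by an element of the cover, as a homeomorphism. -/
noncomputable def leftHomeo (g : DoubleCover) : DoubleCover ≃ₜ DoubleCover where
  toEquiv := Equiv.mulLeft g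
  continuous_toFun := by
    rw [continuous_def]
    intro U hU x hx
    obtain ⟨n, hn⟩ := hU _ hx
    exact ⟨n, fun k hk => by simpa [mul_assoc] using hn k hk⟩
  continuous_invFun := by
    rw [continuous_def]
    intro U hU x hx
    obtain ⟨n, hn⟩ := hU _ hx
    exact ⟨n, fun k hk => by simpa [mul_assoc] using hn k hk⟩

theorem leftHomeo_apply (g x : DoubleCover) : leftHomeo g x = g * x := rfl

theorem mem_Gamma1_of_close {k : SL(2, ℚ_[2])} {r : ℝ} (hr : r ≤ 1 / 4)
    (hk : ∀ i j, ‖k i j - (1 : SL(2, ℚ_[2])) i j‖ ≤ r) : k ∈ Gamma1 := by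
  have h00 := hk 0 0
  have h01 := hk 0 1
  have h10 := hk 1 0
  have h11 := hk 1 1
  simp at h00 h01 h10 h11
  exact mem_Gamma1_iff.2 ⟨h00.trans hr, h01.trans (hr.trans (by norm_num)), h10.trans hr,
    h11.trans hr⟩

/-- A set that is stable under right multiplication by `K₁` is open. -/
theorem isOpen_of_mul_mem {U : Set DoubleCover} (hU : ∀ x ∈ U, ∀ k ∈ K₁, x * k ∈ U) :
    IsOpen U := fun x hx => ⟨2, fun k hk => hU x hx _ (sec_mem_K₁
  (mem_Gamma1_of_close (r := (2 : ℝ) ^ (-((2 : ℕ) : ℤ))) (by norm_num) hk))⟩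

theorem isOpen_K₀ : IsOpen K₀ :=
  isOpen_of_mul_mem fun _ hx _ hk => K₀_mul hx (K₁_subset_K₀ hk)

theorem mul_mem_K₀_iff {x k : DoubleCover} (hk : k ∈ K₀) : x * k ∈ K₀ ↔ x ∈ K₀ :=
  ⟨fun h => by simpa using K₀_mul h (K₀_inv hk), fun h => K₀_mul h hk⟩

theorem mul_mem_K₀_iff' {x k : DoubleCover} (hk : k ∈ K₀) : k * x ∈ K₀ ↔ x ∈ K₀ :=
  ⟨fun h => by simpa using K₀_mul (K₀_inv hk) h, fun h => K₀_mul hk h⟩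

theorem isClosed_K₀ : IsClosed K₀ :=
  ⟨isOpen_of_mul_mem fun _ hx _ hk h => hx ((mul_mem_K₀_iff (K₁_subset_K₀ hk)).1 h)⟩

theorem isLocallyConstant_of_mul {f : DoubleCover → ℂ} (hf : ∀ x, ∀ k ∈ K₁, f (x * k) = f x) :
    IsLocallyConstant f := by
  intro s
  refine isOpen_of_mul_mem fun x hx k hk => ?_
  change f (x * k) ∈ s
  rwa [hf x k hk]

/-- The group `K₁` is compact, being the image of a compact set of matrices under the section,
which is a homomorphism on `Γ₁(4)` and hence continuous there. -/
theorem isCompact_K₁ : IsCompact K₁ := by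
  let S : Set (Fin 2 → Fin 2 → ℚ_[2]) := {M | (∀ i j, ‖M i j‖ ≤ 1) ∧ ‖M 0 0 - 1‖ ≤ 1 / 4 ∧
    ‖M 1 0‖ ≤ 1 / 4 ∧ M 0 0 * M 1 1 - M 0 1 * M 1 0 = 1}
  have hball : IsCompact {M : Fin 2 → Fin 2 → ℚ_[2] | ∀ i j, ‖M i j‖ ≤ 1} := by
    have := isCompact_univ_pi (fun _ : Fin 2 => isCompact_univ_pi (fun _ : Fin 2 =>
      isCompact_closedBall (0 : ℚ_[2]) 1))
    convert this using 1
    ext M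
    simp [Set.mem_pi]
  have hS : IsCompact S := by
    refine hball.of_isClosed_subset ?_ fun M hM => hM.1
    have e : S = {M | ∀ i j, ‖M i j‖ ≤ 1} ∩ ({M | ‖M 0 0 - 1‖ ≤ 1 / 4} ∩
      ({M | ‖M 1 0‖ ≤ 1 / 4} ∩ {M | M 0 0 * M 1 1 - M 0 1 * M 1 0 = 1})) := rfl
    rw [e]
    refine hball.isClosed.inter ((isClosed_le (by fun_prop) (by fun_prop)).inter
      ((isClosed_le (by fun_prop) (by fun_prop)).inter
        (isClosed_eq (by fun_prop) (by fun_prop))))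
  let toSL : S → SL(2, ℚ_[2]) := fun M => ⟨Matrix.of M.1, by
    rw [Matrix.det_fin_two]
    exact M.2.2.2.2⟩
  have hmem : ∀ M : S, toSL M ∈ Gamma1 := fun M => ⟨M.2.1, M.2.2.1, M.2.2.2.1⟩
  have hcont : Continuous fun M : S => sec (toSL M) := by
    rw [continuous_def]
    intro U hU
    rw [Metric.isOpen_iff]
    intro M hM
    obtain ⟨n, hn⟩ := hU _ hM
    set r : ℝ := (2 : ℝ) ^ (-((max n 2 : ℕ) : ℤ)) with hr
    have hr0 : 0 < r := by positivity
    have hr4 : r ≤ 1 / 4 := by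
      rw [show (1 / 4 : ℝ) = 2 ^ (-2 : ℤ) by norm_num]
      exact zpow_le_zpow_right₀ one_le_two (by simp)
    refine ⟨r, hr0, fun M' hM' => ?_⟩
    have hd : ∀ i j, ‖toSL M' i j - toSL M i j‖ ≤ r := fun i j => by
      have h1 : dist M'.1 M.1 < r := hM'
      have h2 : dist (M'.1 i j) (M.1 i j) ≤ dist M'.1 M.1 :=
        (dist_le_pi_dist (M'.1 i) (M.1 i) j).trans (dist_le_pi_dist M'.1 M.1 i)
      rw [dist_eq_norm] at h2
      exact h2.trans h1.le
    have hk : ∀ i j, ‖((toSL M)⁻¹ * toSL M') i j - (1 : SL(2, ℚ_[2])) i j‖ ≤ r := fun i j => by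
      have h1 : (1 : SL(2, ℚ_[2])) i j = ((toSL M)⁻¹ * toSL M) i j := by rw [inv_mul_cancel]
      have hi := (Gamma1_inv (hmem M)).1
      rw [h1, mul_entry, mul_entry, add_sub_add_comm, ← mul_sub, ← mul_sub]
      exact norm_add_le_of (norm_mul_le_right (hi i 0) (hd 0 j))
        (norm_mul_le_right (hi i 1) (hd 1 j))
    have h3 := hn _ fun i j => (hk i j).trans
      (zpow_le_zpow_right₀ one_le_two (by simp) : r ≤ (2 : ℝ) ^ (-(n : ℤ)))
    rwa [sec_mul_sec_of_mem (hmem M) (mem_Gamma1_of_close hr4 hk), mul_inv_cancel_left] at h3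
  have hrange : K₁ = Set.range fun M : S => sec (toSL M) := by
    ext x
    constructor
    · intro hx
      obtain ⟨hx1, hx2⟩ := mem_K₁_iff.1 hx
      refine ⟨⟨x.mat.1, hx1.1, hx1.2.1, hx1.2.2, det_entries x.mat⟩, ?_⟩
      exact DoubleCover.ext (Subtype.ext rfl) hx2.symm
    · rintro ⟨M, rfl⟩
      exact sec_mem_K₁ (hmem M)
  rw [hrange]
  have := isCompact_iff_compactSpace.1 hS
  exact isCompact_range hcont

theorem isCompact_K₀ : IsCompact K₀ := by
  have : Finite (Subgroup.center DoubleCover) := by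
    classical
    refine Finite.of_injective
      (fun m : Subgroup.center DoubleCover => ((m : DoubleCover).mat = 1, (m : DoubleCover).sgn)) ?_
    rintro m m' hmm
    simp only [Prod.mk.injEq, eq_iff_iff] at hmm
    refine Subtype.ext (DoubleCover.ext ?_ hmm.2)
    rcases center_mat m.2 with h | h <;> rcases center_mat m'.2 with h' | h'
    · rw [h, h']
    · rw [h, hmm.1.1 h]
    · rw [h', hmm.1.2 h']
    · rw [h, h']
  have e : K₀ = ⋃ m : Subgroup.center DoubleCover, leftHomeo m '' K₁ := by
    ext x
    simp only [Set.mem_iUnion, Set.mem_image, leftHomeo_apply]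
    constructor
    · intro hx
      obtain ⟨m, k, hk, rfl⟩ := exists_of_mem_K₀ hx
      exact ⟨m, k, hk, rfl⟩
    · rintro ⟨m, k, hk, rfl⟩
      exact center_mul_mem_K₀ m hk
  rw [e]
  exact isCompact_iUnion fun m => isCompact_K₁.image (leftHomeo m).continuous

/-! ### Equivariant functions -/

section operators

variable (γ : Subgroup.center DoubleCover →* ℂˣ)

/-- The functions that transform under left translation by `K₀` through the conjugate of `γ`. -/
def LeftEquivariant (F : DoubleCover → ℂ) : Prop :=
  ∀ k ∈ K₀, ∀ g, F (k * g) = star (gammaK₀ γ k) * F g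

/-- The functions that transform under right translation by `K₀` through the conjugate of `γ`. -/
def RightEquivariant (F : DoubleCover → ℂ) : Prop :=
  ∀ k ∈ K₀, ∀ g, F (g * k) = F g * star (gammaK₀ γ k)

variable {γ} {F : DoubleCover → ℂ}

theorem RightEquivariant.mul_K₁ (hF : RightEquivariant γ F) {k : DoubleCover} (hk : k ∈ K₁)
    (g : DoubleCover) : F (g * k) = F g := by
  rw [hF k (K₁_subset_K₀ hk), gammaK₀_of_mem_K₁ γ hk, star_one, mul_one]

namespace LeftEquivariant

theorem K₁_mul (hF : LeftEquivariant γ F) {k : DoubleCover} (hk : k ∈ K₁) (g : DoubleCover) :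
    F (k * g) = F g := by
  rw [hF k (K₁_subset_K₀ hk), gammaK₀_of_mem_K₁ γ hk, star_one, one_mul]

theorem center_mul (hF : LeftEquivariant γ F) (m : Subgroup.center DoubleCover)
    (g : DoubleCover) : F (m * g) = star (γ m : ℂ) * F g := by
  rw [hF m (center_mem_K₀ m), gammaK₀_center]

/-- By the factorization of `K₁` into unipotent and diagonal elements, the equivariance under `K₀`
can be checked on these and on the centre. -/
theorem of_generators (hm : ∀ (m : Subgroup.center DoubleCover) g, F (m * g) = star (γ m : ℂ) * F g)
    (hu : ∀ b : ℚ_[2], ‖b‖ ≤ 1 → ∀ g, F (upper b * g) = F g)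
    (hh : ∀ t : ℚ_[2]ˣ, ‖(t : ℚ_[2]) - 1‖ ≤ 1 / 4 → ∀ g, F (h t * g) = F g)
    (hl : ∀ c : ℚ_[2], ‖c‖ ≤ 1 / 4 → ∀ g, F (lower c * g) = F g) : LeftEquivariant γ F := by
  intro k hk₀ g
  obtain ⟨m, k, hk, rfl⟩ := exists_of_mem_K₀ hk₀
  rw [gammaK₀_mul_K₁ γ m hk, mul_assoc, hm]
  congr 1
  obtain ⟨hk1, hk2⟩ := mem_K₁_iff.1 hk
  obtain ⟨ha, hb, hc, hd⟩ := mem_Gamma1_iff.1 hk1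
  have hd1 := norm_eq_one_of_sub hd
  have hd0 : k.mat 1 1 ≠ 0 := by
    intro h
    simp [h] at hd1
  have hdet := det_entries k.mat
  set d : ℚ_[2]ˣ := Units.mk0 (k.mat 1 1) hd0 with hdd
  have hb' : ‖k.mat 0 1 / k.mat 1 1‖ ≤ 1 := by simpa [hd1] using hb
  have hc' : ‖k.mat 1 0 / k.mat 1 1‖ ≤ 1 / 4 := by rwa [norm_div, hd1, div_one]
  have hd' : ‖((d⁻¹ : ℚ_[2]ˣ) : ℚ_[2]) - 1‖ ≤ 1 / 4 := by
    rw [Units.val_inv_eq_inv_val]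
    exact norm_inv_sub_one hd
  have e : k = upper (k.mat 0 1 / k.mat 1 1) * (h d⁻¹ * lower (k.mat 1 0 / k.mat 1 1)) := by
    refine DoubleCover.ext (sl2_ext ?_ ?_ ?_ ?_) ?_
    · simp [mul_entry, upper, lower, h, hdd]
      field_simp
      linear_combination hdet
    · simp [mul_entry, upper, lower, h, hdd]
      field_simp
    · simp [mul_entry, upper, lower, h, hdd]
      field_simp
    · simp [mul_entry, upper, lower, h, hdd]
    · rw [hk2]
      exact (mem_K₁_iff.1 (DoubleCover.K₁_mul (upper_mem_K₁ hb')
        (DoubleCover.K₁_mul (h_mem_K₁ hd') (lower_mem_K₁ hc')))).2.symm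
  rw [e, mul_assoc, mul_assoc, hu _ hb', hh _ hd', hl _ hc']

end LeftEquivariant

theorem mem_heckeSpace_iff {f : DoubleCover → ℂ} : f ∈ heckeSpace γ ↔
    HasCompactSupport f ∧ LeftEquivariant γ f ∧ RightEquivariant γ f := by
  constructor
  · rintro ⟨-, h2, h3⟩
    refine ⟨h2, fun k hk g => ?_, fun k hk g => ?_⟩
    · simpa [gammaK₀_one] using h3 k hk 1 K₀_one g
    · simpa [gammaK₀_one] using h3 1 K₀_one k hk g
  · rintro ⟨h1, h2, h3⟩
    refine ⟨isLocallyConstant_of_mul fun x k hk => h3.mul_K₁ hk x, h1, fun k hk k' hk' g => ?_⟩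
    rw [h3 k' hk', h2 k hk]

/-! ### The operators of convolution with the generators -/

/-- Left translation of functions: `(translate x F) g = F (x g)`. -/
noncomputable def translate (x : DoubleCover) : (DoubleCover → ℂ) →ₗ[ℂ] (DoubleCover → ℂ) :=
  LinearMap.funLeft ℂ ℂ (x * ·)

@[simp] theorem translate_apply (x : DoubleCover) (F : DoubleCover → ℂ) (g : DoubleCover) :
    translate x F g = F (x * g) := rfl

variable (γ)

/-- The operator of left convolution with `T_w`, written as a sum over the four left cosets of `K₀`
in `K₀ w(1) K₀`. -/
noncomputable def opT : (DoubleCover → ℂ) →ₗ[ℂ] (DoubleCover → ℂ) :=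
  (star (zeta γ) / (Real.sqrt 2 : ℝ)) •
    ∑ j ∈ Finset.range 4, translate ((w 1)⁻¹ * upper (-(j : ℚ_[2])))

/-- The operator of left convolution with `U_1`; the double coset of `w(1/2)` is a single coset. -/
noncomputable def opU : (DoubleCover → ℂ) →ₗ[ℂ] (DoubleCover → ℂ) :=
  star (zeta γ) • translate (w (two ^ (-1 : ℤ)))⁻¹

/-- The sum over cosets in the definition of `opT`. -/
noncomputable def cosetSum (F : DoubleCover → ℂ) (g : DoubleCover) : ℂ :=
  ∑ j ∈ Finset.range 4, F ((w 1)⁻¹ * (upper (-(j : ℚ_[2])) * g))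

theorem opT_apply (F : DoubleCover → ℂ) (g : DoubleCover) :
    opT γ F g = star (zeta γ) / (Real.sqrt 2 : ℝ) * cosetSum F g := by
  simp [opT, cosetSum, mul_assoc]

theorem opU_apply (F : DoubleCover → ℂ) (g : DoubleCover) :
    opU γ F g = star (zeta γ) * F ((w (two ^ (-1 : ℤ)))⁻¹ * g) := by
  simp [opU]

variable {γ}

theorem upper_mul_w_one (b : ℚ_[2]) : upper b * w 1 = w 1 * lower (-b) := by
  simpa using upper_mul_w b 1

theorem lower_mul_w_one (c : ℚ_[2]) : lower c * w 1 = w 1 * upper (-c) := by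
  simpa using lower_mul_w c 1

theorem w_inv_mul_of_mul_w {t : ℚ_[2]ˣ} {x y : DoubleCover} (e : x * w t = w t * y) :
    (w t)⁻¹ * x = y * (w t)⁻¹ := by
  rw [inv_mul_eq_iff_eq_mul, ← mul_assoc, ← e, mul_inv_cancel_right]

namespace LeftEquivariant

theorem w_upper_mul (hF : LeftEquivariant γ F) {b : ℚ_[2]} (hb : ‖b‖ ≤ 1 / 4) (g : DoubleCover) :
    F ((w 1)⁻¹ * (upper b * g)) = F ((w 1)⁻¹ * g) := by
  rw [← mul_assoc, w_inv_mul_of_mul_w (upper_mul_w_one b), mul_assoc,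
    hF.K₁_mul (lower_mem_K₁ (by rwa [norm_neg]))]

theorem w_lower_mul (hF : LeftEquivariant γ F) {c : ℚ_[2]} (hc : ‖c‖ ≤ 1) (g : DoubleCover) :
    F ((w 1)⁻¹ * (lower c * g)) = F ((w 1)⁻¹ * g) := by
  rw [← mul_assoc, w_inv_mul_of_mul_w (lower_mul_w_one c), mul_assoc,
    hF.K₁_mul (upper_mem_K₁ (by rwa [norm_neg]))]

theorem w_h_mul (hF : LeftEquivariant γ F) {t : ℚ_[2]ˣ} (ht : ‖(t : ℚ_[2]) - 1‖ ≤ 1 / 4)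
    (g : DoubleCover) : F ((w 1)⁻¹ * (h t * g)) = F ((w 1)⁻¹ * g) := by
  rw [← mul_assoc, w_inv_mul_of_mul_w (h_mul_w t 1), mul_assoc, hF.K₁_mul (h_mem_K₁ (by
    rw [Units.val_inv_eq_inv_val]
    exact norm_inv_sub_one ht))]

/-- The value of `F` at `w(1)⁻¹ n(b) g` depends only on `b` modulo `4`. -/
theorem w_upper_congr (hF : LeftEquivariant γ F) {b b' : ℚ_[2]} (hb : ‖b - b'‖ ≤ 1 / 4)
    (g : DoubleCover) : F ((w 1)⁻¹ * (upper b * g)) = F ((w 1)⁻¹ * (upper b' * g)) := by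
  rw [← hF.w_upper_mul hb (upper b' * g), ← mul_assoc (upper (b - b')), upper_mul_upper,
    sub_add_cancel]

theorem cosetSum_upper_mul (hF : LeftEquivariant γ F) {b : ℚ_[2]} (hb : ‖b‖ ≤ 1)
    (g : DoubleCover) : cosetSum F (upper b * g) = cosetSum F g := by
  obtain ⟨i, hi, hbi⟩ := exists_natCast_mod_four hb
  unfold cosetSum
  have e : ∀ j : ℕ, F ((w 1)⁻¹ * (upper (-(j : ℚ_[2])) * (upper b * g))) =
      F ((w 1)⁻¹ * (upper ((i : ℚ_[2]) - j) * g)) := fun j => by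
    rw [← mul_assoc (upper _), upper_mul_upper]
    exact hF.w_upper_congr (by rwa [show -(j : ℚ_[2]) + b - (i - j) = b - i by ring]) g
  have p : ∀ x : ℚ_[2], F ((w 1)⁻¹ * (upper (x + 4) * g)) = F ((w 1)⁻¹ * (upper x * g)) :=
    fun x => hF.w_upper_congr (by rw [add_sub_cancel_left, norm_four]) g
  simp only [e]
  have p1 := p (-1)
  have p2 := p (-2)
  have p3 := p (-3)
  norm_num at p1 p2 p3
  interval_cases i <;> simp [Finset.sum_range_succ] <;> norm_num <;>
    simp only [p1, p2, p3] <;> ring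

theorem cosetSum_h_mul (hF : LeftEquivariant γ F) {t : ℚ_[2]ˣ} (ht : ‖(t : ℚ_[2]) - 1‖ ≤ 1 / 4)
    (g : DoubleCover) : cosetSum F (h t * g) = cosetSum F g := by
  refine Finset.sum_congr rfl fun j _ => ?_
  have h0 := t.ne_zero
  have e : upper (-(j : ℚ_[2])) * h t = h t * upper (((t : ℚ_[2]) ^ 2)⁻¹ * -(j : ℚ_[2])) := by
    rw [h_mul_upper, mul_inv_cancel_left₀ (pow_ne_zero 2 h0)]
  rw [← mul_assoc (upper _), e, mul_assoc (h t), hF.w_h_mul ht]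
  refine hF.w_upper_congr ?_ g
  rw [show ((t : ℚ_[2]) ^ 2)⁻¹ * -(j : ℚ_[2]) - -(j : ℚ_[2]) =
    (((t : ℚ_[2]) * t)⁻¹ - 1) * -(j : ℚ_[2]) by rw [pow_two]; ring]
  refine norm_mul_le_left (norm_inv_sub_one (norm_mul_sub_one ht ht)) ?_
  rw [norm_neg]
  exact_mod_cast Padic.norm_int_le_one (p := 2) j

theorem cosetSum_lower_mul (hF : LeftEquivariant γ F) {c : ℚ_[2]} (hc : ‖c‖ ≤ 1 / 4)
    (g : DoubleCover) : cosetSum F (lower c * g) = cosetSum F g := by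
  refine Finset.sum_congr rfl fun j _ => ?_
  have hj : ‖(j : ℚ_[2])‖ ≤ 1 := by exact_mod_cast Padic.norm_int_le_one (p := 2) j
  have hu : ‖(1 - j * c) - 1‖ ≤ 1 / 4 := by
    rw [sub_sub_cancel_left, norm_neg]
    exact norm_mul_le_right hj hc
  have hu1 := norm_eq_one_of_sub hu
  have hu0 : 1 - j * c ≠ 0 := by
    intro h
    simp [h] at hu1
  set u : ℚ_[2]ˣ := Units.mk0 (1 - j * c) hu0 with huu
  have hu0' : 1 - c * j ≠ 0 := by rwa [mul_comm]
  have hc' : ‖c / (1 - j * c)‖ ≤ 1 / 4 := by rwa [norm_div, hu1, div_one]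
  have hb' : ‖-(j : ℚ_[2]) / (1 - j * c)‖ ≤ 1 := by rwa [norm_div, hu1, div_one, norm_neg]
  have m1 := upper_mem_K₁ (b := -(j : ℚ_[2])) (by rwa [norm_neg])
  have m2 := lower_mem_K₁ hc
  have m3 := lower_mem_K₁ hc'
  have m4 := h_mem_K₁ (t := u) hu
  have m5 := upper_mem_K₁ hb'
  -- both sides lie in `K₁`, so that it suffices to compare the matrices
  have e : upper (-(j : ℚ_[2])) * lower c =
      lower (c / (1 - j * c)) * (h u * upper (-(j : ℚ_[2]) / (1 - j * c))) := by
    refine DoubleCover.ext (sl2_ext ?_ ?_ ?_ ?_) ?_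
    · simp [mul_entry, upper, lower, h, huu]
      ring
    · simp [mul_entry, upper, lower, h, huu]
      field_simp
    · simp [mul_entry, upper, lower, h, huu]
      field_simp
    · simp [mul_entry, upper, lower, h, huu]
      field_simp
      ring
    · rw [(mem_K₁_iff.1 (DoubleCover.K₁_mul m1 m2)).2,
        (mem_K₁_iff.1 (DoubleCover.K₁_mul m3 (DoubleCover.K₁_mul m4 m5))).2]
  rw [← mul_assoc (upper _), e, mul_assoc, mul_assoc, hF.w_lower_mul (hc'.trans (by norm_num)),
    hF.w_h_mul hu]
  refine hF.w_upper_congr ?_ g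
  rw [show -(j : ℚ_[2]) / (1 - j * c) - -(j : ℚ_[2]) =
    ((1 - j * c)⁻¹ - 1) * -(j : ℚ_[2]) by ring]
  exact norm_mul_le_left (norm_inv_sub_one hu) (by rwa [norm_neg])

protected theorem opT (hF : LeftEquivariant γ F) : LeftEquivariant γ (opT γ F) := by
  refine of_generators (fun m g => ?_) (fun b hb g => ?_) (fun t ht g => ?_) fun c hc g => ?_
  · rw [opT_apply, opT_apply, mul_left_comm]
    congr 1
    rw [cosetSum, cosetSum, Finset.mul_sum]
    refine Finset.sum_congr rfl fun j _ => ?_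
    rw [← hF.center_mul, ← mul_assoc (upper _), center_comm, mul_assoc, ← mul_assoc (w 1)⁻¹,
      center_comm, mul_assoc]
  · rw [opT_apply, opT_apply, hF.cosetSum_upper_mul hb]
  · rw [opT_apply, opT_apply, hF.cosetSum_h_mul ht]
  · rw [opT_apply, opT_apply, hF.cosetSum_lower_mul hc]

protected theorem opU (hF : LeftEquivariant γ F) : LeftEquivariant γ (opU γ F) := by
  have h2 : ‖((two ^ (-1 : ℤ) : ℚ_[2]ˣ) : ℚ_[2]) ^ 2‖ = 4 := by
    rw [two_pow_val, norm_pow, norm_zpow, norm_two]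
    norm_num
  have h2' : ((two ^ (-1 : ℤ) : ℚ_[2]ˣ) : ℚ_[2]) ^ 2 ≠ 0 := pow_ne_zero 2 (Units.ne_zero _)
  refine of_generators (fun m g => ?_) (fun b hb g => ?_) (fun t ht g => ?_) fun c hc g => ?_
  · rw [opU_apply, opU_apply, mul_left_comm, ← hF.center_mul, ← mul_assoc, center_comm, mul_assoc]
  · rw [opU_apply, opU_apply, ← mul_assoc, w_inv_mul_of_mul_w (upper_mul_w b _), mul_assoc,
      hF.K₁_mul (lower_mem_K₁ _)]
    rw [norm_div, norm_neg, h2]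
    linarith
  · rw [opU_apply, opU_apply, ← mul_assoc, w_inv_mul_of_mul_w (h_mul_w t _), mul_assoc,
      hF.K₁_mul (h_mem_K₁ (by
        rw [Units.val_inv_eq_inv_val]
        exact norm_inv_sub_one ht))]
  · rw [opU_apply, opU_apply, ← mul_assoc, w_inv_mul_of_mul_w (lower_mul_w c _), mul_assoc,
      hF.K₁_mul (upper_mem_K₁ _)]
    rw [norm_mul, norm_neg, h2]
    linarith

end LeftEquivariant

theorem HasCompactSupport.translate (x : DoubleCover) (hF : HasCompactSupport F) :
    HasCompactSupport (translate x F) :=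
  hF.comp_homeomorph (leftHomeo x)

theorem opT_mem (hF : F ∈ heckeSpace γ) : opT γ F ∈ heckeSpace γ := by
  obtain ⟨h1, h2, h3⟩ := mem_heckeSpace_iff.1 hF
  refine mem_heckeSpace_iff.2 ⟨?_, h2.opT, fun k hk g => ?_⟩
  · have e : opT γ F = fun g => star (zeta γ) / (Real.sqrt 2 : ℝ) *
        (∑ j ∈ Finset.range 4, translate ((w 1)⁻¹ * upper (-(j : ℚ_[2]))) F) g := by
      funext g
      simp [opT]
    rw [e]
    refine HasCompactSupport.mul_left ?_
    simp only [Finset.sum_range_succ, Finset.sum_range_zero, zero_add]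
    exact (((HasCompactSupport.translate _ h1).add (HasCompactSupport.translate _ h1)).add
      (HasCompactSupport.translate _ h1)).add (HasCompactSupport.translate _ h1)
  · rw [opT_apply, opT_apply, cosetSum, cosetSum, mul_assoc, Finset.sum_mul]
    simp only [← mul_assoc, h3 k hk]

theorem opU_mem (hF : F ∈ heckeSpace γ) : opU γ F ∈ heckeSpace γ := by
  obtain ⟨h1, h2, h3⟩ := mem_heckeSpace_iff.1 hF
  refine mem_heckeSpace_iff.2 ⟨?_, h2.opU, fun k hk g => ?_⟩
  · have e : opU γ F = fun g => star (zeta γ) * translate (w (two ^ (-1 : ℤ)))⁻¹ F g := by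
      funext g
      simp [opU]
    rw [e]
    exact HasCompactSupport.mul_left (HasCompactSupport.translate _ h1)
  · rw [opU_apply, opU_apply]
    simp only [← mul_assoc, h3 k hk]

end operators

/-! ### The relations -/

section relations

variable {γ : Subgroup.center DoubleCover →* ℂˣ} {F : DoubleCover → ℂ}

theorem gamma_hNegOne_inv (hγ : γ muNegOne = -1) :
    (γ hNegOne⁻¹ : ℂ) = star (γ hNegOne : ℂ) := by
  rw [map_inv, Units.val_inv_eq_inv_val, star_gamma_hNegOne hγ]
  refine inv_eq_of_mul_eq_one_right ?_
  linear_combination -gamma_hNegOne_sq hγ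

theorem opU_opU (hγ : γ muNegOne = -1) (hF : LeftEquivariant γ F) : opU γ (opU γ F) = F := by
  funext g
  rw [opU_apply, opU_apply, ← mul_assoc _ _ g, ← mul_inv_rev, w_half_sq, ← Subgroup.coe_inv,
    hF.center_mul, gamma_hNegOne_inv hγ, star_star, ← mul_assoc, ← mul_assoc, ← pow_two,
    ← star_pow, zeta_sq hγ, star_gamma_hNegOne hγ]
  linear_combination (-F g) * gamma_hNegOne_sq hγ

theorem lower_eq_conj (c : ℚ_[2]) : lower c = (w 1)⁻¹ * upper (-c) * w 1 := by
  rw [mul_assoc, upper_mul_w_one, inv_mul_cancel_left, neg_neg]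

theorem lower_mul_lower (b c : ℚ_[2]) : lower b * lower c = lower (b + c) := by
  rw [lower_eq_conj b, lower_eq_conj c, lower_eq_conj (b + c), neg_add, ← upper_mul_upper]
  group

theorem upper_comm (b c : ℚ_[2]) : upper b * upper c = upper c * upper b := by
  rw [upper_mul_upper, upper_mul_upper, add_comm]

/-- The element `n⁻(2) n(1) n⁻(2)⁻¹` lies in `K₀`, over `-Γ₁(4)`. It makes an equivariant function
vanish on the double coset of `n⁻(2)`. -/
theorem lower_two_mul_upper_one : ∃ k ∈ K₀, -k.mat ∈ Gamma1 ∧ lower 2 * upper 1 = k * lower 2 := by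
  have h3 : ‖(2 : ℚ_[2]) + 2‖ ≤ 1 / 4 := by
    rw [show (2 : ℚ_[2]) + 2 = 4 by norm_num, norm_four]
  have hk : -(lower 2 * upper 1 * (lower 2)⁻¹).mat ∈ Gamma1 := by
    obtain ⟨i1, i2, i3, i4⟩ := inv_entries (lowerMat 2)
    rw [mem_Gamma1_iff]
    simp only [Matrix.SpecialLinearGroup.coe_neg, Matrix.neg_apply, mul_mat, inv_mat, lower, upper,
      sec_mat, mul_entry, i1, i2, i3, i4]
    simp only [lowerMat_00, lowerMat_01, lowerMat_10, lowerMat_11, upperMat_00, upperMat_01,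
      upperMat_10, upperMat_11]
    norm_num [norm_four]
  exact ⟨_, mem_K₀_iff.2 (Or.inr hk), hk, (inv_mul_cancel_right _ _).symm⟩

theorem apply_lower_two_upper (hγ : γ muNegOne = -1) (hF : LeftEquivariant γ F) :
    ∃ κ : ℂ, κ ^ 2 = -1 ∧ ∀ g, F (lower 2 * (upper 1 * g)) = κ * F (lower 2 * g) := by
  obtain ⟨k, hk, hk', e⟩ := lower_two_mul_upper_one
  refine ⟨star (gammaK₀ γ k), ?_, fun g => ?_⟩
  · rw [← star_pow, gammaK₀_sq_of_neg_mem hγ hk', star_neg, star_one]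
  · rw [← mul_assoc, e, mul_assoc, hF k hk]

/-- The quadratic relation. In the double sum over the cosets of `K₀ w(1) K₀`, the elements `n⁻(i)`
with `i` congruent to `±1` modulo `4` reduce to `n⁻(±1) = n(±1) w(∓1) n(±1)` and yield a multiple
of `T_w`, the element `n⁻(0) = 1` yields a multiple of the identity, and `n⁻(2)` yields nothing. -/
theorem opT_opT (hγ : γ muNegOne = -1) (hF : LeftEquivariant γ F) :
    opT γ (opT γ F) = opT γ F + (2 : ℂ) • F := by
  funext g
  set L : ℚ_[2] → ℂ := fun c => ∑ j ∈ Finset.range 4, F (lower c * (upper (-(j : ℚ_[2])) * g)) with hL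
  have e1 : cosetSum (opT γ F) g = star (zeta γ) / (Real.sqrt 2 : ℝ) * ((γ hNegOne : ℂ) *
      ∑ i ∈ Finset.range 4, L i) := by
    rw [cosetSum]
    simp only [opT_apply]
    rw [← Finset.mul_sum]
    congr 1
    simp only [cosetSum, hL]
    rw [Finset.sum_comm, Finset.mul_sum]
    refine Finset.sum_congr rfl fun i _ => ?_
    rw [Finset.mul_sum]
    refine Finset.sum_congr rfl fun j _ => ?_
    have : (w 1)⁻¹ * (upper (-(i : ℚ_[2])) * ((w 1)⁻¹ * (upper (-(j : ℚ_[2])) * g))) =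
        ((hNegOne⁻¹ : Subgroup.center DoubleCover) : DoubleCover) *
          (lower i * (upper (-(j : ℚ_[2])) * g)) := by
      rw [← mul_assoc _ (lower _), ← center_comm, Subgroup.coe_inv, ← w_one_sq, lower_eq_conj]
      group
    rw [this, hF.center_mul, gamma_hNegOne_inv hγ, star_star]
  have l0 : L 0 = 4 * F g := by
    simp only [hL, lower_zero, one_mul]
    rw [Finset.sum_congr rfl fun j _ => hF.K₁_mul (upper_mem_K₁ _) g]
    · simp
    · intro j _
      rw [norm_neg]
      exact_mod_cast Padic.norm_int_le_one (p := 2) j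
  have l1 : L 1 = cosetSum F g := by
    rw [← hF.cosetSum_upper_mul (b := 1) (by simp) g]
    refine Finset.sum_congr rfl fun j _ => ?_
    rw [lower_one, mul_assoc, mul_assoc, hF.K₁_mul (upper_mem_K₁ (by simp)), w_one_inv,
      ← mul_assoc (upper 1), upper_comm, mul_assoc]
  have l3 : L 3 = star (γ hNegOne : ℂ) * cosetSum F g := by
    rw [← hF.cosetSum_upper_mul (b := -1) (by simp) g, cosetSum, Finset.mul_sum]
    refine Finset.sum_congr rfl fun j _ => ?_
    have hw : w 1 = hNegOne * (w 1)⁻¹ := by rw [← w_one_sq, mul_inv_cancel_right]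
    rw [show (3 : ℚ_[2]) = 4 + -1 by norm_num, ← lower_mul_lower, mul_assoc,
      hF.K₁_mul (lower_mem_K₁ norm_four.le), lower_neg_one, mul_assoc, mul_assoc,
      hF.K₁_mul (upper_mem_K₁ (by simp)), ← mul_assoc (upper (-1)), upper_comm, mul_assoc]
    conv_lhs => rw [hw]
    rw [mul_assoc, hF.center_mul]
  have l2 : L 2 = 0 := by
    obtain ⟨κ, hκ, h⟩ := apply_lower_two_upper hγ hF
    have h' : ∀ b : ℚ_[2], F (lower 2 * (upper (b + 1) * g)) = κ * F (lower 2 * (upper b * g)) := by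
      intro b
      rw [add_comm, ← upper_mul_upper, mul_assoc, h]
    have h1 := h' (-1)
    have h2 := h' (-2)
    have h3 := h' (-3)
    norm_num at h1 h2 h3
    simp only [hL, Finset.sum_range_succ, Finset.sum_range_zero]
    norm_num
    rw [h1, h2, h3]
    linear_combination ((1 + κ) * F (lower 2 * (upper (-3) * g))) * hκ
  rw [opT_apply, e1]
  have hs : ∑ i ∈ Finset.range 4, L i = L 0 + L 1 + L 2 + L 3 := by
    simp [Finset.sum_range_succ]
  rw [hs, l0, l1, l2, l3]
  simp only [Pi.add_apply, Pi.smul_apply, smul_eq_mul, opT_apply]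
  rw [star_zeta hγ, star_gamma_hNegOne hγ, div_div, ← pow_two, sqrt_two_sq]
  have hI := gamma_hNegOne_sq hγ
  set I := (γ hNegOne : ℂ)
  linear_combination ((I - 2) * F g + (1 - I) / 4 * (I - 2) * cosetSum F g) * hI

end relations

/-! ### Double cosets that support equivariant functions -/

/-- The alternating products `s t s t ⋯` of `n` factors of the elements `w(1)` and `w(1/2)`, with
first factor `w(1)` if `b` is `false` and `w(1/2)` if `b` is `true`. Up to the centre they are the
elements `h(2ᵐ)` and `w(2ᵐ)`, so they represent the affine Weyl group. -/
noncomputable def pt : Bool → ℕ → DoubleCover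
  | _, 0 => 1
  | false, n + 1 => w 1 * pt true n
  | true, n + 1 => w (two ^ (-1 : ℤ)) * pt false n

theorem pt_mat_add_two (n : ℕ) : (pt false (n + 2)).mat = hMat (-two) * (pt false n).mat ∧
    (pt true (n + 2)).mat = hMat (-two)⁻¹ * (pt true n).mat := by
  have h1 : wMat 1 * wMat (two ^ (-1 : ℤ)) = hMat (-two) := by
    refine sl2_ext ?_ ?_ ?_ ?_ <;> simp [mul_entry, inv_neg]
  have h2 : wMat (two ^ (-1 : ℤ)) * wMat 1 = hMat (-two)⁻¹ := by
    refine sl2_ext ?_ ?_ ?_ ?_ <;> simp [mul_entry, inv_neg]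
  constructor
  · rw [pt, pt, mul_mat, mul_mat, ← mul_assoc]
    change wMat 1 * wMat _ * _ = _
    rw [h1]
  · rw [pt, pt, mul_mat, mul_mat, ← mul_assoc]
    change wMat _ * wMat 1 * _ = _
    rw [h2]

theorem pt_mat (k : ℕ) :
    (pt false (2 * k)).mat = hMat ((-two) ^ k) ∧ (pt false (2 * k + 1)).mat = wMat ((-two) ^ k) ∧
    (pt true (2 * k)).mat = hMat ((-two)⁻¹ ^ k) ∧
    (pt true (2 * k + 1)).mat = wMat ((-two)⁻¹ ^ k * two ^ (-1 : ℤ)) := by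
  induction k with
  | zero =>
    refine ⟨?_, ?_, ?_, ?_⟩
    · simp [pt, hMat_one]
    · simp [pt, w]
    · simp [pt, hMat_one]
    · simp [pt, w]
  | succ k ih =>
    obtain ⟨i1, i2, i3, i4⟩ := ih
    have e : 2 * (k + 1) + 1 = 2 * k + 1 + 2 := by ring
    rw [e, show 2 * (k + 1) = 2 * k + 2 by ring, (pt_mat_add_two _).1, (pt_mat_add_two _).1,
      (pt_mat_add_two _).2, (pt_mat_add_two _).2, i1, i2, i3, i4, hMat_mul, hMat_mul,
      hMat_mul_wMat, hMat_mul_wMat, pow_succ', pow_succ', mul_assoc]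
    exact ⟨rfl, rfl, rfl, rfl⟩

theorem pt_mem_K₀_iff {b : Bool} {n : ℕ} : pt b n ∈ K₀ ↔ n = 0 := by
  constructor
  · intro hK
    have h1 := norm_entry_of_mem_K₀ hK
    have key : ∀ k : ℕ, ‖((-two : ℚ_[2]ˣ) : ℚ_[2]) ^ k‖ = 1 → k = 0 := by
      intro k hk
      rw [norm_pow, Units.val_neg, norm_neg] at hk
      change ‖(2 : ℚ_[2])‖ ^ k = 1 at hk
      by_contra h0
      exact (pow_lt_one₀ (norm_nonneg _) (by rw [norm_two]; norm_num) h0).ne hk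
    rcases Nat.even_or_odd' n with ⟨k, rfl | rfl⟩ <;> cases b
    · rw [(pt_mat k).1, hMat_00, Units.val_pow_eq_pow_val] at h1
      rw [key k h1]
    · rw [(pt_mat k).2.2.1, hMat_00, Units.val_pow_eq_pow_val, Units.val_inv_eq_inv_val, inv_pow,
        norm_inv, inv_eq_one] at h1
      rw [key k h1]
    · rw [(pt_mat k).2.1, wMat_00] at h1
      simp at h1
    · rw [(pt_mat k).2.2.2, wMat_00] at h1
      simp at h1
  · rintro rfl
    cases b <;> exact K₀_one

theorem h_mem_K₀ {t : ℚ_[2]ˣ} (ht : ‖(t : ℚ_[2])‖ = 1) : h t ∈ K₀ := by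
  rw [mem_K₀_iff]
  have key : ∀ s : ℚ_[2]ˣ, ‖(s : ℚ_[2]) - 1‖ ≤ 1 / 4 → hMat s ∈ Gamma1 := fun s hs =>
    (mem_K₁_iff.1 (h_mem_K₁ hs)).1
  rcases norm_unit_mod_four ht with h1 | h1
  · exact Or.inl (key t h1)
  · right
    have e : -(h t).mat = hMat (-t) := by
      refine sl2_ext ?_ ?_ ?_ ?_ <;> simp [h, inv_neg]
    rw [e]
    exact key (-t) (by simpa using h1)

section support

variable {γ : Subgroup.center DoubleCover →* ℂˣ} {f : DoubleCover → ℂ}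

/-- An equivariant function that vanishes at `y` vanishes on the double coset of `y`, and even on
all elements over its image in `SL₂(ℚ₂)`. -/
theorem eq_zero_of_mat_eq (hl : LeftEquivariant γ f) (hr : RightEquivariant γ f)
    {g k y k' : DoubleCover} (hk : k ∈ K₀) (hk' : k' ∈ K₀) (hy : f y = 0)
    (h : g.mat = k.mat * y.mat * k'.mat) : f g = 0 := by
  have h1 : (g * (k * y * k')⁻¹).mat ∈ Gamma1 := by
    rw [mul_mat, inv_mat, mul_mat, mul_mat, ← h, mul_inv_cancel]
    exact Gamma1_one
  have e : g = g * (k * y * k')⁻¹ * (k * (y * k')) := by group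
  rw [e, hl _ (mem_K₀_iff.2 (Or.inl h1)), hl k hk, hr k' hk', hy]
  simp

/-- Every diagonal or antidiagonal matrix is, up to a diagonal matrix of units, the matrix of an
alternating product of `w(1)` and `w(1/2)`. -/
theorem exists_pt_mat (t : ℚ_[2]ˣ) :
    (∃ b n, ∃ u : ℚ_[2]ˣ, ‖(u : ℚ_[2])‖ = 1 ∧ hMat t = hMat u * (pt b n).mat) ∧
    (∃ b n, ∃ u : ℚ_[2]ˣ, ‖(u : ℚ_[2])‖ = 1 ∧ wMat t = hMat u * (pt b n).mat) := by
  have hn : ∀ s : ℚ_[2]ˣ, ‖(s : ℚ_[2])‖ = ‖(t : ℚ_[2])‖ → ‖((t * s⁻¹ : ℚ_[2]ˣ) : ℚ_[2])‖ = 1 := by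
    intro s hs
    rw [Units.val_mul, Units.val_inv_eq_inv_val, norm_mul, norm_inv, hs]
    exact mul_inv_cancel₀ (norm_ne_zero_iff.2 t.ne_zero)
  have h2 : ‖((-two : ℚ_[2]ˣ) : ℚ_[2])‖ = 2⁻¹ := by
    rw [Units.val_neg, norm_neg]
    change ‖(2 : ℚ_[2])‖ = _
    rw [norm_two, one_div]
  have h2' : ‖((two : ℚ_[2]ˣ) : ℚ_[2])‖ = 2⁻¹ := by
    rw [← h2, Units.val_neg, norm_neg]
  have ht := Padic.norm_eq_zpow_neg_valuation t.ne_zero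
  push_cast at ht
  rcases le_or_gt 0 (t : ℚ_[2]).valuation with hv | hv
  · obtain ⟨k, hk⟩ := Int.eq_ofNat_of_zero_le hv
    have hs : ‖(((-two) ^ k : ℚ_[2]ˣ) : ℚ_[2])‖ = ‖(t : ℚ_[2])‖ := by
      rw [Units.val_pow_eq_pow_val, norm_pow, h2, ht, hk, zpow_neg, inv_pow, zpow_natCast]
    refine ⟨⟨false, 2 * k, _, hn _ hs, ?_⟩, ⟨false, 2 * k + 1, _, hn _ hs, ?_⟩⟩
    · rw [(pt_mat k).1, hMat_mul, inv_mul_cancel_right]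
    · rw [(pt_mat k).2.1, hMat_mul_wMat, inv_mul_cancel_right]
  · obtain ⟨k, hk⟩ := Int.eq_ofNat_of_zero_le (a := -(t : ℚ_[2]).valuation - 1) (by omega)
    have hk' : -(t : ℚ_[2]).valuation = ((k + 1 : ℕ) : ℤ) := by push_cast; omega
    have hs : ‖(((-two)⁻¹ ^ (k + 1) : ℚ_[2]ˣ) : ℚ_[2])‖ = ‖(t : ℚ_[2])‖ := by
      rw [Units.val_pow_eq_pow_val, Units.val_inv_eq_inv_val, norm_pow, norm_inv, h2, inv_inv, ht,
        hk', zpow_natCast]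
    have hs' : ‖(((-two)⁻¹ ^ k * two ^ (-1 : ℤ) : ℚ_[2]ˣ) : ℚ_[2])‖ = ‖(t : ℚ_[2])‖ := by
      rw [← hs, pow_succ, Units.val_mul, Units.val_mul, norm_mul, norm_mul, zpow_neg_one,
        Units.val_inv_eq_inv_val two, Units.val_inv_eq_inv_val (-two), norm_inv two.val,
        norm_inv (-two : ℚ_[2]ˣ).val, h2, h2']
    refine ⟨⟨true, 2 * (k + 1), _, hn _ hs, ?_⟩, ⟨true, 2 * k + 1, _, hn _ hs', ?_⟩⟩
    · rw [(pt_mat _).2.2.1, hMat_mul, inv_mul_cancel_right]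
    · rw [(pt_mat k).2.2.2, hMat_mul_wMat, inv_mul_cancel_right]

/-- The unipotent matrix that fixes the vector `(x, 2 y)`. -/
noncomputable def unipotentMat (x y : ℚ_[2]) : SL(2, ℚ_[2]) :=
  ⟨!![1 - 2 * x * y, x ^ 2; -4 * y ^ 2, 1 + 2 * x * y], by
    rw [Matrix.det_fin_two_of]
    ring⟩

theorem mul_unipotentMat (g : SL(2, ℚ_[2])) {x y X Y : ℚ_[2]} (hX : X = g 0 0 * x + 2 * g 0 1 * y)
    (hY : Y = g 1 0 / 2 * x + g 1 1 * y) : g * unipotentMat x y = unipotentMat X Y * g := by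
  have hd := det_entries g
  have e00 : ∀ x y, unipotentMat x y 0 0 = 1 - 2 * x * y := fun _ _ => rfl
  have e01 : ∀ x y, unipotentMat x y 0 1 = x ^ 2 := fun _ _ => rfl
  have e10 : ∀ x y, unipotentMat x y 1 0 = -4 * y ^ 2 := fun _ _ => rfl
  have e11 : ∀ x y, unipotentMat x y 1 1 = 1 + 2 * x * y := fun _ _ => rfl
  subst hX hY
  refine sl2_ext ?_ ?_ ?_ ?_ <;> simp only [mul_entry, e00, e01, e10, e11]
  · linear_combination (2 * y * (g 0 0 * x + 2 * g 0 1 * y)) * hd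
  · linear_combination (-x * (g 0 0 * x + 2 * g 0 1 * y)) * hd
  · linear_combination (4 * y * (g 1 0 / 2 * x + g 1 1 * y)) * hd
  · linear_combination (-2 * x * (g 1 0 / 2 * x + g 1 1 * y)) * hd

theorem unipotentMat_mem {x y : ℚ_[2]} (hx : ‖x‖ ≤ 1) (hy : ‖y‖ ≤ 1) (h : ‖x * y‖ < 1) :
    unipotentMat x y ∈ Gamma1 := by
  have h2 : ‖2 * x * y‖ ≤ 1 / 4 := by
    rw [mul_assoc, norm_mul, norm_two]
    linarith [norm_le_half h]
  rw [mem_Gamma1_iff]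
  change ‖1 - 2 * x * y - 1‖ ≤ 1 / 4 ∧ ‖x ^ 2‖ ≤ 1 ∧ ‖-4 * y ^ 2‖ ≤ 1 / 4 ∧
    ‖1 + 2 * x * y - 1‖ ≤ 1 / 4
  refine ⟨?_, ?_, ?_, ?_⟩
  · rwa [sub_sub_cancel_left, norm_neg]
  · rw [norm_pow]
    exact pow_le_one₀ (norm_nonneg x) hx
  · refine norm_mul_le_left (by rw [norm_neg, norm_four]) ?_
    rw [norm_pow]
    exact pow_le_one₀ (norm_nonneg y) hy
  · rwa [add_sub_cancel_left]

theorem neg_unipotentMat_mem {x y : ℚ_[2]} (hx : ‖x‖ ≤ 1) (hy : ‖y‖ ≤ 1) (h : ‖x * y‖ = 1) :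
    -unipotentMat x y ∈ Gamma1 := by
  have h1 := norm_sub_one_of_unit h
  have h2 : ‖x * y - 1 + 2‖ ≤ 1 / 2 := norm_add_le_of h1 norm_two.le
  rw [mem_Gamma1_iff]
  change ‖-(1 - 2 * x * y) - 1‖ ≤ 1 / 4 ∧ ‖-x ^ 2‖ ≤ 1 ∧ ‖-(-4 * y ^ 2)‖ ≤ 1 / 4 ∧
    ‖-(1 + 2 * x * y) - 1‖ ≤ 1 / 4
  refine ⟨?_, ?_, ?_, ?_⟩
  · rw [show -(1 - 2 * x * y) - 1 = 2 * (x * y - 1) by ring, norm_mul, norm_two]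
    linarith
  · rw [norm_neg, norm_pow]
    exact pow_le_one₀ (norm_nonneg x) hx
  · rw [norm_neg]
    refine norm_mul_le_left (by rw [norm_neg, norm_four]) ?_
    rw [norm_pow]
    exact pow_le_one₀ (norm_nonneg y) hy
  · rw [show -(1 + 2 * x * y) - 1 = -(2 * (x * y - 1 + 2)) by ring, norm_neg, norm_mul, norm_two]
    linarith

/-- If `g` conjugates an element of `K₀` over `-Γ₁(4)` to an element over `Γ₁(4)`, or conversely, an
equivariant function vanishes at `g`, because `γ` takes the values `±i` on the former and `±1` on
the latter. Here the elements are unipotent. -/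
theorem eq_zero_of_unipotent (hγ : γ muNegOne = -1) (hl : LeftEquivariant γ f)
    (hr : RightEquivariant γ f) {g : DoubleCover} {x y X Y : ℚ_[2]} (hx : ‖x‖ ≤ 1) (hy : ‖y‖ ≤ 1)
    (hX : ‖X‖ ≤ 1) (hY : ‖Y‖ ≤ 1) (eX : X = g.mat 0 0 * x + 2 * g.mat 0 1 * y)
    (eY : Y = g.mat 1 0 / 2 * x + g.mat 1 1 * y)
    (h : ‖x * y‖ = 1 ∧ ‖X * Y‖ < 1 ∨ ‖x * y‖ < 1 ∧ ‖X * Y‖ = 1) : f g = 0 := by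
  set k := sec (unipotentMat x y) with hk
  set k' := g * k * g⁻¹ with hk'
  have m : k.mat = unipotentMat x y := rfl
  have m' : k'.mat = unipotentMat X Y := by
    rw [hk', mul_mat, mul_mat, m, mul_unipotentMat g.mat eX eY, inv_mat, mul_inv_cancel_right]
  have e : g * k = k' * g := by rw [hk', inv_mul_cancel_right]
  have key : k ∈ K₀ → k' ∈ K₀ → (gammaK₀ γ k) ^ 2 ≠ (gammaK₀ γ k') ^ 2 → f g = 0 := by
    intro h1 h2 h3
    by_contra h0
    have h4 := hr k h1 g
    rw [e, hl k' h2, mul_comm] at h4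
    have h5 := star_injective (mul_left_cancel₀ h0 h4)
    exact h3 (by rw [h5])
  rcases h with ⟨h1, h2⟩ | ⟨h1, h2⟩
  · have n1 := neg_unipotentMat_mem hx hy h1
    have n2 := unipotentMat_mem hX hY h2
    rw [← m] at n1
    rw [← m'] at n2
    refine key (mem_K₀_iff.2 (Or.inr n1)) (mem_K₀_iff.2 (Or.inl n2)) ?_
    rw [gammaK₀_sq_of_neg_mem hγ n1, gammaK₀_sq_of_mem γ n2]
    norm_num
  · have n1 := unipotentMat_mem hx hy h1
    have n2 := neg_unipotentMat_mem hX hY h2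
    rw [← m] at n1
    rw [← m'] at n2
    refine key (mem_K₀_iff.2 (Or.inl n1)) (mem_K₀_iff.2 (Or.inr n2)) ?_
    rw [gammaK₀_sq_of_neg_mem hγ n2, gammaK₀_sq_of_mem γ n1]
    norm_num

/-- An equivariant function that vanishes at all the alternating products of `w(1)` and `w(1/2)` is
zero. Compare the norms of the entries of `(a, 2b; c/2, d)`. If an entry of maximal norm is
larger than its two neighbours, the matrix is in the double coset of a monomial matrix, by Gaussian
elimination. If it has the same norm as a neighbour, the function vanishes at the matrix. -/
theorem eq_zero_of_pt (hγ : γ muNegOne = -1) (hl : LeftEquivariant γ f)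
    (hr : RightEquivariant γ f) (h0 : ∀ b n, f (pt b n) = 0) : f = 0 := by
  funext g
  change f g = 0
  have hd := det_entries g.mat
  have hh : ∀ t : ℚ_[2]ˣ, f (h t) = 0 := fun t => by
    obtain ⟨b, n, u, hu, e⟩ := (exists_pt_mat t).1
    exact eq_zero_of_mat_eq hl hr (h_mem_K₀ hu) K₀_one (h0 b n) (by
      rw [one_mat, mul_one]
      exact e)
  have hw : ∀ t : ℚ_[2]ˣ, f (w t) = 0 := fun t => by
    obtain ⟨b, n, u, hu, e⟩ := (exists_pt_mat t).2
    exact eq_zero_of_mat_eq hl hr (h_mem_K₀ hu) K₀_one (h0 b n) (by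
      rw [one_mat, mul_one]
      exact e)
  have kill := fun x y X Y hx hy hX hY => eq_zero_of_unipotent hγ hl hr (g := g) (x := x) (y := y)
    (X := X) (Y := Y) hx hy hX hY
  have hmax : ∀ r : ℝ, ‖g.mat 0 0‖ ≤ r → ‖2 * g.mat 0 1‖ ≤ r → ‖g.mat 1 0 / 2‖ ≤ r →
      ‖g.mat 1 1‖ ≤ r → 1 ≤ r := by
    intro r h1 h2 h3 h4
    by_contra h
    rw [not_le] at h
    have h5 := norm_sub_le_of (norm_mul_le_left h1 (h4.trans h.le))
      (norm_mul_le_left h2 (h3.trans h.le))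
    rw [show g.mat 0 0 * g.mat 1 1 - 2 * g.mat 0 1 * (g.mat 1 0 / 2) = 1 by
      linear_combination hd, norm_one] at h5
    linarith
  have hu : ∀ {x y : ℚ_[2]}, y ≠ 0 → ‖x‖ < ‖2 * y‖ → ‖x / y‖ ≤ 1 / 4 := by
    intro x y hy h
    refine norm_le_quarter ?_
    rw [norm_mul, norm_two] at h
    rw [norm_div, div_lt_iff₀ (norm_pos_iff.2 hy)]
    exact h
  have hv : ∀ {x y : ℚ_[2]}, y ≠ 0 → ‖x‖ < ‖y / 2‖ → ‖x / y‖ ≤ 1 := by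
    intro x y hy h
    refine norm_le_one_of_lt ?_
    rw [norm_div, norm_two] at h
    rw [norm_div, div_lt_iff₀ (norm_pos_iff.2 hy)]
    linarith
  have hu' : ∀ {x y : ℚ_[2]}, y ≠ 0 → ‖x / 2‖ < ‖y‖ → ‖x / y‖ ≤ 1 / 4 := by
    intro x y hy h
    refine hu hy ?_
    rw [norm_div, norm_two] at h
    rw [norm_mul, norm_two]
    linarith
  have hv' : ∀ {x y : ℚ_[2]}, y ≠ 0 → ‖2 * x‖ < ‖y‖ → ‖x / y‖ ≤ 1 := by
    intro x y hy h
    refine hv hy ?_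
    rw [norm_mul, norm_two] at h
    rw [norm_div, norm_two]
    linarith
  have hinv : ∀ {x y : ℚ_[2]}, 1 ≤ ‖y‖ → x = y⁻¹ ∨ x = -y⁻¹ → ‖x‖ ≤ 1 := by
    rintro x y hy (rfl | rfl)
    · rw [norm_inv]
      exact inv_le_one_of_one_le₀ hy
    · rw [norm_neg, norm_inv]
      exact inv_le_one_of_one_le₀ hy
  -- a tie in the first row, in the second row, in the first column, in the second column
  have row₀ : 1 ≤ ‖2 * g.mat 0 1‖ → ‖g.mat 0 0‖ = ‖2 * g.mat 0 1‖ → f g = 0 := by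
    intro h1 h2
    have hb : g.mat 0 1 ≠ 0 := by rintro hb; rw [hb] at h1; norm_num at h1
    have hy : ‖-g.mat 0 0 / (2 * g.mat 0 1)‖ = 1 := by
      rw [norm_div, norm_neg, h2, div_self (by linarith)]
    refine kill 1 (-g.mat 0 0 / (2 * g.mat 0 1)) 0 (-(2 * g.mat 0 1)⁻¹) (by simp) hy.le (by simp)
      (hinv h1 (Or.inr rfl)) ?_ ?_ (Or.inl ⟨by rw [one_mul, hy], by simp⟩)
    · field_simp
      ring
    · field_simp
      linear_combination hd
  have row₁ : 1 ≤ ‖g.mat 1 1‖ → ‖g.mat 1 0 / 2‖ = ‖g.mat 1 1‖ → f g = 0 := by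
    intro h1 h2
    have hb : g.mat 1 1 ≠ 0 := by rintro hb; rw [hb] at h1; norm_num at h1
    have hy : ‖-(g.mat 1 0 / 2) / g.mat 1 1‖ = 1 := by
      rw [norm_div, norm_neg, h2, div_self (by linarith)]
    refine kill 1 (-(g.mat 1 0 / 2) / g.mat 1 1) (g.mat 1 1)⁻¹ 0 (by simp) hy.le
      (hinv h1 (Or.inl rfl)) (by simp) ?_ ?_ (Or.inl ⟨by rw [one_mul, hy], by simp⟩)
    · field_simp
      linear_combination -hd
    · field_simp
      ring
  have col₀ : 1 ≤ ‖g.mat 0 0‖ → ‖g.mat 1 0 / 2‖ = ‖g.mat 0 0‖ → f g = 0 := by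
    intro h1 h2
    have hb : g.mat 0 0 ≠ 0 := by rintro hb; rw [hb] at h1; norm_num at h1
    have hy : ‖g.mat 1 0 / 2 / g.mat 0 0‖ = 1 := by
      rw [norm_div, h2, div_self (by linarith)]
    refine kill (g.mat 0 0)⁻¹ 0 1 (g.mat 1 0 / 2 / g.mat 0 0) (hinv h1 (Or.inl rfl)) (by simp)
      (by simp) hy.le ?_ ?_ (Or.inr ⟨by simp, by rw [one_mul, hy]⟩)
    · field_simp
      ring
    · field_simp
      ring
  have col₁ : 1 ≤ ‖2 * g.mat 0 1‖ → ‖g.mat 1 1‖ = ‖2 * g.mat 0 1‖ → f g = 0 := by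
    intro h1 h2
    have hb : g.mat 0 1 ≠ 0 := by rintro hb; rw [hb] at h1; norm_num at h1
    have hy : ‖g.mat 1 1 / (2 * g.mat 0 1)‖ = 1 := by
      rw [norm_div, h2, div_self (by linarith)]
    refine kill 0 (2 * g.mat 0 1)⁻¹ 1 (g.mat 1 1 / (2 * g.mat 0 1)) (by simp)
      (hinv h1 (Or.inl rfl)) (by simp) hy.le ?_ ?_ (Or.inr ⟨by simp, by rw [one_mul, hy]⟩)
    · field_simp
      ring
    · field_simp
      ring
  -- an entry that is larger than its neighbours, for each of the four positions
  have pos00 : g.mat 0 0 ≠ 0 → ‖2 * g.mat 0 1‖ < ‖g.mat 0 0‖ → ‖g.mat 1 0 / 2‖ < ‖g.mat 0 0‖ →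
      f g = 0 := by
    intro hn h1 h2
    refine eq_zero_of_mat_eq hl hr (K₁_subset_K₀ (lower_mem_K₁ (hu' hn h2)))
      (K₁_subset_K₀ (upper_mem_K₁ (hv' hn h1))) (hh (Units.mk0 _ hn)) ?_
    refine sl2_ext ?_ ?_ ?_ ?_ <;> simp [mul_entry, lower, upper, h] <;> field_simp
    linear_combination hd
  have pos11 : g.mat 1 1 ≠ 0 → ‖2 * g.mat 0 1‖ < ‖g.mat 1 1‖ → ‖g.mat 1 0 / 2‖ < ‖g.mat 1 1‖ →
      f g = 0 := by
    intro hn h1 h2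
    refine eq_zero_of_mat_eq hl hr (K₁_subset_K₀ (upper_mem_K₁ (hv' hn h1)))
      (K₁_subset_K₀ (lower_mem_K₁ (hu' hn h2))) (hh (Units.mk0 _ hn)⁻¹) ?_
    refine sl2_ext ?_ ?_ ?_ ?_ <;> simp [mul_entry, lower, upper, h] <;> field_simp
    linear_combination hd
  have pos01 : g.mat 0 1 ≠ 0 → ‖g.mat 0 0‖ < ‖2 * g.mat 0 1‖ → ‖g.mat 1 1‖ < ‖2 * g.mat 0 1‖ →
      f g = 0 := by
    intro hn h1 h2
    refine eq_zero_of_mat_eq hl hr (K₁_subset_K₀ (lower_mem_K₁ (hu hn h2)))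
      (K₁_subset_K₀ (lower_mem_K₁ (hu hn h1))) (hw (Units.mk0 _ hn)) ?_
    refine sl2_ext ?_ ?_ ?_ ?_ <;> simp [mul_entry, lower, w] <;> field_simp
    linear_combination -hd
  have pos10 : g.mat 1 0 ≠ 0 → ‖g.mat 0 0‖ < ‖g.mat 1 0 / 2‖ → ‖g.mat 1 1‖ < ‖g.mat 1 0 / 2‖ →
      f g = 0 := by
    intro hn h1 h2
    refine eq_zero_of_mat_eq hl hr (K₁_subset_K₀ (upper_mem_K₁ (hv hn h1)))
      (K₁_subset_K₀ (upper_mem_K₁ (hv hn h2))) (hw (-(Units.mk0 _ hn)⁻¹)) ?_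
    refine sl2_ext ?_ ?_ ?_ ?_ <;> simp [mul_entry, upper, w, inv_neg] <;> field_simp
    linear_combination -hd
  have ne : ∀ {x : ℚ_[2]}, 1 ≤ ‖x‖ → x ≠ 0 := by
    rintro x hx rfl
    norm_num at hx
  set P := ‖g.mat 0 0‖
  set Q := ‖2 * g.mat 0 1‖
  set R := ‖g.mat 1 0 / 2‖
  set S := ‖g.mat 1 1‖
  by_cases hP : Q ≤ P ∧ R ≤ P ∧ S ≤ P
  · have h1 := hmax P le_rfl hP.1 hP.2.1 hP.2.2
    rcases hP.1.lt_or_eq with h2 | h2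
    · rcases hP.2.1.lt_or_eq with h3 | h3
      · exact pos00 (ne h1) h2 h3
      · exact col₀ h1 h3
    · exact row₀ (h2 ▸ h1) h2.symm
  by_cases hQ : P ≤ Q ∧ R ≤ Q ∧ S ≤ Q
  · have h1 := hmax Q hQ.1 le_rfl hQ.2.1 hQ.2.2
    rcases hQ.1.lt_or_eq with h2 | h2
    · rcases hQ.2.2.lt_or_eq with h3 | h3
      · exact pos01 (right_ne_zero_of_mul (ne h1)) h2 h3
      · exact col₁ h1 h3
    · exact row₀ h1 h2
  by_cases hR : P ≤ R ∧ Q ≤ R ∧ S ≤ R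
  · have h1 := hmax R hR.1 hR.2.1 le_rfl hR.2.2
    rcases hR.1.lt_or_eq with h2 | h2
    · rcases hR.2.2.lt_or_eq with h3 | h3
      · exact pos10 (fun h => ne h1 (by rw [h, zero_div])) h2 h3
      · exact row₁ (h3 ▸ h1) h3.symm
    · exact col₀ (h2 ▸ h1) h2.symm
  have hS : P ≤ S ∧ Q ≤ S ∧ R ≤ S := by
    clear * - hP hQ hR
    grind
  have h1 := hmax S hS.1 hS.2.1 hS.2.2 le_rfl
  rcases hS.2.1.lt_or_eq with h2 | h2
  · rcases hS.2.2.lt_or_eq with h3 | h3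
    · exact pos11 (ne h1) h2 h3
    · exact row₁ h1 h3
  · exact col₁ (h2 ▸ h1) h2.symm

end support

/-! ### The unit and the generators as functions -/

section functions

variable (γ : Subgroup.center DoubleCover →* ℂˣ)

theorem gammaK₀_of_notMem {x : DoubleCover} (hx : x ∉ K₀) : gammaK₀ γ x = 0 := by
  unfold gammaK₀
  rw [dif_neg]
  rintro ⟨m, k, hk, rfl⟩
  exact hx (center_mul_mem_K₀ m hk)

/-- The unit of the Hecke algebra: the conjugate of `γ` on `K₀`, and zero elsewhere. -/
noncomputable def unitFn (x : DoubleCover) : ℂ := star (gammaK₀ γ x)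

theorem unitFn_ne_zero_iff {x : DoubleCover} : unitFn γ x ≠ 0 ↔ x ∈ K₀ := by
  rw [unitFn, star_ne_zero]
  refine ⟨fun h => ?_, gammaK₀_ne_zero γ⟩
  by_contra hx
  exact h (gammaK₀_of_notMem γ hx)

theorem unitFn_mem : unitFn γ ∈ heckeSpace γ := by
  refine mem_heckeSpace_iff.2 ⟨?_, fun k hk g => ?_, fun k hk g => ?_⟩
  · refine HasCompactSupport.intro' isCompact_K₀ isClosed_K₀ fun x hx => ?_
    by_contra h
    exact hx ((unitFn_ne_zero_iff γ).1 h)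
  · by_cases hg : g ∈ K₀
    · rw [unitFn, unitFn, gammaK₀_mul γ hk hg, star_mul']
    · rw [unitFn, unitFn, gammaK₀_of_notMem γ hg,
        gammaK₀_of_notMem γ fun h => hg ((mul_mem_K₀_iff' hk).1 h)]
      simp
  · by_cases hg : g ∈ K₀
    · rw [unitFn, unitFn, gammaK₀_mul γ hg hk, star_mul']
    · rw [unitFn, unitFn, gammaK₀_of_notMem γ hg,
        gammaK₀_of_notMem γ fun h => hg ((mul_mem_K₀_iff hk).1 h)]
      simp

variable {γ} {F : DoubleCover → ℂ}

/-- The function `X_g` is determined by its support, its equivariance and its value at `g`. -/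
theorem eq_X (hF : F ∈ heckeSpace γ) {g : DoubleCover} (hg : F g = star (gammaN γ g))
    (hs : ∀ x, F x ≠ 0 → ∃ k ∈ K₀, ∃ k' ∈ K₀, x = k * g * k') : F = X γ g := by
  obtain ⟨-, hl, hr⟩ := mem_heckeSpace_iff.1 hF
  funext x
  unfold X
  split_ifs with hx
  · obtain ⟨h1, h2, h3⟩ := hx.choose_spec
    conv_lhs => rw [h3]
    rw [hr _ h2, hl _ h1, hg]
  · by_contra h
    obtain ⟨k, hk, k', hk', e⟩ := hs x h
    exact hx ⟨(k, k'), hk, hk', e⟩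

theorem unitFn_eq_X (hγ : γ muNegOne = -1) : unitFn γ = X γ 1 := by
  refine eq_X (unitFn_mem γ) ?_ fun x hx => ?_
  · rw [unitFn, gammaK₀_one, gammaN_one hγ]
  · exact ⟨x, (unitFn_ne_zero_iff γ).1 hx, 1, K₀_one, by simp⟩

theorem opU_unitFn (hγ : γ muNegOne = -1) : opU γ (unitFn γ) = U γ 1 := by
  refine eq_X (opU_mem (unitFn_mem γ)) ?_ fun x hx => ?_
  · rw [opU_apply, inv_mul_cancel, unitFn, gammaK₀_one, gammaN_w hγ, star_one, mul_one]
  · rw [opU_apply] at hx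
    have h1 := (unitFn_ne_zero_iff γ).1 (right_ne_zero_of_mul hx)
    exact ⟨1, K₀_one, _, h1, by simp⟩

theorem lower_mem_K₀_iff {c : ℚ_[2]} : lower c ∈ K₀ ↔ ‖c‖ ≤ 1 / 4 :=
  ⟨fun h => h.2, fun h => K₁_subset_K₀ (lower_mem_K₁ h)⟩

theorem opT_unitFn (hγ : γ muNegOne = -1) : opT γ (unitFn γ) = Tw γ := by
  have h2 : ((Real.sqrt 2 : ℝ) : ℂ) ≠ 0 := by
    intro h
    have := sqrt_two_sq
    rw [h] at this
    norm_num at this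
  have hF : ((Real.sqrt 2 : ℝ) : ℂ) • opT γ (unitFn γ) = X γ (w (two ^ (-0 : ℤ))) := by
    refine eq_X (Submodule.smul_mem _ _ (opT_mem (unitFn_mem γ))) ?_ fun x hx => ?_
    · have n2 : ¬ ‖(2 : ℚ_[2])‖ ≤ 1 / 4 := by rw [norm_two]; norm_num
      have n3 : ¬ ‖(3 : ℚ_[2])‖ ≤ 1 / 4 := by
        intro h
        have := norm_sub_le_of norm_four.le h
        norm_num at this
      have z : ∀ c : ℚ_[2], ¬ ‖c‖ ≤ 1 / 4 → unitFn γ (lower c) = 0 := fun c hc => by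
        by_contra h
        exact hc (lower_mem_K₀_iff.1 ((unitFn_ne_zero_iff γ).1 h))
      rw [gammaN_w hγ, Pi.smul_apply, opT_apply, cosetSum, neg_zero, zpow_zero]
      have e : ∀ j : ℕ, (w 1)⁻¹ * (upper (-(j : ℚ_[2])) * w 1) = lower j := fun j => by
        rw [lower_eq_conj, mul_assoc]
      simp only [e, Finset.sum_range_succ, Finset.sum_range_zero]
      norm_num only [Nat.cast_zero, Nat.cast_one, Nat.cast_ofNat]
      rw [z 1 (by norm_num), z 2 n2, z 3 n3, lower_zero, unitFn, gammaK₀_one, smul_eq_mul]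
      field_simp
      simp
    · rw [Pi.smul_apply, opT_apply] at hx
      have h3 := right_ne_zero_of_mul (right_ne_zero_of_mul hx)
      obtain ⟨j, -, hj⟩ := Finset.exists_ne_zero_of_sum_ne_zero h3
      have h1 := (unitFn_ne_zero_iff γ).1 hj
      have hu : upper (j : ℚ_[2]) ∈ K₀ :=
        K₁_subset_K₀ (upper_mem_K₁ (by exact_mod_cast Padic.norm_int_le_one (p := 2) j))
      refine ⟨_, hu, _, h1, ?_⟩
      rw [neg_zero, zpow_zero, ← mul_assoc, ← mul_assoc, mul_inv_cancel_right,
        upper_mul_upper, add_neg_cancel, upper_zero, one_mul]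
  rw [Tw, U, ← hF, inv_smul_smul₀ h2]

end functions

/-! ### Convolution -/

section convolution

variable {γ : Subgroup.center DoubleCover →* ℂˣ} {F f : DoubleCover → ℂ} (μ : Measure DoubleCover)

theorem integrable_conv [IsFiniteMeasureOnCompacts μ] (hF : HasCompactSupport F)
    (hr : RightEquivariant γ F) (hl : LeftEquivariant γ f) (g₀ : DoubleCover) :
    Integrable (fun g => F g * f (g⁻¹ * g₀)) μ := by
  refine Continuous.integrable_of_hasCompactSupport ?_ hF.mul_right
  refine (isLocallyConstant_of_mul fun x k hk => ?_).continuous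
  rw [hr.mul_K₁ hk, mul_inv_rev, mul_assoc, hl.K₁_mul (K₁_inv hk)]

theorem conv_translate [μ.IsMulLeftInvariant] (x : DoubleCover) :
    conv μ (translate x F) f = translate x (conv μ F f) := by
  funext g₀
  have e : ∀ g, translate x F g * f (g⁻¹ * g₀) =
      (fun y => F y * f (y⁻¹ * (x * g₀))) (leftHomeo x g) := fun g => by
    simp only [leftHomeo_apply, translate_apply, mul_inv_rev]
    congr 2
    group
  have h1 := (leftHomeo x).measurableEmbedding.integral_map (μ := μ)
    (fun y => F y * f (y⁻¹ * (x * g₀)))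
  have h2 : μ.map (leftHomeo x) = μ := map_mul_left_eq_self μ x
  rw [h2] at h1
  rw [translate_apply, conv, conv, h1]
  exact integral_congr_ae (Filter.Eventually.of_forall e)

theorem RightEquivariant.translate (hr : RightEquivariant γ F) (x : DoubleCover) :
    RightEquivariant γ (translate x F) := fun k hk g => by
  rw [translate_apply, translate_apply, ← mul_assoc, hr k hk]

theorem conv_opT [μ.IsHaarMeasure] (hF : F ∈ heckeSpace γ) (hf : f ∈ heckeSpace γ) :
    conv μ (opT γ F) f = opT γ (conv μ F f) := by
  obtain ⟨h1, -, h3⟩ := mem_heckeSpace_iff.1 hF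
  obtain ⟨-, h2, -⟩ := mem_heckeSpace_iff.1 hf
  funext g₀
  simp only [opT, LinearMap.smul_apply, LinearMap.sum_apply, ← conv_translate]
  simp only [conv, Pi.smul_apply, Finset.sum_apply, smul_eq_mul, mul_assoc, Finset.sum_mul]
  rw [integral_const_mul, integral_finsetSum]
  exact fun j _ => integrable_conv μ (HasCompactSupport.translate _ h1) (h3.translate _) h2 g₀

theorem conv_opU [μ.IsHaarMeasure] : conv μ (opU γ F) f = opU γ (conv μ F f) := by
  funext g₀
  simp only [opU, LinearMap.smul_apply, ← conv_translate]
  simp only [conv, Pi.smul_apply, smul_eq_mul, mul_assoc]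
  rw [integral_const_mul]

theorem conv_add [μ.IsHaarMeasure] {F' : DoubleCover → ℂ} (hF : F ∈ heckeSpace γ)
    (hF' : F' ∈ heckeSpace γ) (hf : f ∈ heckeSpace γ) :
    conv μ (F + F') f = conv μ F f + conv μ F' f := by
  obtain ⟨h1, -, h3⟩ := mem_heckeSpace_iff.1 hF
  obtain ⟨h1', -, h3'⟩ := mem_heckeSpace_iff.1 hF'
  obtain ⟨-, h2, -⟩ := mem_heckeSpace_iff.1 hf
  funext g₀
  simp only [conv, Pi.add_apply, add_mul]
  exact integral_add (integrable_conv μ h1 h3 h2 g₀) (integrable_conv μ h1' h3' h2 g₀)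

theorem conv_smul (c : ℂ) : conv μ (c • F) f = c • conv μ F f := by
  funext g₀
  simp only [conv, Pi.smul_apply, smul_eq_mul, mul_assoc]
  rw [integral_const_mul]

theorem conv_unitFn (hμ : μ K₀ = 1) (hf : LeftEquivariant γ f) : conv μ (unitFn γ) f = f := by
  funext g₀
  have e : ∀ g, unitFn γ g * f (g⁻¹ * g₀) = K₀.indicator (fun _ => f g₀) g := fun g => by
    by_cases hg : g ∈ K₀
    · rw [Set.indicator_of_mem hg, hf _ (K₀_inv hg), ← mul_assoc, unitFn, ← star_mul',
        gammaK₀_inv γ hg, star_one, one_mul]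
    · rw [Set.indicator_of_notMem hg, unitFn, gammaK₀_of_notMem γ hg, star_zero, zero_mul]
  simp only [conv, e]
  rw [integral_indicator isOpen_K₀.measurableSet, setIntegral_const]
  simp [Measure.real, hμ]

end convolution

/-! ### The presented algebra and its action on the Hecke algebra -/

section presentation

theorem sub_two_mul_add_one {R : Type*} [Ring R] (x : R) :
    (x - 2) * (x + 1) = x * x - (x + 2) := by
  rw [sub_mul, mul_add, mul_add, mul_one, mul_one, two_mul]
  abel

theorem gen_zero_mul_self : gen 0 * gen 0 = gen 0 + (2 : ℂ) • (1 : PresentedAlgebra) := by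
  have h := RingQuot.mkAlgHom_rel ℂ HeckeRel.quadratic
  have e2 : RingQuot.mkAlgHom ℂ HeckeRel 2 = 2 := map_ofNat _ 2
  rw [map_mul, map_sub, map_add, map_one, map_zero, e2] at h
  change (gen 0 - 2) * (gen 0 + 1) = 0 at h
  have h2 : (2 : ℂ) • (1 : PresentedAlgebra) = 2 := by
    rw [two_smul, one_add_one_eq_two]
  rw [h2, ← sub_eq_zero, ← h, sub_two_mul_add_one]

theorem gen_one_mul_self : gen 1 * gen 1 = 1 := by
  have h := RingQuot.mkAlgHom_rel ℂ HeckeRel.involution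
  rwa [map_pow, map_one, pow_two] at h

/-- A subspace of the presented algebra that contains `1` and is stable under left multiplication
by the generators is everything. -/
theorem eq_top_of_gen_mul_mem (N : Submodule ℂ PresentedAlgebra) (h1 : 1 ∈ N)
    (h : ∀ i, ∀ a ∈ N, gen i * a ∈ N) : N = ⊤ := by
  have key : ∀ p : FreeAlgebra ℂ (Fin 2), ∀ a ∈ N, RingQuot.mkAlgHom ℂ HeckeRel p * a ∈ N := by
    intro p
    induction p using FreeAlgebra.induction with
    | grade0 r =>
      intro a ha
      rw [AlgHom.commutes, ← Algebra.smul_def]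
      exact N.smul_mem r ha
    | grade1 i => exact h i
    | mul p q hp hq =>
      intro a ha
      rw [map_mul, mul_assoc]
      exact hp _ (hq a ha)
    | add p q hp hq =>
      intro a ha
      rw [map_add, add_mul]
      exact N.add_mem (hp a ha) (hq a ha)
  refine eq_top_iff.2 fun a _ => ?_
  obtain ⟨p, rfl⟩ := RingQuot.mkAlgHom_surjective ℂ HeckeRel a
  simpa using key p 1 h1

/-- The alternating words of length `n` in the generators, with first letter `t` if `b` is `false`
and `u` if `b` is `true`. -/
noncomputable def word : Bool → ℕ → PresentedAlgebra
  | _, 0 => 1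
  | false, n + 1 => gen 0 * word true n
  | true, n + 1 => gen 1 * word false n

theorem span_word : Submodule.span ℂ (Set.range fun p : Bool × ℕ => word p.1 p.2) = ⊤ := by
  set N := Submodule.span ℂ (Set.range fun p : Bool × ℕ => word p.1 p.2) with hN
  have hw : ∀ b n, word b n ∈ N := fun b n => Submodule.subset_span ⟨(b, n), rfl⟩
  refine eq_top_of_gen_mul_mem N (hw true 0) fun i a ha => ?_
  rw [hN] at ha
  induction ha using Submodule.span_induction with
  | mem x hx =>
    obtain ⟨⟨b, n⟩, rfl⟩ := hx
    fin_cases i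
    · cases b
      · cases n with
        | zero => exact hw false 1
        | succ n =>
          change gen 0 * (gen 0 * word true n) ∈ N
          rw [← mul_assoc, gen_zero_mul_self, add_mul, smul_mul_assoc, one_mul]
          exact N.add_mem (hw false (n + 1)) (N.smul_mem 2 (hw true n))
      · exact hw false (n + 1)
    · cases b
      · exact hw true (n + 1)
      · cases n with
        | zero => exact hw true 1
        | succ n =>
          change gen 1 * (gen 1 * word false n) ∈ N
          rw [← mul_assoc, gen_one_mul_self, one_mul]
          exact hw false n
  | zero => rw [mul_zero]; exact N.zero_mem
  | add x y _ _ hx hy => rw [mul_add]; exact N.add_mem hx hy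
  | smul c x _ hx => rw [mul_smul_comm]; exact N.smul_mem c hx

variable {γ : Subgroup.center DoubleCover →* ℂˣ} (hγ : γ muNegOne = -1)

variable (γ) in
/-- The operators `opT` and `opU` on the Hecke algebra. -/
noncomputable def heckeOp : Fin 2 → Module.End ℂ (heckeSpace γ) :=
  ![(opT γ).restrict fun _ hF => opT_mem hF, (opU γ).restrict fun _ hF => opU_mem hF]

theorem leftEquivariant_coe (F : heckeSpace γ) : LeftEquivariant γ (F : DoubleCover → ℂ) :=
  (mem_heckeSpace_iff.1 F.2).2.1

theorem rightEquivariant_coe (F : heckeSpace γ) : RightEquivariant γ (F : DoubleCover → ℂ) :=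
  (mem_heckeSpace_iff.1 F.2).2.2

/-- The action of the presented algebra on the Hecke algebra by convolution from the left. -/
noncomputable def heckeAction : PresentedAlgebra →ₐ[ℂ] Module.End ℂ (heckeSpace γ) :=
  RingQuot.liftAlgHom ℂ ⟨FreeAlgebra.lift ℂ (heckeOp γ), by
    intro x y hxy
    cases hxy with
    | quadratic =>
      have e : (FreeAlgebra.lift ℂ (heckeOp γ)) 2 = 2 := map_ofNat _ 2
      rw [map_mul, map_sub, map_add, map_one, map_zero, FreeAlgebra.lift_ι_apply, e]
      refine LinearMap.ext fun F => Subtype.ext ?_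
      have h := opT_opT hγ (leftEquivariant_coe F)
      have e2 : ((heckeOp γ 0 - 2) * (heckeOp γ 0 + 1) : Module.End ℂ (heckeSpace γ)) =
          heckeOp γ 0 * heckeOp γ 0 - (heckeOp γ 0 + (2 : ℂ) • 1) := by
        rw [two_smul, one_add_one_eq_two, sub_two_mul_add_one]
      rw [e2]
      change opT γ (opT γ F) - (opT γ F + (2 : ℂ) • (F : DoubleCover → ℂ)) = 0
      rw [h, sub_self]
    | involution =>
      rw [map_pow, map_one, FreeAlgebra.lift_ι_apply, pow_two]
      exact LinearMap.ext fun F => Subtype.ext (opU_opU hγ (leftEquivariant_coe F))⟩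

theorem heckeAction_gen (i : Fin 2) : heckeAction hγ (gen i) = heckeOp γ i := by
  rw [heckeAction, gen, RingQuot.liftAlgHom_mkAlgHom_apply, FreeAlgebra.lift_ι_apply]

/-- The linear map from the presented algebra to the Hecke algebra that is given by the action on
the unit. -/
noncomputable def toHecke : PresentedAlgebra →ₗ[ℂ] heckeSpace γ :=
  (LinearMap.applyₗ (⟨unitFn γ, unitFn_mem γ⟩ : heckeSpace γ)).comp (heckeAction hγ).toLinearMap

theorem toHecke_apply (a : PresentedAlgebra) :
    toHecke hγ a = heckeAction hγ a ⟨unitFn γ, unitFn_mem γ⟩ := rfl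

theorem toHecke_one : (toHecke hγ 1 : DoubleCover → ℂ) = unitFn γ := by
  rw [toHecke_apply, map_one]
  rfl

theorem toHecke_mul (a b : PresentedAlgebra) :
    toHecke hγ (a * b) = heckeAction hγ a (toHecke hγ b) := by
  rw [toHecke_apply, map_mul]
  rfl

theorem toHecke_gen_zero_mul (a : PresentedAlgebra) :
    (toHecke hγ (gen 0 * a) : DoubleCover → ℂ) = opT γ (toHecke hγ a) := by
  rw [toHecke_mul, heckeAction_gen]
  rfl

theorem toHecke_gen_one_mul (a : PresentedAlgebra) :
    (toHecke hγ (gen 1 * a) : DoubleCover → ℂ) = opU γ (toHecke hγ a) := by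
  rw [toHecke_mul, heckeAction_gen]
  rfl

/-- Convolution with the image of `a` is the action of `a`. -/
theorem conv_toHecke (μ : Measure DoubleCover) [μ.IsHaarMeasure] (hμ : μ K₀ = 1)
    (a : PresentedAlgebra) (f : heckeSpace γ) :
    conv μ (toHecke hγ a) (f : DoubleCover → ℂ) = heckeAction hγ a f := by
  let N : Submodule ℂ PresentedAlgebra :=
    { carrier := {a | ∀ f : heckeSpace γ,
        conv μ (toHecke hγ a) (f : DoubleCover → ℂ) = heckeAction hγ a f}
      zero_mem' := fun f => by
        funext g
        simp [conv]
      add_mem' := by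
        intro a b ha hb f
        rw [map_add, map_add, Submodule.coe_add, conv_add μ (toHecke hγ a).2 (toHecke hγ b).2 f.2,
          ha f, hb f]
        rfl
      smul_mem' := by
        intro c a ha f
        rw [map_smul, map_smul, Submodule.coe_smul, conv_smul, ha f]
        rfl }
  have hN : N = ⊤ := by
    refine eq_top_of_gen_mul_mem N (fun f => ?_) fun i a ha f => ?_
    · rw [toHecke_one, conv_unitFn μ hμ (leftEquivariant_coe f), map_one]
      rfl
    · rw [map_mul (heckeAction hγ), heckeAction_gen]
      fin_cases i
      · refine (congrArg (fun F => conv μ F f) (toHecke_gen_zero_mul hγ a)).trans ?_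
        rw [conv_opT μ (toHecke hγ a).2 f.2, ha f]
        rfl
      · refine (congrArg (fun F => conv μ F f) (toHecke_gen_one_mul hγ a)).trans ?_
        rw [conv_opU μ, ha f]
        rfl
  have ha : a ∈ N := hN ▸ Submodule.mem_top
  exact ha f

end presentation

/-! ### Values at the representatives of the affine Weyl group -/

section values

variable {γ : Subgroup.center DoubleCover →* ℂˣ} (hγ : γ muNegOne = -1)

theorem upper_mul_pt (n : ℕ) :
    (∀ b : ℚ_[2], ‖b‖ ≤ 1 → ∃ k ∈ K₁, upper b * pt true n = pt true n * k) ∧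
    (∀ c : ℚ_[2], ‖c‖ ≤ 1 / 4 → ∃ k ∈ K₁, lower c * pt false n = pt false n * k) := by
  induction n with
  | zero =>
    exact ⟨fun b hb => ⟨_, upper_mem_K₁ hb, by simp [pt]⟩,
      fun c hc => ⟨_, lower_mem_K₁ hc, by simp [pt]⟩⟩
  | succ n ih =>
    constructor
    · intro b hb
      obtain ⟨k, hk, e⟩ := ih.2 (-b / ((two ^ (-1 : ℤ) : ℚ_[2]ˣ) : ℚ_[2]) ^ 2) (by
        rw [two_pow_val, norm_div, norm_neg, norm_pow, norm_zpow, norm_two]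
        norm_num
        linarith)
      exact ⟨k, hk, by rw [pt, ← mul_assoc, upper_mul_w, mul_assoc, e, mul_assoc]⟩
    · intro c hc
      obtain ⟨k, hk, e⟩ := ih.1 (-c) (by
        rw [norm_neg]
        linarith)
      exact ⟨k, hk, by rw [pt, ← mul_assoc, lower_mul_w_one, mul_assoc, e, mul_assoc]⟩

theorem w_one_inv_mul (hγ : γ muNegOne = -1) {F : DoubleCover → ℂ} (hF : LeftEquivariant γ F)
    (g : DoubleCover) : F ((w 1)⁻¹ * g) = (γ hNegOne : ℂ) * F (w 1 * g) := by
  have e : (w 1)⁻¹ * g = ((hNegOne⁻¹ : Subgroup.center DoubleCover) : DoubleCover) * (w 1 * g) := by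
    rw [Subgroup.coe_inv, ← w_one_sq]
    group
  rw [e, hF.center_mul, gamma_hNegOne_inv hγ, star_star]

theorem w_half_inv_mul (hγ : γ muNegOne = -1) {F : DoubleCover → ℂ} (hF : LeftEquivariant γ F)
    (g : DoubleCover) :
    F ((w (two ^ (-1 : ℤ)))⁻¹ * g) = (γ hNegOne : ℂ) * F (w (two ^ (-1 : ℤ)) * g) := by
  have e : (w (two ^ (-1 : ℤ)))⁻¹ * g =
      ((hNegOne⁻¹ : Subgroup.center DoubleCover) : DoubleCover) *
        (w (two ^ (-1 : ℤ)) * g) := by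
    rw [Subgroup.coe_inv, ← w_half_sq]
    group
  rw [e, hF.center_mul, gamma_hNegOne_inv hγ, star_star]

theorem star_zeta_ne_zero (hγ : γ muNegOne = -1) : star (zeta γ) ≠ 0 :=
  right_ne_zero_of_mul_eq_one (zeta_mul_star_zeta hγ)

theorem opU_pt_true (F : DoubleCover → ℂ) (n : ℕ) :
    opU γ F (pt true (n + 1)) = star (zeta γ) * F (pt false n) := by
  rw [opU_apply, pt, inv_mul_cancel_left]

theorem opU_pt_false (hγ : γ muNegOne = -1) {F : DoubleCover → ℂ} (hF : LeftEquivariant γ F)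
    (n : ℕ) : opU γ F (pt false n) =
      star (zeta γ) * (γ hNegOne : ℂ) * F (pt true (n + 1)) := by
  rw [opU_apply, w_half_inv_mul hγ hF, pt, mul_assoc]

variable (γ) in
/-- The factor with which the operator of convolution with `T_w` lengthens an argument. -/
noncomputable def raiseFactor : ℂ :=
  star (zeta γ) / (Real.sqrt 2 : ℝ) * (4 * (γ hNegOne : ℂ))

theorem raiseFactor_ne_zero (hγ : γ muNegOne = -1) : raiseFactor γ ≠ 0 := by
  have h2 : ((Real.sqrt 2 : ℝ) : ℂ) ≠ 0 := by
    intro h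
    have := sqrt_two_sq
    rw [h] at this
    norm_num at this
  exact mul_ne_zero (div_ne_zero (star_zeta_ne_zero hγ) h2)
    (mul_ne_zero (by norm_num) (Units.ne_zero _))

/-- At an alternating product that does not begin with `w(1)`, all cosets contribute equally. -/
theorem opT_pt_true (hγ : γ muNegOne = -1) {F : DoubleCover → ℂ} (hl : LeftEquivariant γ F)
    (hr : RightEquivariant γ F) (n : ℕ) :
    opT γ F (pt true n) = raiseFactor γ * F (pt false (n + 1)) := by
  have e : ∀ j : ℕ, F ((w 1)⁻¹ * (upper (-(j : ℚ_[2])) * pt true n)) =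
      (γ hNegOne : ℂ) * F (pt false (n + 1)) := fun j => by
    obtain ⟨k, hk, e⟩ := (upper_mul_pt n).1 (-(j : ℚ_[2])) (by
      rw [norm_neg]
      exact_mod_cast Padic.norm_int_le_one (p := 2) j)
    rw [e, ← mul_assoc, hr.mul_K₁ hk, w_one_inv_mul hγ hl, pt]
  rw [opT_apply, cosetSum, Finset.sum_congr rfl fun j _ => e j, raiseFactor]
  simp
  ring

/-- At an alternating product that begins with `w(1)`, the value follows from the quadratic
relation. -/
theorem opT_pt_false (hγ : γ muNegOne = -1) {F : DoubleCover → ℂ} (hl : LeftEquivariant γ F)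
    (hr : RightEquivariant γ F) (hr' : RightEquivariant γ (opT γ F)) (n : ℕ) :
    opT γ F (pt false (n + 1)) = F (pt false (n + 1)) + 2 / raiseFactor γ * F (pt true n) := by
  have h1 := opT_pt_true hγ hl.opT hr' n
  rw [opT_opT hγ hl, Pi.add_apply, opT_pt_true hγ hl hr, Pi.smul_apply, smul_eq_mul] at h1
  have h0 := raiseFactor_ne_zero hγ
  field_simp
  linear_combination -h1

/-- The function of an alternating word vanishes at all alternating products except the one that
corresponds to the word. -/
theorem toHecke_word_pt (n : ℕ) : ∀ (b b' : Bool) (n' : ℕ),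
    (toHecke hγ (word b n) : DoubleCover → ℂ) (pt b' n') ≠ 0 ↔
      (n = 0 ∧ n' = 0) ∨ (b = b' ∧ n = n') := by
  have one : ∀ (b b' : Bool) (n' : ℕ), (toHecke hγ (word b 0) : DoubleCover → ℂ) (pt b' n') ≠ 0 ↔
      n' = 0 := by
    intro b b' n'
    have e : word b 0 = 1 := by cases b <;> rfl
    rw [e, toHecke_one, unitFn_ne_zero_iff, pt_mem_K₀_iff]
  induction n with
  | zero =>
    intro b b' n'
    rw [one]
    grind
  | succ n ih =>
    have hz := star_zeta_ne_zero hγ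
    have hM : (γ hNegOne : ℂ) ≠ 0 := Units.ne_zero _
    have hR := raiseFactor_ne_zero hγ
    intro b b' n'
    cases b
    · have hl := leftEquivariant_coe (toHecke hγ (word true n))
      have hr := rightEquivariant_coe (toHecke hγ (word true n))
      rw [word, toHecke_gen_zero_mul]
      cases b'
      · cases n' with
        | zero =>
          have e : pt false 0 = pt true 0 := rfl
          have h := (ih true false 1).not
          rw [not_not] at h
          rw [e, opT_pt_true hγ hl hr, h.2 (by grind), mul_zero]
          simp
        | succ n' =>
          have hr' := rightEquivariant_coe (toHecke hγ (gen 0 * word true n))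
          rw [toHecke_gen_zero_mul] at hr'
          have h := (ih true false (n' + 1)).not
          rw [not_not] at h
          rw [opT_pt_false hγ hl hr hr', h.2 (by grind), zero_add,
            mul_ne_zero_iff_left (div_ne_zero two_ne_zero hR), ih true true n']
          grind
      · have h := (ih true false (n' + 1)).not
        rw [not_not] at h
        rw [opT_pt_true hγ hl hr, h.2 (by grind), mul_zero]
        grind
    · have hl := leftEquivariant_coe (toHecke hγ (word false n))
      rw [word, toHecke_gen_one_mul]
      have key : ∀ m, opU γ (toHecke hγ (word false n) : DoubleCover → ℂ) (pt false m) = 0 := by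
        intro m
        have h := (ih false true (m + 1)).not
        rw [not_not] at h
        rw [opU_pt_false hγ hl, h.2 (by grind), mul_zero]
      cases b'
      · rw [key]
        grind
      · cases n' with
        | zero =>
          have e : pt true 0 = pt false 0 := rfl
          rw [e, key]
          simp
        | succ n' =>
          rw [opU_pt_true, mul_ne_zero_iff_left hz, ih false false n']
          grind

end values

/-! ### Bijectivity -/

section basis

variable {γ : Subgroup.center DoubleCover →* ℂˣ} (hγ : γ muNegOne = -1)

/-- An enumeration of the alternating words without repetition: the empty word, which `word`
produces for both values of the first letter, occurs only once. -/
def label : Option (Bool × ℕ) → Bool × ℕ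
  | none => (false, 0)
  | some (b, n) => (b, n + 1)

theorem exists_label (b : Bool) (n : ℕ) :
    ∃ i, pt b n = pt (label i).1 (label i).2 ∧ word b n = word (label i).1 (label i).2 := by
  cases n with
  | zero => exact ⟨none, by cases b <;> rfl, by cases b <;> rfl⟩
  | succ n => exact ⟨some (b, n), rfl, rfl⟩

theorem toHecke_label (i j : Option (Bool × ℕ)) :
    (toHecke hγ (word (label i).1 (label i).2) : DoubleCover → ℂ)
      (pt (label j).1 (label j).2) ≠ 0 ↔ i = j := by
  rw [toHecke_word_pt]
  rcases i with _ | ⟨b, n⟩ <;> rcases j with _ | ⟨b', n'⟩ <;> simp [label]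

theorem toHecke_sum (c : Option (Bool × ℕ) →₀ ℂ) (j : Option (Bool × ℕ)) :
    (toHecke hγ (c.sum fun i a => a • word (label i).1 (label i).2) : DoubleCover → ℂ)
      (pt (label j).1 (label j).2) =
    c j * (toHecke hγ (word (label j).1 (label j).2) : DoubleCover → ℂ)
      (pt (label j).1 (label j).2) := by
  rw [Finsupp.sum, map_sum, AddSubmonoidClass.coe_finsetSum, Finset.sum_apply]
  rw [Finset.sum_eq_single j]
  · rw [map_smul]
    rfl
  · intro i _ hij
    rw [map_smul, Submodule.coe_smul, Pi.smul_apply, smul_eq_mul]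
    have h := (toHecke_label hγ i j).not
    rw [not_not] at h
    rw [h.2 hij, mul_zero]
  · intro hj
    rw [Finsupp.notMem_support_iff.1 hj, zero_smul, map_zero]
    rfl

theorem toHecke_injective : Function.Injective (toHecke hγ) := by
  refine (injective_iff_map_eq_zero (toHecke hγ)).2 fun a ha => ?_
  have hspan : a ∈ Submodule.span ℂ
      (Set.range fun i : Option (Bool × ℕ) => word (label i).1 (label i).2) := by
    have e : Set.range (fun p : Bool × ℕ => word p.1 p.2) ⊆
        Set.range fun i : Option (Bool × ℕ) => word (label i).1 (label i).2 := by
      rintro _ ⟨⟨b, n⟩, rfl⟩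
      obtain ⟨i, -, hi⟩ := exists_label b n
      exact ⟨i, hi.symm⟩
    refine Submodule.span_mono e ?_
    rw [span_word]
    exact Submodule.mem_top
  obtain ⟨c, rfl⟩ := Finsupp.mem_span_range_iff_exists_finsupp.1 hspan
  have hc : c = 0 := by
    ext j
    have h := toHecke_sum hγ c j
    rw [ha] at h
    exact (mul_eq_zero.1 h.symm).resolve_right ((toHecke_label hγ j j).2 rfl)
  rw [hc]
  simp

/-- By compactness of its support, a function in the Hecke algebra vanishes at almost all of the
representatives, which lie in different cosets of `K₀`. -/
theorem finite_support_pt (hγ : γ muNegOne = -1) (f : heckeSpace γ) :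
    {i | (f : DoubleCover → ℂ) (pt (label i).1 (label i).2) ≠ 0}.Finite := by
  obtain ⟨hc, -, -⟩ := mem_heckeSpace_iff.1 f.2
  obtain ⟨t, ht⟩ := IsCompact.elim_finite_subcover hc
    (fun x : DoubleCover => leftHomeo x⁻¹ ⁻¹' K₀)
    (fun x => isOpen_K₀.preimage (leftHomeo x⁻¹).continuous) fun x _ =>
      Set.mem_iUnion.2 ⟨x, by simpa [leftHomeo_apply] using K₀_one⟩
  refine (t.finite_toSet.biUnion
    (t := fun x => {i | x⁻¹ * pt (label i).1 (label i).2 ∈ K₀}) fun x _ => ?_).subset fun i hi => ?_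
  · refine Set.Subsingleton.finite fun i hi j hj => ?_
    rw [← toHecke_label hγ i j]
    have e : pt (label j).1 (label j).2 = pt (label i).1 (label i).2 *
        ((x⁻¹ * pt (label i).1 (label i).2)⁻¹ * (x⁻¹ * pt (label j).1 (label j).2)) := by
      group
    have hk := K₀_mul (K₀_inv hi) hj
    rw [e, rightEquivariant_coe (toHecke hγ _) _ hk]
    exact mul_ne_zero ((toHecke_label hγ i i).2 rfl) (star_ne_zero.2 (gammaK₀_ne_zero γ hk))
  · have h1 := ht (subset_tsupport _ hi)
    simpa [leftHomeo_apply] using h1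

theorem toHecke_surjective : Function.Surjective (toHecke hγ) := by
  classical
  intro f
  have hfin := finite_support_pt hγ f
  set c : Option (Bool × ℕ) →₀ ℂ := Finsupp.onFinset hfin.toFinset
    (fun j => (f : DoubleCover → ℂ) (pt (label j).1 (label j).2) /
      (toHecke hγ (word (label j).1 (label j).2) : DoubleCover → ℂ)
        (pt (label j).1 (label j).2)) (fun j hj => by
      rw [Set.Finite.mem_toFinset]
      exact fun h => hj (by rw [h, zero_div])) with hc
  refine ⟨c.sum fun i a => a • word (label i).1 (label i).2, ?_⟩
  rw [← sub_eq_zero]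
  refine Subtype.ext (eq_zero_of_pt hγ (leftEquivariant_coe _) (rightEquivariant_coe _)
    fun b n => ?_)
  obtain ⟨j, hj, -⟩ := exists_label b n
  rw [hj, Submodule.coe_sub, Pi.sub_apply, toHecke_sum, hc, Finsupp.onFinset_apply,
    div_mul_cancel₀ _ ((toHecke_label hγ j j).2 rfl), sub_self]

theorem toHecke_bijective : Function.Bijective (toHecke hγ) :=
  ⟨toHecke_injective hγ, toHecke_surjective hγ⟩

end basis

end DoubleCover

theorem mainTheorem2 (γ : Subgroup.center DoubleCover →* ℂˣ)
    (hγ : γ DoubleCover.muNegOne = -1)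
    (μ : MeasureTheory.Measure DoubleCover) [μ.IsHaarMeasure]
    (hμ : μ DoubleCover.K₀ = 1) :
    ∃ Φ : DoubleCover.PresentedAlgebra ≃ₗ[ℂ] DoubleCover.heckeSpace γ,
      (∀ a b : DoubleCover.PresentedAlgebra, (Φ (a * b) : DoubleCover → ℂ) =
        DoubleCover.conv μ (Φ a : DoubleCover → ℂ) (Φ b : DoubleCover → ℂ)) ∧
      (Φ 1 : DoubleCover → ℂ) = DoubleCover.X γ 1 ∧
      (Φ (DoubleCover.gen 0) : DoubleCover → ℂ) = DoubleCover.Tw γ ∧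
      (Φ (DoubleCover.gen 1) : DoubleCover → ℂ) = DoubleCover.U γ 1 := by
  refine ⟨LinearEquiv.ofBijective (DoubleCover.toHecke hγ) (DoubleCover.toHecke_bijective hγ),
    fun a b => ?_, ?_, ?_, ?_⟩
  · simp only [LinearEquiv.ofBijective_apply]
    rw [DoubleCover.conv_toHecke hγ μ hμ, DoubleCover.toHecke_mul]
  · rw [LinearEquiv.ofBijective_apply, DoubleCover.toHecke_one, DoubleCover.unitFn_eq_X hγ]
  · rw [LinearEquiv.ofBijective_apply, ← mul_one (DoubleCover.gen 0),
      DoubleCover.toHecke_gen_zero_mul, DoubleCover.toHecke_one, DoubleCover.opT_unitFn hγ]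
  · rw [LinearEquiv.ofBijective_apply, ← mul_one (DoubleCover.gen 1),
      DoubleCover.toHecke_gen_one_mul, DoubleCover.toHecke_one, DoubleCover.opU_unitFn hγ]
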